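/- **Conventions.** $n$ is the security parameter, given in unary. All algorithms are probabilistic polynomial time (PPT); $f$ is negligible if $n^c f(n)\to 0$ for every $c$. An oracle adversary is PPT if, against every oracle with polynomially bounded answers, its running time is bounded by a polynomial in its input length, for all coins and answers. Oracles may refuse with $\bot$. **Building blocks.** *DAA scheme.* $\mathsf{Setup}_{DAA}(1^n)$ outputs the issuer's keys $(pk,sk_I)$; a signer samples a key $sk$; $\mathsf{Join}_{DAA}(pk,sk;r)$ outputs $com$ from uniform coins $r\in\{0,1\}^{\ell(n)}$ ($\ell$ a polynomial); $\mathsf{Issue}_{DAA}(sk_I,com)$ outputs a credential $cred$; $\mathsf{Sign}_{DAA}(sk,cred,dom,m)$ outputs a signature, where the basename $dom$ is a string or $\bot$; $\mathsf{Verify}_{DAA}(pk,m,dom,\sigma,RL)\in\{0,1\}$ and $\mathsf{Link}(\sigma,\sigma')\in\{0,1,\bot\}$ are deterministic. For $dom\ne\bot$, the revocation list $RL$ (of secret keys) invalidates exactly the signatures created with a revoked key: $\mathsf{Verify}_{DAA}(pk,m,dom,\sigma,RL)=1$ iff $\mathsf{Verify}_{DAA}(pk,m,dom,\sigma,\emptyset)=1$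 and no $sk\in RL$ can produce, for any $cred,m'$, a signature $\sigma'$ of $\mathsf{Sign}_{DAA}(sk,cred,dom,m')$ with $\mathsf{Link}(\sigma,\sigma')=1$. *User-controlled traceability.* Every PPT adversary wins the following game with negligible probability only. The challenger runs $\mathsf{Setup}_{DAA}$, gives $pk$ to the adversary, and keeps a list $RL$, initially empty. Each identity $S$ can be joined only once. Queries: $\mathsf{HJoin}(S)$: the challenger runs Join and Issue with a fresh key and fresh coins for $S$ and returns $cred$. $\mathsf{Join}(S,sk,r)$, with $|r|=\ell(n)$: the adversary plays the signer; the challenger returns $cred\leftarrow\mathsf{Issue}_{DAA}(sk_I,\mathsf{Join}_{DAA}(pk,sk;r))$ and puts $sk$ on $RL$. $\mathsf{Sign}(S,dom,m)$: returns a signature under the key and credential of $S$. $\mathsf{Corrupt}(S)$: returns the key of $S$ and puts it on $RL$. The adversary outputs $(S,\sigma,m,dom)$ and wins if (1) $\mathsf{Verify}_{DAA}(pk,m,dom,\sigma,RL)=1$ and $\sigma$ is not the response to any query $\mathsf{Sign}(\cdot,dom,m)$, or (2) $dom\neq\bot$, $\sigma$ was returned by a query $\mathsf{Sign}(S,dom,\cdot)$,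 and some query $\mathsf{Sign}(S,dom,\cdot)$ returned a $\sigma'$ with $\mathsf{Link}(\sigma,\sigma')=0$. *Instant linkability.* There are deterministic polynomial-time $\mathsf{NymGen}$, $\mathsf{NymExtract}$, $\mathsf{VerifyBsn}$ such that, for basenames $dom\ne\bot$, $\mathsf{NymGen}(sk,dom)=\mathsf{NymExtract}(\mathsf{Sign}_{DAA}(sk,cred,dom,m))$ always; $\mathsf{Link}(\sigma_1,\sigma_2)=1$ iff $\mathsf{NymExtract}(\sigma_1)=\mathsf{NymExtract}(\sigma_2)$; and every PPT algorithm outputs, with negligible probability only, $(dom,dom',\sigma,pk,m)$ with $dom\neq dom'$, $\mathsf{VerifyBsn}(\sigma,dom)=\mathsf{VerifyBsn}(\sigma,dom')=1$ and $\mathsf{Verify}_{DAA}(pk,m,dom,\sigma,\emptyset)=1$. *Hash.* $h=(h_n)$ is deterministic polynomial-time and collision resistant: every PPT algorithm on input $1^n$ outputs $m_1\ne m_2$ with $h_n(m_1)=h_n(m_2)$ with negligible probability only. *Proof of knowledge.* $(\mathsf{Setup}_{ZK},\mathsf{CreateProof},\mathsf{VerifyProof})$ is a perfectly complete non-interactive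 proof system for $R_{Join}=\{((com,pk),(sk,r)): |r|=\ell(n),\ com=\mathsf{Join}_{DAA}(pk,sk;r)\}$ and a proof of knowledge: there are PPT $E_1,E_2$ such that, with $(\rho,\tau)\leftarrow E_1(1^n)$, the string $\rho$ is indistinguishable from $\mathsf{Setup}_{ZK}(1^n)$ for PPT algorithms with negligible error, and for every algorithm producing $(x,\pi)$ from $\rho$, with probability $1$ either $\mathsf{VerifyProof}(\rho,x,\pi)=0$ or $(x,E_2(\rho,\tau,x,\pi))\in R_{Join}$. **TrollThrottle.** Setup: $\rho=(1^n,\rho_J)$ with $\rho_J\leftarrow\mathsf{Setup}_{ZK}(1^n)$. The issuer's keys are those of $\mathsf{Setup}_{DAA}(1^n)$. Join-Issue: the user sends $com\leftarrow\mathsf{Join}_{DAA}(pk,sk_U;r)$ and a proof $\Pi$ for $(com,pk)$ with witness $(sk_U,r)$; the issuer aborts if $\Pi$ is rejected and otherwise returns $cred_U\leftarrow\mathsf{Issue}_{DAA}(sk_I,com)$. Comment on $(dom,m)$, $dom\ne\bot$: $\gamma=(\sigma,nym,dom,h(m))$ with $\sigma\leftarrow\mathsf{Sign}_{DAA}(sk_U,cred_U,dom,h(m))$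 and $nym=\mathsf{NymGen}(sk_U,dom)$. $\mathsf{Verify}(pk,nym,dom,m,\gamma)=1$ iff $\gamma=(\sigma,nym,dom,h^*)$ with the given $nym$ and $dom$, $\mathsf{Verify}_{DAA}(pk,h^*,dom,\sigma,\emptyset)=1$, $h(m)=h^*$, $\mathsf{NymExtract}(\sigma)=nym$ and $\mathsf{VerifyBsn}(\sigma,dom)=1$. **Trolling experiment.** Sets $CU,HU,VM,USK,COMM$ and the table $ver$ are initially empty. The adversary gets $(\rho,pk)$ and the oracles: - $\mathsf{CorruptUser}(U)$: return $(sk_U,cred_U)$ if recorded in $USK$, else $\bot$; add $U$ to $CU$ and remove it from $HU$. - $\mathsf{CorruptVer}(U,V)$: set $ver[V,U]=1$ and add $(V,U)$ to $VM$. - $\mathsf{CreateHonestUser}(U,V)$: refuse if $U\in HU\cup CU$; else set $ver[V,U]=1$, run Join-Issue honestly with a fresh key, record $(U,sk_U,cred_U,V)$ in $USK$, add $U$ to $HU$ and return $cred_U$ (on abort, return $\bot$ and record nothing). - $\mathsf{JoinSystem}(U,V)$: refuse unless $U\notin HU\cup CU$, $ver[V,U]=1$ and $U$ has not yet obtained a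 credential through this oracle; else run Issue with the adversary as the user. - $\mathsf{CreateComment}(U,dom,m)$: refuse unless $U\in HU$; else create $(nym,\gamma)$ with Comment, add $(U,nym,dom,m,\gamma)$ to $COMM$ and return $(\gamma,nym)$. The adversary outputs a finite list of tuples $(nym_i,dom_i,m_i,\gamma_i)$. It wins if all of them satisfy $\mathsf{Verify}=1$ and, after deleting the tuples recorded in $COMM$, some basename $dom$ occurs with more than $|CU|+|VM|$ distinct pseudonyms. **Theorem (Protection against trolling).** If the DAA scheme is user-controlled traceable and instantly linkable, the hash function is collision resistant and the proof system for $R_{Join}$ is a proof of knowledge, then every PPT adversary wins the trolling experiment for TrollThrottle with negligible probability only. -/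

import Mathlib

noncomputable section

/-! ## Data

All keys, messages, signatures, … are finite objects, represented as binary trees. Bit strings,
numbers, tuples and lists are embedded by `Coded`; natural numbers are written in unary, so that
the security parameter `n` is handed to algorithms as `1ⁿ`. -/

/-- Finite binary trees: the data on which algorithms operate. -/
inductive Data : Type
  | nil : Data
  | pair : Data → Data → Data
  deriving DecidableEq

/-- The number of nodes of a tree: the length of the datum. -/
def Data.size : Data → ℕ
  | .nil => 1
  | .pair a b => 1 + a.size + b.size

/-- Types with a fixed encoding as data. -/
class Coded (α : Type) where
  code : α → Data
  decode : Data → Option α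
  decode_code : ∀ a, decode (code a) = some a

instance : Coded Data where
  code a := a
  decode a := some a
  decode_code _ := rfl

instance : Coded Bool where
  code b := if b then .pair .nil .nil else .nil
  decode
    | .nil => some false
    | .pair .nil .nil => some true
    | _ => none
  decode_code b := by cases b <;> rfl

/-- Unary numerals. -/
def Data.ofNat : ℕ → Data
  | 0 => .nil
  | n + 1 => .pair .nil (Data.ofNat n)

def Data.toNat : Data → Option ℕ
  | .nil => some 0
  | .pair .nil b => (Data.toNat b).map (· + 1)
  | .pair (.pair _ _) _ => none

theorem Data.toNat_ofNat (n : ℕ) : Data.toNat (Data.ofNat n) = some n := by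
  induction n with
  | zero => rfl
  | succ n ih => simp [Data.ofNat, Data.toNat, ih]

instance : Coded ℕ where
  code := Data.ofNat
  decode := Data.toNat
  decode_code := Data.toNat_ofNat

instance {α β : Type} [Coded α] [Coded β] : Coded (α × β) where
  code x := .pair (Coded.code x.1) (Coded.code x.2)
  decode
    | .nil => none
    | .pair a b => (Coded.decode a).bind fun x => (Coded.decode b).map fun y => (x, y)
  decode_code x := by simp [Coded.decode_code]

instance {α : Type} [Coded α] : Coded (Option α) where
  code
    | none => .nil
    | some a => .pair .nil (Coded.code a)
  decode
    | .nil => some none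
    | .pair .nil a => (Coded.decode a).map some
    | .pair (.pair _ _) _ => none
  decode_code x := by cases x <;> simp [Coded.decode_code]

def Data.ofList {α : Type} [Coded α] : List α → Data
  | [] => .nil
  | a :: l => .pair (Coded.code a) (Data.ofList l)

def Data.toList {α : Type} [Coded α] : Data → Option (List α)
  | .nil => some []
  | .pair a b => (Coded.decode a).bind fun x => (Data.toList b).map fun l => x :: l

theorem Data.toList_ofList {α : Type} [Coded α] (l : List α) :
    Data.toList (Data.ofList l) = some l := by
  induction l with
  | nil => rfl
  | cons a l ih => simp [Data.ofList, Data.toList, ih, Coded.decode_code]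

instance {α : Type} [Coded α] : Coded (List α) where
  code := Data.ofList
  decode := Data.toList
  decode_code := Data.toList_ofList

/-! ## Probabilistic oracle programs with a step count -/

/-- A small programming language. A program maps data to data; `flip` tosses a fair coin, `query`
sends its input to the oracle and returns the answer, and `loop p`, on an input `pair c s`,
applies `p` to `s` as many times as the size of `c` says. All programs halt; since a polynomial-time
algorithm can be run under a clock of polynomial size (clocks of size `|x| ^ k` are built with nested
loops), this loses no polynomial-time algorithm. -/
inductive Prog : Type
  | id : Prog
  | nil : Prog
  | fst : Prog
  | snd : Prog
  | eq : Prog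
  | flip : Prog
  | query : Prog
  | pair : Prog → Prog → Prog
  | comp : Prog → Prog → Prog
  | ite : Prog → Prog → Prog → Prog
  | loop : Prog → Prog

/-- Run the step `f` for `k` rounds from `x`, adding up the costs. -/
def iterateCost {m : Type → Type} [Monad m] (f : Data → m (Data × ℕ)) : ℕ → Data → m (Data × ℕ)
  | 0, x => pure (x, 0)
  | k + 1, x => do
      let y ← f x
      let z ← iterateCost f k y.1
      pure (z.1, y.2 + z.2)

/-- The result of an instruction that turned `x` into `y`: it costs one step, plus reading `x`,
plus writing `y`, plus the cost `c` of its sub-programs. -/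
def charge (x y : Data) (c : ℕ) : Data × ℕ := (y, 1 + x.size + y.size + c)

/-- Run a program on an input; the outcome is the output together with the number of steps.
The monad `m` says how coins and oracle answers are resolved. -/
def Prog.exec {m : Type → Type} [Monad m] (coin : m Bool) (oracle : Data → m Data) :
    Prog → Data → m (Data × ℕ)
  | .id, x => pure (charge x x 0)
  | .nil, x => pure (charge x .nil 0)
  | .fst, x => pure (charge x (match x with | .nil => .nil | .pair a _ => a) 0)
  | .snd, x => pure (charge x (match x with | .nil => .nil | .pair _ b => b) 0)
  | .eq, x => pure (charge x
      (match x with | .nil => .nil | .pair a b => Coded.code (decide (a = b))) 0)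
  | .flip, x => do
      let b ← coin
      pure (charge x (Coded.code b) 0)
  | .query, x => do
      let y ← oracle x
      pure (charge x y 0)
  | .pair p q, x => do
      let y ← p.exec coin oracle x
      let z ← q.exec coin oracle x
      pure (charge x (.pair y.1 z.1) (y.2 + z.2))
  | .comp p q, x => do
      let y ← q.exec coin oracle x
      let z ← p.exec coin oracle y.1
      pure (charge x z.1 (y.2 + z.2))
  | .ite p q r, x => do
      let y ← p.exec coin oracle x
      let z ← if y.1 = .nil then r.exec coin oracle x else q.exec coin oracle x
      pure (charge x z.1 (y.2 + z.2))
  | .loop p, x => match x with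
      | .nil => pure (charge .nil .nil 0)
      | .pair c s => do
          let y ← iterateCost (p.exec coin oracle) c.size s
          pure (charge (.pair c s) y.1 y.2)

/-- A fair coin. -/
def fairCoin : PMF Bool := PMF.uniformOfFintype Bool

/-- `n` fair coins. -/
def randomBits (n : ℕ) : PMF (List Bool) :=
  (PMF.uniformOfFintype (Fin n → Bool)).map List.ofFn

/-- Run a program without an oracle (queries are answered by `nil`). -/
def Prog.run (p : Prog) (x : Data) : PMF (Data × ℕ) :=
  p.exec fairCoin (fun _ => pure .nil) x

/-- The randomised map `F` is computed by a probabilistic program whose number of steps is, on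
all coins, at most a polynomial in the length of the input. -/
def PPT {α β : Type} [Coded α] [Coded β] (F : α → PMF β) : Prop :=
  ∃ (p : Prog) (t : Polynomial ℕ), ∀ a : α,
    (p.run (Coded.code a)).map Prod.fst = (F a).map Coded.code ∧
    ∀ y ∈ (p.run (Coded.code a)).support, y.2 ≤ t.eval (Coded.code a).size

/-- Deterministic polynomial time. -/
def PolyTime {α β : Type} [Coded α] [Coded β] (f : α → β) : Prop :=
  PPT fun a => PMF.pure (f a)

/-- A probabilistic polynomial-time oracle program: whatever oracle it is run with, as long as the
oracle's answers are polynomially bounded (an answer to a query `v` has length at most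
`q (|input| + |v|)`), its number of steps is at most a polynomial in the length of the input, on
all coins and for all answers. -/
def Prog.IsOraclePPT (p : Prog) : Prop :=
  ∀ q : Polynomial ℕ, ∃ t : Polynomial ℕ, ∀ x : Data,
    ∀ y ∈ (p.exec (m := SetM) (Set.univ : Set Bool)
        (fun v => ({r | r.size ≤ q.eval (x.size + v.size)} : Set Data)) x).run,
      y.2 ≤ t.eval x.size

/-- Run an oracle program against a stateful randomised oracle; the outcome is the program's
output together with the final state of the oracle. -/
def Prog.interact {σ : Type} (p : Prog) (oracle : Data → σ → PMF (Data × σ)) (x : Data) (s : σ) :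
    PMF (Data × σ) :=
  (StateT.run (p.exec (m := StateT σ PMF) (fun s => fairCoin.map fun b => (b, s)) oracle x) s).map
    fun r => (r.1.1, r.2)

/-! ## Probabilities, negligible functions -/

/-- The probability that an experiment succeeds. -/
def prob (d : PMF Prop) : ℝ := (d True).toReal

/-- `f` is smaller than every inverse polynomial. -/
def Negligible (f : ℕ → ℝ) : Prop :=
  Asymptotics.SuperpolynomialDecay Filter.atTop (fun n : ℕ => (n : ℝ)) f

/-! ## Hash functions -/

/-- A family of hash functions, indexed by the security parameter. -/
structure HashFunction where
  hash : ℕ → Data → Data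
  hash_poly : PolyTime fun x : ℕ × Data => hash x.1 x.2

def HashFunction.CollisionResistant (H : HashFunction) : Prop :=
  ∀ A : ℕ → PMF (Data × Data), PPT A → Negligible fun n => prob do
    let (m₁, m₂) ← A n
    pure (m₁ ≠ m₂ ∧ H.hash n m₁ = H.hash n m₂)

/-! ## Non-interactive proofs of knowledge -/

/-- A non-interactive proof system for the relation `R n` between statements and witnesses
(where `n` is the security parameter), with perfect completeness. -/
structure ProofSystem {X W : Type} [Coded X] [Coded W] (R : ℕ → X → W → Prop) where
  setup : ℕ → PMF Data
  createProof : Data → X → W → PMF Data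
  verifyProof : Data → X → Data → Bool
  setup_ppt : PPT setup
  createProof_ppt : PPT fun x : Data × X × W => createProof x.1 x.2.1 x.2.2
  verifyProof_poly : PolyTime fun x : Data × X × Data => verifyProof x.1 x.2.1 x.2.2
  complete : ∀ n, ∀ ρ ∈ (setup n).support, ∀ x w, R n x w →
    ∀ π ∈ (createProof ρ x w).support, verifyProof ρ x π = true

/-- Knowledge extraction: there are algorithms `E₁`, producing a reference string with a trapdoor,
and `E₂`, using the trapdoor, such that no efficient algorithm can tell the reference strings of
`E₁` from honest ones, and `E₂` always extracts a witness from an accepted proof. -/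
def ProofSystem.IsProofOfKnowledge {X W : Type} [Coded X] [Coded W] {R : ℕ → X → W → Prop}
    (P : ProofSystem R) : Prop :=
  ∃ (E₁ : ℕ → PMF (Data × Data)) (E₂ : Data → Data → X → Data → PMF W),
    PPT E₁ ∧ (PPT fun x : Data × Data × X × Data => E₂ x.1 x.2.1 x.2.2.1 x.2.2.2) ∧
    (∀ A : ℕ × Data → PMF Bool, PPT A → Negligible fun n =>
      |prob (do
          let ρ ← P.setup n
          let b ← A (n, ρ)
          pure (b = true)) -
        prob (do
          let (ρ, _) ← E₁ n
          let b ← A (n, ρ)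
          pure (b = true))|) ∧
    (∀ (A : ℕ → Data → PMF (X × Data)) (n : ℕ),
      prob (do
        let (ρ, τ) ← E₁ n
        let (x, π) ← A n ρ
        let w ← E₂ ρ τ x π
        pure (P.verifyProof ρ x π = false ∨ R n x w)) = 1)

/-! ## Direct anonymous attestation -/

/-- A direct anonymous attestation (DAA) scheme. A basename is a datum or `⊥ = none`. The random
coins of `join` are an explicit argument, a uniform bit string of length `joinCoins n`. -/
structure DAAScheme where
  /-- issuer's key pair `(pk, sk)` -/
  setup : ℕ → PMF (Data × Data)
  /-- fresh secret key of a signer, for security parameter `n` and issuer key `pk` -/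
  userKey : ℕ → Data → PMF Data
  joinCoins : Polynomial ℕ
  /-- commitment computed from `pk`, the signer's secret key and coins -/
  join : Data → Data → List Bool → Data
  /-- credential computed from the issuer's secret key and the commitment -/
  issue : Data → Data → PMF Data
  /-- signature on (secret key, credential, basename, message) -/
  sign : Data → Data → Option Data → Data → PMF Data
  /-- verification of (`pk`, message, basename, signature, revocation list) -/
  verify : Data → Data → Option Data → Data → List Data → Bool
  /-- `some true`: linked, `some false`: unlinked, `none`: invalid -/
  link : Data → Data → Option Bool
  setup_ppt : PPT setup
  userKey_ppt : PPT fun x : ℕ × Data => userKey x.1 x.2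
  join_poly : PolyTime fun x : Data × Data × List Bool => join x.1 x.2.1 x.2.2
  issue_ppt : PPT fun x : Data × Data => issue x.1 x.2
  sign_ppt : PPT fun x : Data × Data × Option Data × Data => sign x.1 x.2.1 x.2.2.1 x.2.2.2
  verify_poly : PolyTime fun x : Data × Data × Option Data × Data × List Data =>
    verify x.1 x.2.1 x.2.2.1 x.2.2.2.1 x.2.2.2.2
  link_poly : PolyTime fun x : Data × Data => link x.1 x.2
  /-- The meaning of a revocation list: on a basename other than `⊥`, it invalidates exactly the
  signatures created with a revoked key, that is, those linked to a signature which that key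
  produces on the same basename. -/
  verify_revocation : ∀ (pk m dom σ : Data) (RL : List Data),
    verify pk m (some dom) σ RL = true ↔
      verify pk m (some dom) σ [] = true ∧
        ∀ sk ∈ RL, ¬ ∃ cred m', ∃ σ' ∈ (sign sk cred (some dom) m').support,
          link σ σ' = some true

/-- A signer in the traceability game. -/
structure DAASigner where
  sk : Data
  cred : Data

/-- The challenger's records in the traceability game: the signers by identity, the revocation
list, and the `Sign` queries (identity, basename, message) with their responses. -/
structure TraceState where
  signers : Data → Option DAASigner
  RL : List Data
  signed : Set (Data × Option Data × Data × Data)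

/-- The queries of the traceability game. In `join S sk r` the adversary plays the signer, with a
secret key and coins of its choice. -/
inductive TraceQuery
  | sign (S : Data) (dom : Option Data) (m : Data)
  | hjoin (S : Data)
  | join (S sk : Data) (r : List Bool)
  | corrupt (S : Data)

def TraceQuery.decode (v : Data) : Option TraceQuery :=
  match (Coded.decode v : Option (ℕ × Data)) with
  | some (0, a) => (Coded.decode a).map
      fun (x : Data × Option Data × Data) => .sign x.1 x.2.1 x.2.2
  | some (1, a) => some (.hjoin a)
  | some (2, a) => (Coded.decode a).map fun (x : Data × Data × List Bool) => .join x.1 x.2.1 x.2.2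
  | some (3, a) => some (.corrupt a)
  | _ => none

/-- The challenger's answers in the traceability game; `none` is `⊥`. An identity can be joined
only once. -/
def DAAScheme.traceAnswer (D : DAAScheme) (n : ℕ) (pk skI : Data) (s : TraceState) :
    TraceQuery → PMF (Option Data × TraceState)
  | .sign S dom m =>
      match s.signers S with
      | none => pure (none, s)
      | some u => do
          let σ ← D.sign u.sk u.cred dom m
          pure (some σ, { s with signed := insert (S, dom, m, σ) s.signed })
  | .hjoin S =>
      match s.signers S with
      | some _ => pure (none, s)
      | none => do
          let sk ← D.userKey n pk
          let r ← randomBits (D.joinCoins.eval n)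
          let cred ← D.issue skI (D.join pk sk r)
          pure (some cred, { s with signers := Function.update s.signers S (some ⟨sk, cred⟩) })
  | .join S sk r =>
      match s.signers S with
      | some _ => pure (none, s)
      | none =>
          if r.length = D.joinCoins.eval n then do
            let cred ← D.issue skI (D.join pk sk r)
            pure (some cred, { s with
              signers := Function.update s.signers S (some ⟨sk, cred⟩)
              RL := sk :: s.RL })
          else pure (none, s)
  | .corrupt S =>
      match s.signers S with
      | none => pure (none, s)
      | some u => pure (some u.sk, { s with RL := u.sk :: s.RL })

def DAAScheme.traceOracle (D : DAAScheme) (n : ℕ) (pk skI : Data) (v : Data) (s : TraceState) :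
    PMF (Data × TraceState) :=
  match TraceQuery.decode v with
  | none => pure (Coded.code (none : Option Data), s)
  | some q => (D.traceAnswer n pk skI s q).map fun x => (Coded.code x.1, x.2)

/-- The winning condition for the forgery `(S, σ, m, dom)`: either `σ` is accepted and is not the
response to a `Sign` query on message `m` and basename `dom`, or `dom ≠ ⊥` and `σ` is unlinked
from another signature of the same signer on the same basename. -/
def DAAScheme.TraceWin (D : DAAScheme) (pk : Data) (s : TraceState)
    (S σ m : Data) (dom : Option Data) : Prop :=
  (D.verify pk m dom σ s.RL = true ∧ ¬ ∃ S', (S', dom, m, σ) ∈ s.signed) ∨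
  (dom ≠ none ∧ (∃ m₁, (S, dom, m₁, σ) ∈ s.signed) ∧
    ∃ m' σ', (S, dom, m', σ') ∈ s.signed ∧ D.link σ σ' = some false)

/-- The traceability game. -/
def DAAScheme.traceExp (D : DAAScheme) (A : Prog) (n : ℕ) : PMF Prop := do
  let (pk, skI) ← D.setup n
  let (out, s) ← A.interact (D.traceOracle n pk skI) (Coded.code (n, pk)) ⟨fun _ => none, [], ∅⟩
  pure (∃ S σ m dom, Coded.decode out = some (S, σ, m, dom) ∧ D.TraceWin pk s S σ m dom)

def DAAScheme.UserControlledTraceable (D : DAAScheme) : Prop :=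
  ∀ A : Prog, A.IsOraclePPT → Negligible fun n => prob (D.traceExp A n)

/-- The additional algorithms of an instantly linkable scheme. -/
structure NymAlgorithms where
  nymGen : Data → Data → Data
  nymExtract : Data → Data
  verifyBsn : Data → Data → Bool
  nymGen_poly : PolyTime fun x : Data × Data => nymGen x.1 x.2
  nymExtract_poly : PolyTime nymExtract
  verifyBsn_poly : PolyTime fun x : Data × Data => verifyBsn x.1 x.2

structure DAAScheme.InstantlyLinkable (D : DAAScheme) (N : NymAlgorithms) : Prop where
  nymGen_eq : ∀ sk cred dom m, ∀ σ ∈ (D.sign sk cred (some dom) m).support,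
    N.nymGen sk dom = N.nymExtract σ
  link_iff : ∀ σ₁ σ₂, D.link σ₁ σ₂ = some true ↔ N.nymExtract σ₁ = N.nymExtract σ₂
  verifyBsn_unique : ∀ A : ℕ → PMF (Data × Data × Data × Data × Data), PPT A →
    Negligible fun n => prob do
      let (dom, dom', σ, pk, m) ← A n
      pure (dom ≠ dom' ∧ N.verifyBsn σ dom' = true ∧ N.verifyBsn σ dom = true ∧
        D.verify pk m (some dom) σ [] = true)

/-! ## Accountable commenting schemes and the trolling experiment -/

/-- An accountable commenting scheme with setup parameters in `Param` and issuer secret keys in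
`IKey`. The `Join-Issue` protocol: the user sends the message `join`, and the issuer answers with a
credential, or aborts (`none`). -/
structure CommentingScheme (Param IKey : Type) where
  setup : ℕ → PMF Param
  /-- the issuer's `(pk, sk)` -/
  keyGen : Param → PMF (Data × IKey)
  /-- fresh secret key of a user -/
  userKey : Param → Data → PMF Data
  /-- `join ρ pk skU U` -/
  join : Param → Data → Data → Data → PMF Data
  /-- `issue ρ skI U msg` -/
  issue : Param → IKey → Data → Data → PMF (Option Data)
  /-- `comment ρ pk skU credU dom m`, returning `(nym, γ)` -/
  comment : Param → Data → Data → Data → Data → Data → PMF (Data × Data)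
  /-- `verify ρ pk nym dom m γ` -/
  verify : Param → Data → Data → Data → Data → Data → Bool
  /-- `claim ρ pk skU credU dom m γ` -/
  claim : Param → Data → Data → Data → Data → Data → Data → PMF Data
  /-- `verifyClaim ρ pk dom m γ evidence` -/
  verifyClaim : Param → Data → Data → Data → Data → Data → Bool

/-- The global sets of the trolling experiment. `ver` holds the pairs `(V, U)` with
`ver[V, U] = 1`; `REG` holds the users that have obtained a credential through `JoinSystem`. -/
structure TrollState where
  CU : Finset Data
  HU : Finset Data
  VM : Finset (Data × Data)
  ver : Finset (Data × Data)
  REG : Finset Data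
  /-- `(U, skU, credU, V)` -/
  USK : List (Data × Data × Data × Data)
  /-- `(U, nym, dom, m, γ)` -/
  COMM : Finset (Data × Data × Data × Data × Data)

inductive TrollQuery
  | corruptUser (U : Data)
  | corruptVer (U V : Data)
  | createHonestUser (U V : Data)
  | joinSystem (U V msg : Data)
  | createComment (U dom m : Data)

def TrollQuery.decode (v : Data) : Option TrollQuery :=
  match (Coded.decode v : Option (ℕ × Data)) with
  | some (0, a) => some (.corruptUser a)
  | some (1, a) => (Coded.decode a).map fun (x : Data × Data) => .corruptVer x.1 x.2
  | some (2, a) => (Coded.decode a).map fun (x : Data × Data) => .createHonestUser x.1 x.2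
  | some (3, a) => (Coded.decode a).map fun (x : Data × Data × Data) => .joinSystem x.1 x.2.1 x.2.2
  | some (4, a) => (Coded.decode a).map
      fun (x : Data × Data × Data) => .createComment x.1 x.2.1 x.2.2
  | _ => none

namespace CommentingScheme

variable {Param IKey : Type}

/-- The oracles of the trolling experiment; `none` is `⊥`. `joinSystem` serves a user that is
neither honest nor corrupted, is confirmed by `V`, and has not registered before. (Such a user has
been confirmed by a `corruptVer` query, so it is counted in `VM`.) -/
def trollAnswer (C : CommentingScheme Param IKey) (ρ : Param) (pk : Data) (skI : IKey)
    (s : TrollState) : TrollQuery → PMF (Option Data × TrollState)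
  | .corruptUser U =>
      pure ((s.USK.find? fun e => e.1 = U).map fun e => Coded.code (e.2.1, e.2.2.1),
        { s with CU := insert U s.CU, HU := s.HU.erase U })
  | .corruptVer U V =>
      pure (none, { s with ver := insert (V, U) s.ver, VM := insert (V, U) s.VM })
  | .createHonestUser U V =>
      if U ∈ s.HU ∪ s.CU then pure (none, s)
      else do
        let s' : TrollState := { s with ver := insert (V, U) s.ver }
        let sk ← C.userKey ρ pk
        let msg ← C.join ρ pk sk U
        let c ← C.issue ρ skI U msg
        match c with
        | none => pure (none, s')
        | some cred =>
            pure (some cred, { s' with USK := (U, sk, cred, V) :: s.USK, HU := insert U s.HU })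
  | .joinSystem U V msg =>
      if U ∉ s.HU ∪ s.CU ∧ (V, U) ∈ s.ver ∧ U ∉ s.REG then do
        let c ← C.issue ρ skI U msg
        match c with
        | none => pure (none, s)
        | some cred => pure (some cred, { s with REG := insert U s.REG })
      else pure (none, s)
  | .createComment U dom m =>
      if U ∈ s.HU then
        match s.USK.find? fun e => e.1 = U with
        | none => pure (none, s)
        | some (_, sk, cred, _) => do
            let (nym, γ) ← C.comment ρ pk sk cred dom m
            pure (some (Coded.code (γ, nym)),
              { s with COMM := insert (U, nym, dom, m, γ) s.COMM })
      else pure (none, s)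

def trollOracle (C : CommentingScheme Param IKey) (ρ : Param) (pk : Data) (skI : IKey)
    (v : Data) (s : TrollState) : PMF (Data × TrollState) :=
  match TrollQuery.decode v with
  | none => pure (Coded.code (none : Option Data), s)
  | some q => (C.trollAnswer ρ pk skI s q).map fun x => (Coded.code x.1, x.2)

/-- The winning condition for the list `OUT` of tuples `(nym, dom, m, γ)`: all tuples verify and,
with the tuples recorded in `COMM` removed, some basename has more pseudonyms than there are
corrupted users and malicious verifications. -/
def TrollWin (C : CommentingScheme Param IKey) (ρ : Param) (pk : Data) (s : TrollState)
    (OUT : List (Data × Data × Data × Data)) : Prop :=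
  let OUT' := OUT.toFinset \ s.COMM.image fun e => e.2
  let S : Finset (Data × Data) := OUT'.image fun e => (e.1, e.2.1)
  let t := (S.image fun e => e.2).sup fun dom => ((S.filter fun e => e.2 = dom).image Prod.fst).card
  (∀ e ∈ OUT, C.verify ρ pk e.1 e.2.1 e.2.2.1 e.2.2.2 = true) ∧ t > s.CU.card + s.VM.card

/-- The trolling experiment. -/
def trollExp [Coded Param] (C : CommentingScheme Param IKey) (A : Prog) (n : ℕ) : PMF Prop := do
  let ρ ← C.setup n
  let (pk, skI) ← C.keyGen ρ
  let (out, s) ← A.interact (C.trollOracle ρ pk skI) (Coded.code (ρ, pk)) ⟨∅, ∅, ∅, ∅, ∅, [], ∅⟩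
  pure (∃ OUT, Coded.decode out = some OUT ∧ C.TrollWin ρ pk s OUT)

def ProtectsAgainstTrolling [Coded Param] (C : CommentingScheme Param IKey) : Prop :=
  ∀ A : Prog, A.IsOraclePPT → Negligible fun n => prob (C.trollExp A n)

end CommentingScheme

/-! ## TrollThrottle -/

/-- The relation `R_Join` between statements `(com, pk)` and witnesses `(sk, r)`: `com` is the
commitment that `join` computes from `pk` and `sk` with the random coins `r`. -/
def DAAScheme.RJoin (D : DAAScheme) (n : ℕ) (x : Data × Data) (w : Data × List Bool) : Prop :=
  w.2.length = D.joinCoins.eval n ∧ x.1 = D.join x.2 w.1 w.2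

/-- The TrollThrottle protocol. The setup parameter is `(1ⁿ, ρ_Join)`, the issuer's secret key is
the pair `(pk, sk)` of DAA keys, and a comment `γ` is the tuple `(σ, nym, dom, h(m))`. -/
def trollThrottle (D : DAAScheme) (N : NymAlgorithms) (H : HashFunction)
    (P : ProofSystem D.RJoin) : CommentingScheme (ℕ × Data) (Data × Data) :=
  let verify (ρ : ℕ × Data) (pk nym dom m γ : Data) : Bool :=
    match γ with
    | .pair σ (.pair nym' (.pair dom' h')) =>
        nym' = nym && dom' = dom && D.verify pk h' (some dom) σ [] && H.hash ρ.1 m = h' &&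
          N.nymExtract σ = nym && N.verifyBsn σ dom
    | _ => false
  { setup := fun n => (P.setup n).map fun ρJ => (n, ρJ)
    keyGen := fun ρ => (D.setup ρ.1).map fun k => (k.1, k)
    userKey := fun ρ pk => D.userKey ρ.1 pk
    join := fun ρ pk sk _ => do
      let r ← randomBits (D.joinCoins.eval ρ.1)
      let com := D.join pk sk r
      let π ← P.createProof ρ.2 (com, pk) (sk, r)
      pure (Coded.code (com, π))
    issue := fun ρ skI _ msg =>
      match msg with
      | .nil => pure none
      | .pair com π =>
          if P.verifyProof ρ.2 (com, skI.1) π = true then (D.issue skI.2 com).map some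
          else pure none
    comment := fun ρ _ sk cred dom m => do
      let σ ← D.sign sk cred (some dom) (H.hash ρ.1 m)
      let nym := N.nymGen sk dom
      pure (nym, Coded.code (σ, nym, dom, H.hash ρ.1 m))
    verify := verify
    claim := fun _ _ _ _ _ _ γ => pure γ
    verifyClaim := fun ρ pk dom m γ _ =>
      match γ with
      | .pair _ (.pair nym _) => verify ρ pk nym dom m γ
      | _ => false }

end

noncomputable section

/-! ## Outcomes of programs -/

/-! The cryptographic argument. First replace the reference string by one from the extractor's `E₁`.
Whether the adversary has won can be computed from a run of the experiment (`won`, `won_poly`), and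
a run takes polynomial time (`gameRun_ppt`), so the probability of winning changes only negligibly.

With the trapdoor at hand, the experiment can be simulated inside the traceability game. Honest
users are created by `hjoin` queries, their comments come from `sign` queries, and their corruption
is a `corrupt` query. When the adversary registers a user, `E₂` extracts a key and coins from its
proof, and these are submitted in a `join` query; the commitment they produce is the one the
adversary sent, so the credential has the right distribution. The simulation is perfect (`red_spec`,
`gameRun_eq_jointRun`).

Now count. A key enters the revocation list only when an honest user is corrupted or a user
registers through `joinSystem`. A registered user is not honest, so it was confirmed by a
`corruptVer` query and is counted in `VM`. Hence there are at most `|CU| + |VM|` revoked keys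
(`RedInv.card_revoked`), and each of them has one pseudonym per basename. If the adversary wins,
some new tuple carries a pseudonym belonging to no revoked key. Its signature is linked to no
signature of a revoked key, so it verifies with respect to the revocation list. If its comment was
never recorded, it is a forgery in the traceability game. If it was recorded, it was recorded with a
different message of the same hash, since otherwise the tuple would have been deleted: this is a
collision (`win_of_won`). So the winning probability is at most the sum of three negligible terms:
distinguishing the reference strings, finding a collision, and winning the traceability game
(`prob_won_le`).

The rest shows that the distinguisher, the collision finder and the traceability adversary are
polynomial-time programs of the given language. Closure properties of `PPT` and `PolyTime` handle
everything without an oracle. For an adversary with an oracle, `Prog.subst` replaces each query by a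
program that keeps a state; `simulates_subst` bounds the cost and `Prog.runT_subst` identifies the
distribution. The delicate point is that the adversary's running time is controlled only if answers
are bounded in terms of its input and the query, although the tables of the simulation keep growing.
Therefore answers depend on the tables only through a lookup for one user, whose entry has a length
bounded independently of the history (`exists_simulation`). -/

theorem SetM.mem_bind {α β : Type} (s : SetM α) (f : α → SetM β) (b : β) :
    b ∈ (s >>= f).run ↔ ∃ a ∈ s.run, b ∈ (f a).run := by
  change b ∈ ⋃ i ∈ s.run, (f i).run ↔ _
  simp

/-- A set as a nondeterministic computation. -/
def SetM.ofSet {α : Type} (s : Set α) : SetM α := s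

theorem SetM.mem_ofSet {α : Type} (s : Set α) (a : α) : a ∈ (SetM.ofSet s).run ↔ a ∈ s := Iff.rfl

theorem SetM.mem_pure {α : Type} (a b : α) : b ∈ (pure a : SetM α).run ↔ b = a := Iff.rfl

/-- The possible results of a program when the answer to a query `v` may be any element of `O v`. -/
def Prog.outcomes (O : Data → Set Data) (p : Prog) (x : Data) : Set (Data × ℕ) :=
  (p.exec (SetM.ofSet Set.univ) (fun v => SetM.ofSet (O v)) x).run

/-- The possible results of iterating a step. -/
def iterOutcomes (f : Data → Set (Data × ℕ)) : ℕ → Data → Set (Data × ℕ)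
  | 0, x => {(x, 0)}
  | k + 1, x => {y | ∃ u ∈ f x, ∃ v ∈ iterOutcomes f k u.1, y = (v.1, u.2 + v.2)}

/-- The first component of a pair. -/
def Data.left : Data → Data
  | .nil => .nil
  | .pair a _ => a

/-- The second component of a pair. -/
def Data.right : Data → Data
  | .nil => .nil
  | .pair _ b => b

/-- Are the components of the pair equal? -/
def Data.eqTest : Data → Data
  | .nil => .nil
  | .pair a b => Coded.code (decide (a = b))

@[simp] theorem Data.left_pair (a b : Data) : (Data.pair a b).left = a := rfl
@[simp] theorem Data.right_pair (a b : Data) : (Data.pair a b).right = b := rfl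
@[simp] theorem Data.left_nil : Data.nil.left = .nil := rfl
@[simp] theorem Data.right_nil : Data.nil.right = .nil := rfl

theorem Data.size_pos (x : Data) : 0 < x.size := by cases x <;> simp only [Data.size] <;> omega

theorem Data.size_left (x : Data) : x.left.size ≤ x.size := by
  cases x <;> simp only [Data.size, Data.left] <;> omega

theorem Data.size_right (x : Data) : x.right.size ≤ x.size := by
  cases x <;> simp [Data.size]

section outcomes

variable (O : Data → Set Data) (p q r : Prog) (x : Data) (y : Data × ℕ)

theorem mem_iterOutcomes (k : ℕ) :
    y ∈ (iterateCost (m := SetM) (p.exec (SetM.ofSet Set.univ) (fun v => SetM.ofSet (O v))) k x).run ↔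
      y ∈ iterOutcomes (p.outcomes O) k x := by
  induction k generalizing x y with
  | zero => exact SetM.mem_pure _ _
  | succ k ih =>
    simp only [iterateCost, SetM.mem_bind, SetM.mem_pure, ih, iterOutcomes, Set.mem_ofPred_eq]
    rfl

theorem mem_outcomes_id : y ∈ Prog.id.outcomes O x ↔ y = charge x x 0 := SetM.mem_pure _ _
theorem mem_outcomes_nil : y ∈ Prog.nil.outcomes O x ↔ y = charge x .nil 0 := SetM.mem_pure _ _
theorem mem_outcomes_fst : y ∈ Prog.fst.outcomes O x ↔ y = charge x x.left 0 := by
  cases x <;> exact SetM.mem_pure _ _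
theorem mem_outcomes_snd : y ∈ Prog.snd.outcomes O x ↔ y = charge x x.right 0 := by
  cases x <;> exact SetM.mem_pure _ _
theorem mem_outcomes_eq : y ∈ Prog.eq.outcomes O x ↔ y = charge x x.eqTest 0 := by
  cases x <;> exact SetM.mem_pure _ _

theorem mem_outcomes_flip :
    y ∈ Prog.flip.outcomes O x ↔ ∃ b : Bool, y = charge x (Coded.code b) 0 := by
  simp only [Prog.outcomes, Prog.exec, SetM.mem_bind, SetM.mem_pure, SetM.mem_ofSet,
    Set.mem_univ, true_and]

theorem mem_outcomes_query :
    y ∈ Prog.query.outcomes O x ↔ ∃ a ∈ O x, y = charge x a 0 := by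
  simp only [Prog.outcomes, Prog.exec, SetM.mem_bind, SetM.mem_pure, SetM.mem_ofSet]

theorem mem_outcomes_pair :
    y ∈ (Prog.pair p q).outcomes O x ↔ ∃ u ∈ p.outcomes O x, ∃ v ∈ q.outcomes O x,
      y = charge x (.pair u.1 v.1) (u.2 + v.2) := by
  simp only [Prog.outcomes, Prog.exec, SetM.mem_bind, SetM.mem_pure]

theorem mem_outcomes_comp :
    y ∈ (Prog.comp p q).outcomes O x ↔ ∃ u ∈ q.outcomes O x, ∃ v ∈ p.outcomes O u.1,
      y = charge x v.1 (u.2 + v.2) := by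
  simp only [Prog.outcomes, Prog.exec, SetM.mem_bind, SetM.mem_pure]

theorem mem_outcomes_ite :
    y ∈ (Prog.ite p q r).outcomes O x ↔ ∃ u ∈ p.outcomes O x,
      ∃ v ∈ (if u.1 = .nil then r.outcomes O x else q.outcomes O x),
      y = charge x v.1 (u.2 + v.2) := by
  simp only [Prog.outcomes, Prog.exec, SetM.mem_bind, SetM.mem_pure]
  refine exists_congr fun u => and_congr_right fun _ => ?_
  split <;> simp only [SetM.mem_bind, SetM.mem_pure]

theorem mem_outcomes_loop_pair (c s : Data) :
    y ∈ (Prog.loop p).outcomes O (.pair c s) ↔ ∃ u ∈ iterOutcomes (p.outcomes O) c.size s,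
      y = charge (.pair c s) u.1 u.2 := by
  simp only [Prog.outcomes, Prog.exec, SetM.mem_bind, SetM.mem_pure, mem_iterOutcomes]

theorem mem_outcomes_loop_nil :
    y ∈ (Prog.loop p).outcomes O .nil ↔ y = charge .nil .nil 0 := SetM.mem_pure _ _

end outcomes

/-- The number of steps covers reading the input and writing the output. -/
theorem Prog.size_le_cost (O : Data → Set Data) (p : Prog) (x : Data) (y : Data × ℕ)
    (h : y ∈ p.outcomes O x) : 1 + x.size + y.1.size ≤ y.2 := by
  cases p with
  | id => rw [mem_outcomes_id] at h; subst h; simp [charge]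
  | nil => rw [mem_outcomes_nil] at h; subst h; simp [charge]
  | fst => rw [mem_outcomes_fst] at h; subst h; simp [charge]
  | snd => rw [mem_outcomes_snd] at h; subst h; simp [charge]
  | eq => rw [mem_outcomes_eq] at h; subst h; simp [charge]
  | flip => rw [mem_outcomes_flip] at h; obtain ⟨b, rfl⟩ := h; simp [charge]
  | query => rw [mem_outcomes_query] at h; obtain ⟨b, -, rfl⟩ := h; simp [charge]
  | pair p q =>
    rw [mem_outcomes_pair] at h; obtain ⟨u, -, v, -, rfl⟩ := h; simp [charge]
  | comp p q =>
    rw [mem_outcomes_comp] at h; obtain ⟨u, -, v, -, rfl⟩ := h; simp [charge]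
  | ite p q r =>
    rw [mem_outcomes_ite] at h; obtain ⟨u, -, v, -, rfl⟩ := h; simp [charge]
  | loop p =>
    cases x with
    | nil => rw [mem_outcomes_loop_nil] at h; subst h; simp [charge]
    | pair c s => rw [mem_outcomes_loop_pair] at h; obtain ⟨u, -, rfl⟩ := h; simp [charge]

/-! ## Change of monad -/

section hom

variable {m m' : Type → Type} [Monad m] [Monad m'] (φ : ∀ {α : Type}, m α → m' α)
  (hpure : ∀ {α : Type} (a : α), φ (pure a) = pure a)
  (hbind : ∀ {α β : Type} (x : m α) (f : α → m β), φ (x >>= f) = φ x >>= fun a => φ (f a))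

include hpure hbind in
theorem iterateCost_hom (f : Data → m (Data × ℕ)) (k : ℕ) (x : Data) :
    φ (iterateCost f k x) = iterateCost (fun x => φ (f x)) k x := by
  induction k generalizing x with
  | zero => exact hpure _
  | succ k ih => simp only [iterateCost, hbind, hpure, ih]

include hpure hbind in
/-- Running programs commutes with monad homomorphisms. -/
theorem Prog.exec_hom (coin : m Bool) (O : Data → m Data) (p : Prog) (x : Data) :
    φ (p.exec coin O x) = p.exec (φ coin) (fun v => φ (O v)) x := by
  induction p generalizing x with
  | loop p ih =>
    cases x with
    | nil => exact hpure _
    | pair c s =>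
      simp only [Prog.exec, hbind, hpure, iterateCost_hom (φ := φ) hpure hbind, ih]
  | ite p q r ihp ihq ihr =>
    simp only [Prog.exec, hbind, ihp]
    congr 1; funext u
    split <;> simp only [hbind, hpure, ihq, ihr]
  | _ => simp only [Prog.exec, hbind, hpure, *]

end hom

/-- Replace queries by the constant answer `nil`. -/
def Prog.noQuery : Prog → Prog
  | .query => .nil
  | .pair p q => .pair p.noQuery q.noQuery
  | .comp p q => .comp p.noQuery q.noQuery
  | .ite p q r => .ite p.noQuery q.noQuery r.noQuery
  | .loop p => .loop p.noQuery
  | p => p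

/-- Lets a program written for no oracle be inlined into an oracle program: its queries no longer
reach the oracle, and even its cost is unchanged. -/
theorem Prog.exec_noQuery {m : Type → Type} [Monad m] [LawfulMonad m] (coin : m Bool)
    (O : Data → m Data) (p : Prog) (x : Data) :
    p.noQuery.exec coin O x = p.exec coin (fun _ => pure .nil) x := by
  induction p generalizing x with
  | query => simp [Prog.noQuery, Prog.exec]
  | loop p ih =>
    cases x with
    | nil => rfl
    | pair c s =>
      simp only [Prog.noQuery, Prog.exec]
      congr 2; funext s; exact ih s
  | ite p q r ihp ihq ihr => simp only [Prog.noQuery, Prog.exec, ihp, ihq, ihr]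
  | _ => simp only [Prog.noQuery, Prog.exec, *]

theorem support_fairCoin : fairCoin.support = Set.univ := by
  simp [fairCoin, PMF.support_uniformOfFintype]

/-- Taking supports is a monad homomorphism that sends the fair coin to the set of both outcomes.
Bounds valid on all coins thus become statements about `Prog.outcomes`. -/
theorem Prog.support_run (p : Prog) (x : Data) :
    (p.run x).support = p.outcomes (fun _ => {.nil}) x := by
  have h := Prog.exec_hom (m := PMF) (m' := SetM) (fun d => SetM.ofSet d.support)
    (fun a => PMF.support_pure a) (fun d f => PMF.support_bind d f)
    fairCoin (fun _ => pure .nil) p x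
  have h2 : (pure Data.nil : PMF Data).support = {.nil} := PMF.support_pure _
  rw [support_fairCoin, h2] at h
  exact h

theorem Prog.outcomes_noQuery (O : Data → Set Data) (p : Prog) (x : Data) :
    p.noQuery.outcomes O x = (p.run x).support := by
  rw [Prog.support_run, Prog.outcomes, Prog.exec_noQuery]; rfl

/-! ## Values of programs -/

/-- Run a program and forget the costs. -/
def Prog.eval {m : Type → Type} [Monad m] (coin : m Bool) (O : Data → m Data) (p : Prog)
    (x : Data) : m Data :=
  Prod.fst <$> p.exec coin O x

/-- Iterate a monadic step. -/
def iterM {m : Type → Type} [Monad m] (f : Data → m Data) : ℕ → Data → m Data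
  | 0, x => pure x
  | k + 1, x => f x >>= iterM f k

section eval

variable {m : Type → Type} [Monad m] [LawfulMonad m] (coin : m Bool) (O : Data → m Data)
  (p q r : Prog) (x : Data)

theorem Prog.eval_id : Prog.id.eval coin O x = pure x := by
  simp [Prog.eval, Prog.exec, charge]
theorem Prog.eval_nil : Prog.nil.eval coin O x = pure .nil := by
  simp [Prog.eval, Prog.exec, charge]
theorem Prog.eval_fst : Prog.fst.eval coin O x = pure x.left := by
  cases x <;> simp [Prog.eval, Prog.exec, charge, Data.left]
theorem Prog.eval_snd : Prog.snd.eval coin O x = pure x.right := by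
  cases x <;> simp [Prog.eval, Prog.exec, charge, Data.right]
theorem Prog.eval_eq : Prog.eq.eval coin O x = pure x.eqTest := by
  cases x <;> simp [Prog.eval, Prog.exec, charge, Data.eqTest]
theorem Prog.eval_flip : Prog.flip.eval coin O x = Coded.code <$> coin := by
  simp [Prog.eval, Prog.exec, charge]
theorem Prog.eval_query : Prog.query.eval coin O x = O x := by
  simp [Prog.eval, Prog.exec, charge]
theorem Prog.eval_pair : (Prog.pair p q).eval coin O x =
    p.eval coin O x >>= fun y => q.eval coin O x >>= fun z => pure (.pair y z) := by
  simp [Prog.eval, Prog.exec, charge]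
theorem Prog.eval_comp : (Prog.comp p q).eval coin O x = q.eval coin O x >>= p.eval coin O := by
  simp [Prog.eval, Prog.exec, charge]
theorem Prog.eval_ite : (Prog.ite p q r).eval coin O x =
    p.eval coin O x >>= fun y =>
      if y = .nil then r.eval coin O x else q.eval coin O x := by
  simp only [Prog.eval, Prog.exec, charge, map_bind, bind_map_left]
  congr 1; funext u
  split <;> simp

theorem map_iterateCost (k : ℕ) :
    Prod.fst <$> iterateCost (p.exec coin O) k x = iterM (p.eval coin O) k x := by
  induction k generalizing x with
  | zero => simp [iterateCost, iterM]
  | succ k ih =>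
    rw [iterateCost, iterM, Prog.eval, map_bind, bind_map_left]
    congr 1; funext u
    rw [← ih u.1]
    simp

theorem Prog.eval_loop_pair (c s : Data) :
    (Prog.loop p).eval coin O (.pair c s) = iterM (p.eval coin O) c.size s := by
  rw [← map_iterateCost]
  simp [Prog.eval, Prog.exec, charge]
theorem Prog.eval_loop_nil : (Prog.loop p).eval coin O .nil = pure .nil := by
  simp [Prog.eval, Prog.exec, charge]

end eval

/-- Run a program without an oracle and forget the costs. -/
def Prog.val (p : Prog) (x : Data) : PMF Data := p.eval fairCoin (fun _ => pure .nil) x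

theorem Prog.map_run (p : Prog) (x : Data) : (p.run x).map Prod.fst = p.val x := rfl

theorem Prog.exists_cost {p : Prog} {x y : Data} (h : y ∈ (p.val x).support) :
    ∃ c, (y, c) ∈ p.outcomes (fun _ => {.nil}) x := by
  rw [← Prog.map_run, PMF.support_map, Prog.support_run] at h
  obtain ⟨⟨y, c⟩, h, rfl⟩ := h
  exact ⟨c, h⟩

theorem Prog.mem_val {p : Prog} {x : Data} {y : Data × ℕ}
    (h : y ∈ p.outcomes (fun _ => {.nil}) x) : y.1 ∈ (p.val x).support := by
  rw [← Prog.map_run, PMF.support_map, Prog.support_run]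
  exact ⟨y, h, rfl⟩

/-! ## Closure properties of probabilistic polynomial time -/

theorem Polynomial.eval_mono_nat (t : Polynomial ℕ) {a b : ℕ} (h : a ≤ b) :
    t.eval a ≤ t.eval b := by
  rw [Polynomial.eval_eq_sum_range, Polynomial.eval_eq_sum_range]
  exact Finset.sum_le_sum fun i _ => by gcongr

section val

variable (p q r : Prog) (x : Data)

theorem Prog.val_id : Prog.id.val x = pure x := Prog.eval_id ..
theorem Prog.val_nil : Prog.nil.val x = pure .nil := Prog.eval_nil ..
theorem Prog.val_fst : Prog.fst.val x = pure x.left := Prog.eval_fst ..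
theorem Prog.val_snd : Prog.snd.val x = pure x.right := Prog.eval_snd ..
theorem Prog.val_eq : Prog.eq.val x = pure x.eqTest := Prog.eval_eq ..
theorem Prog.val_flip : Prog.flip.val x = Coded.code <$> fairCoin := Prog.eval_flip ..
theorem Prog.val_pair : (Prog.pair p q).val x =
    p.val x >>= fun y => q.val x >>= fun z => pure (.pair y z) := Prog.eval_pair ..
theorem Prog.val_comp : (Prog.comp p q).val x = q.val x >>= p.val := Prog.eval_comp ..
theorem Prog.val_ite : (Prog.ite p q r).val x =
    p.val x >>= fun y => if y = .nil then r.val x else q.val x := Prog.eval_ite ..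
theorem Prog.val_loop_pair (c s : Data) :
    (Prog.loop p).val (.pair c s) = iterM p.val c.size s := Prog.eval_loop_pair ..

end val

/-- The program `p` computes the randomised map `F` in time `t`. -/
structure Prog.Computes {α β : Type} [Coded α] [Coded β] (p : Prog) (t : Polynomial ℕ)
    (F : α → PMF β) : Prop where
  val_eq : ∀ a : α, p.val (Coded.code a) = Coded.code (α := β) <$> F a
  cost_le : ∀ a : α, ∀ y ∈ p.outcomes (fun _ => {.nil}) (Coded.code a),
    y.2 ≤ t.eval (Coded.code a).size

theorem PMF.mem_support_bind' {α β : Type} (p : PMF α) (f : α → PMF β) (b : β) :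
    b ∈ (p >>= f).support ↔ ∃ a ∈ p.support, b ∈ (f a).support :=
  PMF.mem_support_bind_iff p f b

theorem PMF.mem_support_map' {α β : Type} (p : PMF α) (f : α → β) (b : β) :
    b ∈ (f <$> p).support ↔ ∃ a ∈ p.support, f a = b :=
  PMF.mem_support_map_iff f p b

theorem PMF.mem_support_pure' {α : Type} (a b : α) :
    b ∈ (Pure.pure a : PMF α).support ↔ b = a :=
  PMF.mem_support_pure_iff a b

theorem PMF.bind_congr' {α β : Type} {p : PMF α} {f g : α → PMF β}
    (h : ∀ a ∈ p.support, f a = g a) : p >>= f = p >>= g := by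
  change p.bind f = p.bind g
  ext b
  rw [PMF.bind_apply, PMF.bind_apply]
  refine tsum_congr fun a => ?_
  by_cases ha : a ∈ p.support
  · rw [h a ha]
  · rw [(PMF.apply_eq_zero_iff p a).2 ha, zero_mul, zero_mul]

section

variable {α β γ δ : Type} [Coded α] [Coded β] [Coded γ] [Coded δ]

theorem Coded.code_injective : Function.Injective (Coded.code : α → Data) := fun a b h => by
  have := congrArg (Coded.decode (α := α)) h
  simpa [Coded.decode_code] using this

/-- The length of an object. -/
def len (a : α) : ℕ := (Coded.code a).size

@[simp] theorem len_prod (x : α × β) : len x = 1 + len x.1 + len x.2 := rfl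
@[simp] theorem len_data (x : Data) : len x = x.size := rfl
@[simp] theorem len_nil : len ([] : List α) = 1 := rfl
@[simp] theorem len_cons (a : α) (l : List α) : len (a :: l) = 1 + len a + len l := rfl
@[simp] theorem len_none : len (none : Option α) = 1 := rfl
@[simp] theorem len_some (a : α) : len (some a) = 2 + len a := rfl
@[simp] theorem len_zero : len (0 : ℕ) = 1 := rfl
@[simp] theorem len_succ (n : ℕ) : len (n + 1) = 2 + len n := rfl
theorem len_code (a : α) : (Coded.code a).size = len a := rfl
theorem len_bool (b : Bool) : len b ≤ 3 := by cases b <;> decide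

theorem length_le_len (l : List α) : l.length ≤ len l := by
  induction l with
  | nil => simp
  | cons a l ih => simp; omega

/-- The last bound makes the cost dominate the length of the output, which is how the input length
of the next program in a composition is controlled. -/
theorem Prog.Computes.mem_outcomes {p : Prog} {t : Polynomial ℕ} {F : α → PMF β}
    (h : p.Computes t F) {a : α} {y : Data × ℕ}
    (hy : y ∈ p.outcomes (fun _ => {.nil}) (Coded.code a)) :
    ∃ b ∈ (F a).support, y.1 = Coded.code b ∧ y.2 ≤ t.eval (len a) ∧
      1 + len a + len b ≤ y.2 := by
  have h1 := Prog.mem_val hy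
  rw [h.val_eq, PMF.mem_support_map'] at h1
  obtain ⟨b, hb, hb'⟩ := h1
  refine ⟨b, hb, hb'.symm, h.cost_le a y hy, ?_⟩
  have := Prog.size_le_cost _ _ _ _ hy
  rw [← hb'] at this
  exact this

theorem ppt_iff {F : α → PMF β} : PPT F ↔ ∃ p t, Prog.Computes p t F := by
  refine exists_congr fun p => exists_congr fun t => ⟨fun h => ⟨fun a => (h a).1, fun a => ?_⟩,
    fun h a => ⟨h.1 a, ?_⟩⟩
  · rw [← Prog.support_run]; exact (h a).2
  · rw [Prog.support_run]; exact h.2 a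

/-- Writing the output is charged, so the running time bounds its length. -/
theorem PPT.exists_len_le {F : α → PMF β} (h : PPT F) :
    ∃ t : Polynomial ℕ, ∀ a, ∀ b ∈ (F a).support, len b ≤ t.eval (len a) := by
  obtain ⟨p, t, h⟩ := ppt_iff.1 h
  refine ⟨t, fun a b hb => ?_⟩
  have h1 : Coded.code b ∈ (p.val (Coded.code a)).support := by
    rw [h.val_eq, PMF.mem_support_map']; exact ⟨b, hb, rfl⟩
  obtain ⟨c, hc⟩ := Prog.exists_cost h1
  have h2 := Prog.size_le_cost _ _ _ _ hc
  have h3 := h.cost_le _ _ hc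
  simp only [len_code] at h2 h3
  omega

theorem PolyTime.exists_len_le {f : α → β} (h : PolyTime f) :
    ∃ t : Polynomial ℕ, ∀ a, len (f a) ≤ t.eval (len a) := by
  obtain ⟨t, ht⟩ := PPT.exists_len_le h
  exact ⟨t, fun a => ht a _ ((PMF.mem_support_pure_iff _ _).2 rfl)⟩

theorem PPT.of_eq {F G : α → PMF β} (hF : PPT F) (h : ∀ a, F a = G a) : PPT G :=
  (funext h : F = G) ▸ hF

theorem PolyTime.of_eq {f g : α → β} (hf : PolyTime f) (h : ∀ a, f a = g a) : PolyTime g :=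
  (funext h : f = g) ▸ hf

theorem PPT.comp {F : α → PMF β} {G : β → PMF γ} (hF : PPT F) (hG : PPT G) :
    PPT fun a => F a >>= G := by
  obtain ⟨p, s, hF⟩ := ppt_iff.1 hF
  obtain ⟨q, t, hG⟩ := ppt_iff.1 hG
  -- The output of `p` has length at most `s`, so `q` takes at most `t.comp s` steps; this is
  -- counted twice because the result, of at most this length, is charged again by `comp`.
  refine ppt_iff.2 ⟨.comp q p, 1 + Polynomial.X + s + 2 * t.comp s, ⟨fun a => ?_, fun a y hy => ?_⟩⟩
  · rw [Prog.val_comp, hF.val_eq, map_bind, bind_map_left]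
    simp only [hG.val_eq]
  · rw [mem_outcomes_comp] at hy
    obtain ⟨u, hu, v, hv, rfl⟩ := hy
    obtain ⟨b, -, hb, hu2, hu3⟩ := hF.mem_outcomes hu
    rw [hb] at hv
    obtain ⟨c, -, hc, hv2, hv3⟩ := hG.mem_outcomes hv
    have := t.eval_mono_nat (show len b ≤ s.eval (len a) by omega)
    simp only [charge, hc, len_code, Polynomial.eval_add, Polynomial.eval_one, Polynomial.eval_X,
      Polynomial.eval_mul, Polynomial.eval_comp, Polynomial.eval_ofNat]
    omega

theorem PPT.pair {F : α → PMF β} {G : α → PMF γ} (hF : PPT F) (hG : PPT G) :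
    PPT fun a => F a >>= fun b => G a >>= fun c => pure (b, c) := by
  obtain ⟨p, s, hF⟩ := ppt_iff.1 hF
  obtain ⟨q, t, hG⟩ := ppt_iff.1 hG
  refine ppt_iff.2 ⟨.pair p q, 2 + Polynomial.X + 2 * s + 2 * t, ⟨fun a => ?_, fun a y hy => ?_⟩⟩
  · rw [Prog.val_pair, hF.val_eq, hG.val_eq]
    simp only [map_bind, bind_map_left, map_pure]
    rfl
  · rw [mem_outcomes_pair] at hy
    obtain ⟨u, hu, v, hv, rfl⟩ := hy
    obtain ⟨b, -, hb, hu2, hu3⟩ := hF.mem_outcomes hu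
    obtain ⟨c, -, hc, hv2, hv3⟩ := hG.mem_outcomes hv
    simp only [charge, hb, hc, len_code, Data.size, Polynomial.eval_add, Polynomial.eval_X,
      Polynomial.eval_mul, Polynomial.eval_ofNat]
    omega

theorem PolyTime.ppt {f : α → β} (h : PolyTime f) : PPT fun a => (pure (f a) : PMF β) := h

attribute [fun_prop] PolyTime

theorem PPT.comp_polyTime {f : α → β} {G : β → PMF γ} (hG : PPT G) (hf : PolyTime f) :
    PPT fun a => G (f a) := by
  have := PPT.comp hf.ppt hG
  simpa only [pure_bind] using this

@[fun_prop]
theorem PolyTime.comp {g : β → γ} {f : α → β} (hg : PolyTime g) (hf : PolyTime f) :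
    PolyTime fun a => g (f a) :=
  PPT.comp_polyTime (G := fun b => (Pure.pure (g b) : PMF γ)) hg hf

@[fun_prop]
theorem PolyTime.prodMk {f : α → β} {g : α → γ} (hf : PolyTime f) (hg : PolyTime g) :
    PolyTime fun a => (f a, g a) := by
  have := PPT.pair hf.ppt hg.ppt
  simp only [pure_bind] at this
  exact this

theorem PolyTime.of_prog (p : Prog) (f : α → β) (t : Polynomial ℕ)
    (hv : ∀ a : α, p.val (Coded.code a) = (pure (Coded.code (f a)) : PMF Data))
    (hc : ∀ a : α, ∀ y ∈ p.outcomes (fun _ => {.nil}) (Coded.code a), y.2 ≤ t.eval (len a)) :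
    PolyTime f :=
  ppt_iff.2 ⟨p, t, fun a => by rw [hv]; exact (map_pure _ _).symm, hc⟩

/-- Changes of type that do not affect the encoding cost nothing. -/
theorem PolyTime.of_code_eq {f : α → β} (h : ∀ a, Coded.code (f a) = Coded.code a) :
    PolyTime f := by
  refine .of_prog .id f (1 + 2 * Polynomial.X) (fun a => by rw [Prog.val_id, h]) fun a y hy => ?_
  rw [mem_outcomes_id] at hy; subst hy
  simp only [charge, len_code, Polynomial.eval_add, Polynomial.eval_one, Polynomial.eval_X,
      Polynomial.eval_mul, Polynomial.eval_ofNat]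
  omega

@[fun_prop]
theorem PolyTime.id' : PolyTime fun a : α => a := .of_code_eq fun _ => rfl

theorem PolyTime.of_left {f : α → β} (h : ∀ a, Coded.code (f a) = (Coded.code a).left) :
    PolyTime f := by
  refine .of_prog .fst f (1 + 2 * Polynomial.X) (fun a => by rw [Prog.val_fst, h]) fun a y hy => ?_
  rw [mem_outcomes_fst] at hy; subst hy
  have := Data.size_left (Coded.code a)
  simp only [charge, len_code, Polynomial.eval_add, Polynomial.eval_one, Polynomial.eval_X,
      Polynomial.eval_mul, Polynomial.eval_ofNat] at *
  omega

theorem PolyTime.of_right {f : α → β} (h : ∀ a, Coded.code (f a) = (Coded.code a).right) :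
    PolyTime f := by
  refine .of_prog .snd f (1 + 2 * Polynomial.X) (fun a => by rw [Prog.val_snd, h]) fun a y hy => ?_
  rw [mem_outcomes_snd] at hy; subst hy
  have := Data.size_right (Coded.code a)
  simp only [charge, len_code, Polynomial.eval_add, Polynomial.eval_one, Polynomial.eval_X,
      Polynomial.eval_mul, Polynomial.eval_ofNat] at *
  omega

@[fun_prop]
theorem PolyTime.fst {f : α → β × γ} (hf : PolyTime f) : PolyTime fun a => (f a).1 :=
  (PolyTime.of_left (f := Prod.fst) fun _ => rfl).comp hf

@[fun_prop]
theorem PolyTime.snd {f : α → β × γ} (hf : PolyTime f) : PolyTime fun a => (f a).2 :=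
  (PolyTime.of_right (f := Prod.snd) fun _ => rfl).comp hf

theorem PolyTime.const_nil : PolyTime fun _ : α => Data.nil := by
  refine .of_prog .nil _ (2 + Polynomial.X) (fun a => by rw [Prog.val_nil]; rfl) fun a y hy => ?_
  rw [mem_outcomes_nil] at hy; subst hy
  simp only [charge, len_code, Polynomial.eval_add, Polynomial.eval_X, Polynomial.eval_ofNat,
    Data.size]
  omega

theorem PolyTime.const_data (d : Data) : PolyTime fun _ : α => d := by
  induction d with
  | nil => exact .const_nil
  | pair a b iha ihb =>
    exact (PolyTime.of_code_eq (f := fun x : Data × Data => Data.pair x.1 x.2) fun _ => rfl).comp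
      (iha.prodMk ihb)

@[fun_prop]
theorem PolyTime.const (b : β) : PolyTime fun _ : α => b := by
  obtain ⟨p, t, h⟩ := ppt_iff.1 (PolyTime.const_data (α := α) (Coded.code b))
  refine ppt_iff.2 ⟨p, t, fun a => (h.val_eq a).trans ?_, h.cost_le⟩
  change Coded.code <$> (pure (Coded.code b) : PMF Data) = Coded.code <$> (pure b : PMF β)
  simp only [map_pure]
  rfl

@[fun_prop]
theorem PolyTime.code : PolyTime (Coded.code : α → Data) := .of_code_eq fun _ => rfl

@[fun_prop]
theorem PolyTime.dataPair : PolyTime fun x : Data × Data => Data.pair x.1 x.2 :=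
  .of_code_eq fun _ => rfl

@[fun_prop]
theorem PolyTime.left : PolyTime Data.left := .of_left fun _ => rfl

@[fun_prop]
theorem PolyTime.right : PolyTime Data.right := .of_right fun _ => rfl

/-- Programs see only codes, so one program serves all maps that agree after encoding, whatever
their types. -/
theorem PPT.congr_code {F : α → PMF β} (hF : PPT F) {G : α → PMF γ}
    (h : ∀ a, Coded.code (α := γ) <$> G a = Coded.code (α := β) <$> F a) : PPT G := by
  obtain ⟨p, t, hp⟩ := ppt_iff.1 hF
  exact ppt_iff.2 ⟨p, t, fun a => (hp.val_eq a).trans (h a).symm, hp.cost_le⟩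

theorem PolyTime.congr_code {f : α → β} (hf : PolyTime f) {g : α → γ}
    (h : ∀ a, Coded.code (g a) = Coded.code (f a)) : PolyTime g :=
  PPT.congr_code hf (G := fun a => PMF.pure (g a)) fun a => by
    change Coded.code (α := γ) <$> (pure (g a) : PMF γ) =
      Coded.code (α := β) <$> (pure (f a) : PMF β)
    rw [map_pure, map_pure, h]

@[fun_prop]
theorem PolyTime.optionSome : PolyTime (Option.some : α → Option α) :=
  (PolyTime.const_nil.prodMk PolyTime.id').congr_code fun _ => rfl

@[fun_prop]
theorem PolyTime.succ : PolyTime fun n : ℕ => n + 1 :=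
  (PolyTime.const_nil.prodMk PolyTime.id').congr_code fun _ => rfl

@[fun_prop]
theorem PolyTime.cons : PolyTime fun x : α × List α => x.1 :: x.2 :=
  PolyTime.id'.congr_code fun _ => rfl

-- A unary numeral has the same code as a list of that many leaves. Loops over numbers thereby
-- become folds over lists.
@[fun_prop]
theorem PolyTime.listReplicate : PolyTime fun n : ℕ => List.replicate n Data.nil :=
  PolyTime.id'.congr_code fun n => by
    induction n with
    | zero => rfl
    | succ n ih => exact congrArg (Data.pair .nil) ih

theorem eqTest_pair (a b : α) :
    (Data.pair (Coded.code a) (Coded.code b)).eqTest =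
      Coded.code (@decide (a = b) (Classical.dec _)) := by
  by_cases h : a = b
  · simp [h, Data.eqTest]
  · simp [h, Data.eqTest, Coded.code_injective.ne h]

theorem PolyTime.decideEq [DecidableEq α] : PolyTime fun x : α × α => decide (x.1 = x.2) := by
  refine .of_prog .eq _ (4 + Polynomial.X) (fun a => ?_) fun a y hy => ?_
  · rw [Prog.val_eq]
    refine congrArg pure ((eqTest_pair a.1 a.2).trans ?_)
    congr
  · rw [mem_outcomes_eq] at hy; subst hy
    have := len_bool (@decide (a.1 = a.2) (Classical.dec _))
    rw [show (Coded.code a).eqTest = _ from eqTest_pair a.1 a.2]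
    simp only [charge, len_code, Polynomial.eval_add, Polynomial.eval_X, Polynomial.eval_ofNat]
    omega

@[fun_prop]
theorem PolyTime.decide_eq [DecidableEq β] {f g : α → β} (hf : PolyTime f) (hg : PolyTime g) :
    PolyTime fun a => decide (f a = g a) :=
  PolyTime.decideEq.comp (hf.prodMk hg)

/-- Case distinction: is the code of `f d` the leaf, or is it a pair? -/
theorem PPT.cases {f : δ → β} (hf : PolyTime f) {F₀ : δ → PMF γ} (h₀ : PPT F₀)
    {F₁ : δ × α → PMF γ} (h₁ : PPT F₁) {R : δ → PMF γ}
    (hR : ∀ d, (Coded.code (f d) = .nil ∧ R d = F₀ d) ∨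
      ∃ x : α, Coded.code (f d) = Coded.code x ∧ Coded.code (f d) ≠ .nil ∧ R d = F₁ (d, x)) :
    PPT R := by
  obtain ⟨p, s, hp⟩ := ppt_iff.1 (hf.prodMk PolyTime.id').ppt
  obtain ⟨q₀, t₀, hq₀⟩ := ppt_iff.1 h₀
  obtain ⟨q₁, t₁, hq₁⟩ := ppt_iff.1 h₁
  -- `p` produces `(f d, d)`, whose first component is tested. The second branch swaps the
  -- components and feeds `(d, f d)` to `q₁`, which reads the code of `f d` as that of `x`.
  refine ppt_iff.2 ⟨.comp (.ite .fst (.comp q₁ (.pair .snd .fst)) (.comp q₀ .snd)) p,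
    10 + Polynomial.X + 20 * s + 5 * t₀ + 5 * t₁.comp s, ⟨fun d => ?_, fun d y hy => ?_⟩⟩
  · rw [Prog.val_comp, hp.val_eq, map_pure, pure_bind, Prog.val_ite, Prog.val_fst, pure_bind]
    rcases hR d with ⟨h1, h2⟩ | ⟨x, h1, h1', h2⟩
    · rw [if_pos (show (Coded.code (f d, d)).left = .nil from h1), Prog.val_comp, Prog.val_snd,
        pure_bind, h2]
      exact hq₀.val_eq d
    · rw [if_neg (show ¬ (Coded.code (f d, d)).left = .nil from h1'), Prog.val_comp, Prog.val_pair, Prog.val_snd, Prog.val_fst]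
      simp only [pure_bind, h2]
      rw [← hq₁.val_eq]
      change q₁.val (.pair (Coded.code d) (Coded.code (f d))) =
        q₁.val (.pair (Coded.code d) (Coded.code x))
      rw [h1]
  · rw [mem_outcomes_comp] at hy
    obtain ⟨u, hu, v, hv, rfl⟩ := hy
    obtain ⟨b, hb0, hb, hu2, hu3⟩ := hp.mem_outcomes hu
    rw [PMF.mem_support_pure'] at hb0
    subst hb0
    have hX : u.1 = .pair (Coded.code (f d)) (Coded.code d) := hb
    rw [hX, mem_outcomes_ite] at hv
    obtain ⟨w, hw, z, hz, rfl⟩ := hv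
    rw [mem_outcomes_fst] at hw
    subst hw
    have e1 : ((Data.pair (Coded.code (f d)) (Coded.code d)).left) = Coded.code (f d) := rfl
    have e2 : ((Data.pair (Coded.code (f d)) (Coded.code d)).right) = Coded.code d := rfl
    simp only [len_prod] at hu3
    simp only [charge, e1] at hz
    rcases hR d with ⟨h1, h2⟩ | ⟨x, h1, h1', h2⟩
    · rw [if_pos h1, mem_outcomes_comp] at hz
      obtain ⟨w, hw, z, hz, rfl⟩ := hz
      rw [mem_outcomes_snd] at hw
      subst hw
      have hz' : z ∈ q₀.outcomes (fun _ => {.nil}) (Coded.code d) := hz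
      obtain ⟨c, -, hc, hz2, hz3⟩ := hq₀.mem_outcomes hz'
      simp only [charge, hc, e1, e2, len_code, Data.size, Polynomial.eval_add, Polynomial.eval_X,
        Polynomial.eval_mul, Polynomial.eval_ofNat]
      omega
    · rw [if_neg h1', mem_outcomes_comp] at hz
      obtain ⟨w, hw, z, hz, rfl⟩ := hz
      rw [mem_outcomes_pair] at hw
      obtain ⟨w1, hw1, w2, hw2, rfl⟩ := hw
      rw [mem_outcomes_snd] at hw1
      rw [mem_outcomes_fst] at hw2
      subst hw1 hw2
      have hz' : z ∈ q₁.outcomes (fun _ => {.nil}) (Coded.code (d, x)) := by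
        change z ∈ q₁.outcomes _ (.pair (Coded.code d) (Coded.code x))
        rw [← h1]; exact hz
      obtain ⟨c, -, hc, hz2, hz3⟩ := hq₁.mem_outcomes hz'
      have hx : len x = len (f d) := by rw [← len_code x, ← h1]; rfl
      simp only [len_prod, hx] at hz2 hz3
      have := t₁.eval_mono_nat (show 1 + len d + len (f d) ≤ s.eval (len d) by omega)
      simp only [charge, hc, e1, e2, len_code, Data.size, Polynomial.eval_add, Polynomial.eval_X,
        Polynomial.eval_mul, Polynomial.eval_ofNat, Polynomial.eval_comp]
      omega

end

/-! ## Case distinctions -/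

section

variable {α β γ δ : Type} [Coded α] [Coded β] [Coded γ] [Coded δ]

theorem PPT.ite {P : δ → Prop} [DecidablePred P] (hP : PolyTime fun d => decide (P d))
    {F G : δ → PMF γ} (hF : PPT F) (hG : PPT G) : PPT fun d => if P d then F d else G d := by
  have hF' : PPT fun x : δ × Bool => F x.1 := hF.comp_polyTime (PolyTime.id'.fst)
  refine PPT.cases hP hG hF' fun d => ?_
  by_cases h : P d
  · exact .inr ⟨true, by simp [h], by simp [h, Coded.code], by simp [h]⟩
  · exact .inl ⟨by simp [h, Coded.code], by simp [h]⟩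

@[fun_prop]
theorem PolyTime.ite {P : δ → Prop} [DecidablePred P] (hP : PolyTime fun d => decide (P d))
    {f g : δ → γ} (hf : PolyTime f) (hg : PolyTime g) :
    PolyTime fun d => if P d then f d else g d := by
  have := PPT.ite hP hf.ppt hg.ppt
  refine PPT.of_eq this fun d => ?_
  by_cases h : P d
  · simp only [if_pos h]; rfl
  · simp only [if_neg h]; rfl

theorem PPT.optionElim {o : δ → Option α} (ho : PolyTime o) {F : δ → PMF γ} (hF : PPT F)
    {G : δ × α → PMF γ} (hG : PPT G) :
    PPT fun d => (o d).elim (F d) fun a => G (d, a) := by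
  -- `some a` is coded like the pair of a leaf and `a`, so this branch receives an extra leaf and
  -- must drop it.
  have hG' : PPT fun x : δ × Data × α => G (x.1, x.2.2) := hG.comp_polyTime (by fun_prop)
  refine PPT.cases ho hF hG' fun d => ?_
  cases h : o d with
  | none => exact .inl ⟨rfl, rfl⟩
  | some a => exact .inr ⟨(.nil, a), rfl, by simp [Coded.code], rfl⟩

theorem PolyTime.optionElim {o : δ → Option α} (ho : PolyTime o) {f : δ → γ} (hf : PolyTime f)
    {g : δ → α → γ} (hg : PolyTime fun x : δ × α => g x.1 x.2) :
    PolyTime fun d => (o d).elim (f d) (g d) := by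
  have := PPT.optionElim ho hf.ppt hg.ppt
  refine PPT.of_eq this fun d => ?_
  change _ = (pure ((o d).elim (f d) (g d)) : PMF γ)
  cases o d <;> rfl

theorem PPT.listElim {l : δ → List α} (hl : PolyTime l) {F : δ → PMF γ} (hF : PPT F)
    {G : δ × α × List α → PMF γ} (hG : PPT G) :
    PPT fun d => match l d with
      | [] => F d
      | a :: t => G (d, a, t) := by
  refine PPT.cases hl hF hG fun d => ?_
  cases h : l d with
  | nil => exact .inl ⟨rfl, rfl⟩
  | cons a t => exact .inr ⟨(a, t), rfl, by simp [Coded.code, Data.ofList], rfl⟩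

/-- Plain composition would lose the input; running the identity beside `F` keeps it available for
`G`. -/
theorem PPT.bind {F : α → PMF β} {G : α × β → PMF γ} (hF : PPT F) (hG : PPT G) :
    PPT fun a => F a >>= fun b => G (a, b) := by
  have := (PPT.pair (PolyTime.id' (α := α)).ppt hF).comp hG
  simpa only [pure_bind, bind_assoc] using this

theorem PPT.map {F : α → PMF β} {g : α → β → γ} (hF : PPT F)
    (hg : PolyTime fun x : α × β => g x.1 x.2) : PPT fun a => g a <$> F a := by
  have := PPT.bind hF hg.ppt
  simpa only [bind_pure_comp] using this

/-! ## Bounded iteration -/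

/-- Iterate a random step. -/
def iterP {σ : Type} (F : σ → PMF σ) : ℕ → σ → PMF σ
  | 0, x => pure x
  | k + 1, x => F x >>= iterP F k

theorem iterP_succ' {σ : Type} (F : σ → PMF σ) (k : ℕ) (s : σ) :
    iterP F (k + 1) s = iterP F k s >>= F := by
  induction k generalizing s with
  | zero => simp only [iterP, pure_bind, bind_pure]
  | succ k ih =>
    rw [iterP, iterP, bind_assoc]
    congr 1; funext u; exact ih u

theorem iterM_val {p : Prog} {t : Polynomial ℕ} {F : β → PMF β} (h : p.Computes t F) (k : ℕ)
    (s : β) : iterM p.val k (Coded.code s) = Coded.code (α := β) <$> iterP F k s := by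
  induction k generalizing s with
  | zero => simp only [iterM, iterP, map_pure]
  | succ k ih => simp only [iterM, iterP, h.val_eq, bind_map_left, map_bind, ih]

/-- Iterating a polynomial-time step can produce exponentially long data. The hypothesis `hB`
excludes this by bounding every reachable state; each round then costs at most `t` at that bound,
and the number of rounds is the size of a computed datum. -/
theorem PPT.iterate {cnt : α → Data} {ini : α → β} (hcnt : PolyTime cnt) (hini : PolyTime ini)
    {F : β → PMF β} (hF : PPT F) (B : Polynomial ℕ)
    (hB : ∀ a k, ∀ s ∈ (iterP F k (ini a)).support, len s ≤ B.eval (len a)) :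
    PPT fun a => iterP F (cnt a).size (ini a) := by
  obtain ⟨p, s, hp⟩ := ppt_iff.1 (hcnt.prodMk hini).ppt
  obtain ⟨q, t, hq⟩ := ppt_iff.1 hF
  refine ppt_iff.2 ⟨.comp (.loop q) p, 10 + Polynomial.X + 5 * s + 2 * (s * t.comp B) + 2 * B,
    ⟨fun a => ?_, fun a y hy => ?_⟩⟩
  · rw [Prog.val_comp, hp.val_eq, map_pure, pure_bind]
    exact (Prog.val_loop_pair _ _ _).trans (iterM_val hq _ _)
  · rw [mem_outcomes_comp] at hy
    obtain ⟨u, hu, v, hv, rfl⟩ := hy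
    obtain ⟨b, hb0, hb, hu2, hu3⟩ := hp.mem_outcomes hu
    rw [PMF.mem_support_pure'] at hb0
    subst hb0
    have hX : u.1 = .pair (cnt a) (Coded.code (ini a)) := hb
    rw [hX, mem_outcomes_loop_pair] at hv
    obtain ⟨w, hw, rfl⟩ := hv
    -- Induction on the remaining rounds `k`, with `j` rounds already done, so that `hB` applies to
    -- the current state.
    have key : ∀ k j, ∀ x ∈ (iterP F j (ini a)).support, ∀ y ∈ iterOutcomes
        (q.outcomes fun _ => {.nil}) k (Coded.code x),
        y.2 ≤ k * t.eval (B.eval (len a)) ∧ y.1.size ≤ B.eval (len a) := by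
      intro k
      induction k with
      | zero =>
        intro j x hx y hy
        simp only [iterOutcomes, Set.mem_singleton_iff] at hy
        subst hy
        exact ⟨by simp, hB a j x hx⟩
      | succ k ih =>
        intro j x hx y hy
        obtain ⟨u, hu, v, hv, rfl⟩ := hy
        obtain ⟨x', hx', h1, h2, -⟩ := hq.mem_outcomes hu
        rw [h1] at hv
        have h3 := ih (j + 1) x' (by
          rw [iterP_succ', PMF.mem_support_bind']; exact ⟨x, hx, hx'⟩) v hv
        have h4 := t.eval_mono_nat (hB a j x hx)
        refine ⟨?_, h3.2⟩
        have := h3.1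
        simp only
        rw [add_mul, one_mul]
        omega
    have h5 := key _ 0 (ini a) (by rw [iterP, PMF.mem_support_pure']) w hw
    simp only [len_prod, len_data] at hu3
    have h6 : (cnt a).size * t.eval (B.eval (len a)) ≤
      s.eval (len a) * t.eval (B.eval (len a)) := Nat.mul_le_mul_right _ (by omega)
    simp only [charge, len_code, Data.size, Polynomial.eval_add, Polynomial.eval_X,
        Polynomial.eval_mul, Polynomial.eval_ofNat, Polynomial.eval_comp]
    omega

/-! ## Folding over lists -/

/-- One round of a fold over a list, with parameter `c` and accumulator `b`. -/
def foldStep (G : γ × β × α → PMF β) (s : List α × γ × β) : PMF (List α × γ × β) :=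
  match s.1 with
  | [] => pure s
  | a :: l => (fun b => (l, s.2.1, b)) <$> G (s.2.1, s.2.2, a)

theorem foldStep_ppt {G : γ × β × α → PMF β} (hG : PPT G) : PPT (foldStep G) := by
  have h1 : PPT fun x : (List α × γ × β) × α × List α =>
      (fun b => (x.2.2, x.1.2.1, b)) <$> G (x.1.2.1, x.1.2.2, x.2.1) :=
    PPT.map (g := fun x b => (x.2.2, x.1.2.1, b))
      (hG.comp_polyTime (f := fun x : (List α × γ × β) × α × List α =>
        (x.1.2.1, x.1.2.2, x.2.1)) (by fun_prop)) (by fun_prop)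
  exact PPT.listElim (l := Prod.fst) (by fun_prop) (PolyTime.id').ppt h1

-- Rounds beyond the end of the list do nothing. The size of the code of the list can therefore
-- serve as the loop count, although it exceeds the number of elements.
omit [Coded α] [Coded β] [Coded γ] in
theorem iterP_foldStep (G : γ × β × α → PMF β) (l : List α) (c : γ) (b : β) (k : ℕ)
    (hk : l.length ≤ k) : iterP (foldStep G) k (l, c, b) =
      (fun b' => ([], c, b')) <$> l.foldlM (fun b a => G (c, b, a)) b := by
  induction k generalizing l b with
  | zero =>
    have : l = [] := by simpa using hk
    subst this
    simp [iterP]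
  | succ k ih =>
    cases l with
    | nil =>
      rw [iterP, foldStep, pure_bind, ih _ _ (by simp)]
    | cons a l =>
      rw [iterP, foldStep, bind_map_left, List.foldlM_cons, map_bind]
      congr 1; funext b'
      exact ih _ _ (by simpa using hk)

/-- A potential argument: the length of the accumulator plus the length of the remaining list times
the maximal growth per round never increases, since each consumed element shortens the list by at
least one. -/
theorem len_foldStep (G : γ × β × α → PMF β) (g : Polynomial ℕ)
    (hg : ∀ c b a, ∀ y ∈ (G (c, b, a)).support, len y ≤ len b + g.eval (len c + len a))
    (s₀ : List α × γ × β) (k : ℕ) : ∀ s ∈ (iterP (foldStep G) k s₀).support,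
      s.2.1 = s₀.2.1 ∧ len s.1 ≤ len s₀.1 ∧
      len s.2.2 + len s.1 * g.eval (len s₀.2.1 + len s₀.1) ≤
        len s₀.2.2 + len s₀.1 * g.eval (len s₀.2.1 + len s₀.1) := by
  induction k with
  | zero =>
    intro s hs
    rw [iterP, PMF.mem_support_pure'] at hs
    subst hs; simp
  | succ k ih =>
    intro s' hs'
    rw [iterP_succ', PMF.mem_support_bind'] at hs'
    obtain ⟨⟨l, c, b⟩, hs, hs'⟩ := hs'
    obtain ⟨h1, h2, h3⟩ := ih _ hs
    cases l with
    | nil =>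
      rw [foldStep, PMF.mem_support_pure'] at hs'
      subst hs'; exact ⟨h1, h2, h3⟩
    | cons a l =>
      rw [foldStep, PMF.mem_support_map'] at hs'
      obtain ⟨y, hy, rfl⟩ := hs'
      simp only [len_cons] at h1 h2 h3 ⊢
      have h4 := hg _ _ _ y hy
      simp only [h1] at h4
      have h5 := g.eval_mono_nat (show len s₀.2.1 + len a ≤ len s₀.2.1 + len s₀.1 by omega)
      refine ⟨h1, by omega, ?_⟩
      have h6 : (1 + len a + len l) * g.eval (len s₀.2.1 + len s₀.1) ≥
        (1 + len l) * g.eval (len s₀.2.1 + len s₀.1) := Nat.mul_le_mul_right _ (by omega)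
      rw [add_mul (1 : ℕ), one_mul] at h6
      omega

/-- Folding over a list, where each round makes the accumulator longer by at most a polynomial in
the lengths of the list element and the parameter. -/
theorem PPT.foldlM {L : δ → List α} {C : δ → γ} {B : δ → β} (hL : PolyTime L) (hC : PolyTime C)
    (hB : PolyTime B) {G : γ × β × α → PMF β} (hG : PPT G) (g : Polynomial ℕ)
    (hg : ∀ c b a, ∀ y ∈ (G (c, b, a)).support, len y ≤ len b + g.eval (len c + len a)) :
    PPT fun d => (L d).foldlM (fun b a => G (C d, b, a)) (B d) := by
  obtain ⟨tL, htL⟩ := hL.exists_len_le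
  obtain ⟨tC, htC⟩ := hC.exists_len_le
  obtain ⟨tB, htB⟩ := hB.exists_len_le
  have h1 := PPT.iterate (cnt := fun d => Coded.code (L d)) (ini := fun d => (L d, C d, B d))
    (F := foldStep G) (by fun_prop) (by fun_prop) (foldStep_ppt hG)
    (2 + tL + tC + tB + tL * g.comp (tC + tL)) (fun d k s hs => by
      obtain ⟨h1, h2, h3⟩ := len_foldStep G g hg _ k s hs
      simp only at h1 h2 h3
      have e1 := htL d
      have e2 := htC d
      have e3 := htB d
      have e4 := g.eval_mono_nat (show len (C d) + len (L d) ≤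
        tC.eval (len d) + tL.eval (len d) by omega)
      have e5 := Nat.mul_le_mul e1 e4
      simp only [len_prod, h1, Polynomial.eval_add, Polynomial.eval_mul, Polynomial.eval_comp,
        Polynomial.eval_ofNat]
      omega)
  have h2 : PPT fun d => (fun s : List α × γ × β => s.2.2) <$>
      iterP (foldStep G) (Coded.code (L d)).size (L d, C d, B d) :=
    PPT.map (g := fun _ s => s.2.2) h1 (by fun_prop)
  refine PPT.of_eq h2 fun d => ?_
  rw [show (Coded.code (L d)).size = len (L d) from rfl,
    iterP_foldStep _ _ _ _ _ (length_le_len _)]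
  simp

omit [Coded α] [Coded β] in
theorem List.foldlM_pure' {m : Type → Type} [Monad m] [LawfulMonad m] (f : β → α → β)
    (l : List α) (b : β) : l.foldlM (fun b a => (pure (f b a) : m β)) b = pure (l.foldl f b) := by
  induction l generalizing b with
  | nil => rfl
  | cons a l ih => simp [ih]

theorem PolyTime.foldl {L : δ → List α} {C : δ → γ} {B : δ → β} (hL : PolyTime L)
    (hC : PolyTime C) (hB : PolyTime B) {f : γ → β → α → β}
    (hf : PolyTime fun x : γ × β × α => f x.1 x.2.1 x.2.2) (g : Polynomial ℕ)
    (hg : ∀ c b a, len (f c b a) ≤ len b + g.eval (len c + len a)) :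
    PolyTime fun d => (L d).foldl (f (C d)) (B d) := by
  have h := PPT.foldlM hL hC hB hf.ppt g (fun c b a y hy => by
    rw [PMF.mem_support_pure'] at hy; subst hy; exact hg c b a)
  refine PPT.of_eq h fun d => ?_
  exact List.foldlM_pure' _ _ _

/-! ## Arithmetic and list operations -/

theorem PolyTime.optionIsSome : PolyTime (Option.isSome : Option α → Bool) := by
  have := PolyTime.optionElim (o := fun o : Option α => o) PolyTime.id' (.const false)
    (g := fun _ _ => true) (by fun_prop)
  refine this.of_eq fun o => ?_
  cases o <;> rfl

theorem PolyTime.bool_of_prop {f : α → Bool} (hf : PolyTime f) :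
    PolyTime fun a => decide (f a = true) := by simpa using hf

@[fun_prop]
theorem PolyTime.not {f : α → Bool} (hf : PolyTime f) : PolyTime fun a => !f a := by
  have := PolyTime.ite hf.bool_of_prop (.const false) (.const true)
  refine this.of_eq fun a => ?_
  cases f a <;> rfl

@[fun_prop]
theorem PolyTime.and {f g : α → Bool} (hf : PolyTime f) (hg : PolyTime g) :
    PolyTime fun a => f a && g a := by
  have := PolyTime.ite hf.bool_of_prop hg (.const false)
  refine this.of_eq fun a => ?_
  cases f a <;> rfl

@[fun_prop]
theorem PolyTime.or {f g : α → Bool} (hf : PolyTime f) (hg : PolyTime g) :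
    PolyTime fun a => f a || g a := by
  have := PolyTime.ite hf.bool_of_prop (.const true) hg
  refine this.of_eq fun a => ?_
  cases f a <;> rfl

theorem PolyTime.listAny {L : δ → List α} (hL : PolyTime L) {f : δ → α → Bool}
    (hf : PolyTime fun x : δ × α => f x.1 x.2) : PolyTime fun d => (L d).any (f d) := by
  have := PolyTime.foldl hL PolyTime.id' (.const false) (f := fun d b a => b || f d a)
    (by fun_prop) 3 (fun c b a => by
      have := len_bool (b || f c a)
      simp only [Polynomial.eval_ofNat]; omega)
  refine this.of_eq fun d => ?_
  have h : ∀ (l : List α) b, l.foldl (fun b a => b || f d a) b = (b || l.any (f d)) := by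
    intro l
    induction l with
    | nil => simp
    | cons a l ih => intro b; simp [ih, Bool.or_assoc]
  rw [h]; simp

theorem PolyTime.listAll {L : δ → List α} (hL : PolyTime L) {f : δ → α → Bool}
    (hf : PolyTime fun x : δ × α => f x.1 x.2) : PolyTime fun d => (L d).all (f d) := by
  have := (PolyTime.listAny hL (f := fun d a => !f d a) hf.not).not
  refine this.of_eq fun d => ?_
  simp [List.not_any_eq_all_not]

theorem PolyTime.listFindSome {L : δ → List α} (hL : PolyTime L) {f : δ → α → Option β}
    (hf : PolyTime fun x : δ × α => f x.1 x.2) : PolyTime fun d => (L d).findSome? (f d) := by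
  obtain ⟨t, ht⟩ := hf.exists_len_le
  have h1 : PolyTime fun x : δ × Option β × α =>
      x.2.1.elim (f x.1 x.2.2) fun b => some b :=
    PolyTime.optionElim (by fun_prop) (hf.comp (f := fun x : δ × Option β × α => (x.1, x.2.2))
      (by fun_prop)) (by fun_prop)
  have := PolyTime.foldl hL PolyTime.id' (.const none)
    (f := fun d (b : Option β) a => b.elim (f d a) fun b => some b) h1 (t.comp (1 + Polynomial.X))
    (fun c b a => by
      cases b with
      | none =>
        have := ht (c, a)
        simp only [len_prod, add_assoc] at this
        simp only [Option.elim, Polynomial.eval_comp, Polynomial.eval_add, Polynomial.eval_one,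
          Polynomial.eval_X]
        omega
      | some b => simp [Option.elim])
  refine this.of_eq fun d => ?_
  have h : ∀ (l : List α) (b : Option β), l.foldl (fun (b : Option β) a =>
      b.elim (f d a) fun b => some b) b = b.elim (l.findSome? (f d)) fun b => some b := by
    intro l
    induction l with
    | nil => intro b; cases b <;> rfl
    | cons a l ih =>
      intro b
      rw [List.foldl_cons, ih]
      cases b with
      | some b => rfl
      | none =>
        simp only [Option.elim_none, List.findSome?_cons]
        cases f d a <;> rfl
  rw [h]; rfl

/-- The distinct elements `f a`, for `a` in the list. -/
def collect {α β : Type} [DecidableEq β] (f : α → Option β) (l : List α) : List β :=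
  l.foldl (fun acc a => (f a).elim acc fun b => if acc.any (fun c => decide (c = b)) then acc
    else b :: acc) []

theorem collect_spec {α β : Type} [DecidableEq β] (f : α → Option β) (l : List α) :
    (collect f l).Nodup ∧ ∀ b, b ∈ collect f l ↔ ∃ a ∈ l, f a = some b := by
  have key : ∀ (l : List α) (acc : List β), acc.Nodup →
      (l.foldl (fun acc a => (f a).elim acc fun b => if acc.any (fun c => decide (c = b)) then acc
        else b :: acc) acc).Nodup ∧ ∀ b, b ∈ l.foldl (fun acc a => (f a).elim acc fun b =>
          if acc.any (fun c => decide (c = b)) then acc else b :: acc) acc ↔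
            b ∈ acc ∨ ∃ a ∈ l, f a = some b := by
    intro l
    induction l with
    | nil => intro acc h; simpa using h
    | cons a l ih =>
      intro acc h
      rw [List.foldl_cons]
      cases hf : f a with
      | none =>
        obtain ⟨h1, h2⟩ := ih acc h
        refine ⟨h1, fun b => ?_⟩
        rw [Option.elim_none, h2]
        simp [hf]
      | some b =>
        rw [Option.elim_some]
        by_cases hb : b ∈ acc
        · rw [if_pos (by simpa using hb)]
          obtain ⟨h1, h2⟩ := ih acc h
          refine ⟨h1, fun b' => ?_⟩
          rw [h2]
          simp only [List.mem_cons, exists_eq_or_imp, hf, Option.some.injEq]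
          grind
        · rw [if_neg (by simpa using hb)]
          obtain ⟨h1, h2⟩ := ih (b :: acc) (List.nodup_cons.2 ⟨hb, h⟩)
          refine ⟨h1, fun b' => ?_⟩
          rw [h2]
          simp only [List.mem_cons, exists_eq_or_imp, hf, Option.some.injEq]
          grind
  simpa [collect] using key l [] List.nodup_nil

theorem PolyTime.collect [DecidableEq β] {L : δ → List α} (hL : PolyTime L)
    {f : δ → α → Option β} (hf : PolyTime fun x : δ × α => f x.1 x.2) :
    PolyTime fun d => collect (f d) (L d) := by
  obtain ⟨t, ht⟩ := hf.exists_len_le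
  have h0 : PolyTime fun y : (δ × List β × α) × β =>
      y.1.2.1.any fun c => decide (c = y.2) :=
    PolyTime.listAny (by fun_prop) (by fun_prop)
  have h1 : PolyTime fun x : δ × List β × α => (f x.1 x.2.2).elim x.2.1 fun b =>
      if x.2.1.any (fun c => decide (c = b)) then x.2.1 else b :: x.2.1 :=
    PolyTime.optionElim (hf.comp (f := fun x : δ × List β × α => (x.1, x.2.2)) (by fun_prop))
      (by fun_prop) (PolyTime.ite h0.bool_of_prop (by fun_prop) (by fun_prop))
  exact PolyTime.foldl hL PolyTime.id' (.const [])
    (f := fun d (acc : List β) a => (f d a).elim acc fun b =>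
      if acc.any (fun c => decide (c = b)) then acc else b :: acc) h1
    (1 + t.comp (1 + Polynomial.X)) (fun c b a => by
      have := ht (c, a)
      simp only [len_prod, add_assoc] at this
      simp only [Polynomial.eval_comp, Polynomial.eval_add, Polynomial.eval_one, Polynomial.eval_X]
      cases h : f c a with
      | none => simp
      | some y =>
        simp only [h, len_some] at this
        simp only [Option.elim]
        split
        · omega
        · rw [len_cons]; omega)

@[fun_prop]
theorem PolyTime.listLength : PolyTime (List.length : List α → ℕ) := by
  have := PolyTime.foldl (L := fun l : List α => l) PolyTime.id' (.const Data.nil) (.const 0)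
    (f := fun _ n _ => n + 1) (by fun_prop) 2 (fun c b a => by
      simp only [len_succ, Polynomial.eval_ofNat]; omega)
  refine this.of_eq fun l => ?_
  have h : ∀ (l : List α) (n : ℕ), l.foldl (fun n _ => n + 1) n = n + l.length := by
    intro l
    induction l with
    | nil => simp
    | cons a l ih => intro n; simp [ih]; omega
  rw [h, Nat.zero_add]

/-- A fold over `k` dummy elements. Additive growth per round, depending on the parameter only,
keeps the values polynomially long. -/
theorem PolyTime.iterate {k : δ → ℕ} {C : δ → γ} {B : δ → β} (hk : PolyTime k)
    (hC : PolyTime C) (hB : PolyTime B) {f : γ → β → β}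
    (hf : PolyTime fun x : γ × β => f x.1 x.2) (g : Polynomial ℕ)
    (hg : ∀ c b, len (f c b) ≤ len b + g.eval (len c)) :
    PolyTime fun d => (f (C d))^[k d] (B d) := by
  have := PolyTime.foldl (L := fun d => List.replicate (k d) Data.nil)
    (PolyTime.listReplicate.comp hk) hC hB (f := fun c b _ => f c b)
    (hf.comp (f := fun x : γ × β × Data => (x.1, x.2.1)) (by fun_prop)) g (fun c b a =>
      (hg c b).trans (by have := g.eval_mono_nat (show len c ≤ len c + len a by omega); omega))
  refine this.of_eq fun d => ?_
  generalize B d = b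
  induction k d generalizing b with
  | zero => rfl
  | succ k ih => rw [List.replicate_succ, List.foldl_cons, ih]; rfl

@[fun_prop]
theorem PolyTime.add {f g : δ → ℕ} (hf : PolyTime f) (hg : PolyTime g) :
    PolyTime fun d => f d + g d := by
  have := PolyTime.iterate hg (.const Data.nil) hf (f := fun _ n => n + 1) (by fun_prop) 2
    (fun c b => by simp only [len_succ, Polynomial.eval_ofNat]; omega)
  refine this.of_eq fun d => ?_
  simp

theorem len_add (a b : ℕ) : len (a + b) ≤ len a + 2 * len b := by
  induction b with
  | zero => simp
  | succ b ih => rw [← add_assoc, len_succ, len_succ]; omega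

@[fun_prop]
theorem PolyTime.mul {f g : δ → ℕ} (hf : PolyTime f) (hg : PolyTime g) :
    PolyTime fun d => f d * g d := by
  have := PolyTime.iterate hf hg (.const 0) (f := fun c n => n + c) (by fun_prop)
    (2 * Polynomial.X)
    (fun c b => by simpa using len_add b c)
  refine this.of_eq fun d => ?_
  simp

theorem PolyTime.polynomial (t : Polynomial ℕ) : PolyTime fun n : ℕ => t.eval n := by
  induction t using Polynomial.induction_on' with
  | add p q hp hq => simp only [Polynomial.eval_add]; fun_prop
  | monomial k a =>
    simp only [Polynomial.eval_monomial]
    refine PolyTime.mul (.const a) ?_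
    induction k with
    | zero => simp only [pow_zero]; fun_prop
    | succ k ih => simp only [pow_succ]; fun_prop

theorem PolyTime.pred : PolyTime fun n : ℕ => n - 1 :=
  .of_right fun n => by cases n <;> rfl

-- `f d < g d` means that the truncated difference `g d - f d`, an iterated predecessor, is not
-- zero.
@[fun_prop]
theorem PolyTime.decide_lt {f g : δ → ℕ} (hf : PolyTime f) (hg : PolyTime g) :
    PolyTime fun d => decide (f d < g d) := by
  have h1 := PolyTime.iterate hf (.const Data.nil) hg (f := fun _ n => n - 1)
    (PolyTime.pred.comp (by fun_prop)) 0 (fun c b => by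
      cases b <;> simp)
  have h2 := (h1.decide_eq (.const 0)).not
  refine h2.of_eq fun d => ?_
  have h : ∀ k b : ℕ, (fun n : ℕ => n - 1)^[k] b = b - k := by
    intro k
    induction k with
    | zero => simp
    | succ k ih => intro b; rw [Function.iterate_succ_apply, ih]; omega
  rw [h]
  by_cases hlt : f d < g d
  · simp [hlt]; omega
  · simp [hlt]; omega

/-! ## Coins -/

theorem flip_ppt : PPT fun _ : α => fairCoin := by
  refine ppt_iff.2 ⟨.flip, 10 + Polynomial.X, fun a => Prog.val_flip _, fun a y hy => ?_⟩
  rw [mem_outcomes_flip] at hy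
  obtain ⟨b, rfl⟩ := hy
  have := len_bool b
  simp only [charge, len_code, Polynomial.eval_add, Polynomial.eval_X, Polynomial.eval_ofNat]
  omega

/-- The coin is split off at the end, not at the beginning, because the sampling program prepends
each new bit to an accumulator: the bit tossed first comes last. -/
theorem uniform_snoc (n : ℕ) :
    PMF.uniformOfFintype (Fin (n + 1) → Bool) = fairCoin >>= fun b =>
      (fun v : Fin n → Bool => Fin.snoc (α := fun _ => Bool) v b) <$>
        PMF.uniformOfFintype (Fin n → Bool) := by
  ext v
  change _ = (fairCoin.bind fun b => PMF.map (fun v : Fin n → Bool =>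
    Fin.snoc (α := fun _ => Bool) v b) (PMF.uniformOfFintype (Fin n → Bool))) v
  rw [PMF.bind_apply, tsum_eq_single (v (Fin.last n)), PMF.map_apply,
    tsum_eq_single (Fin.init (α := fun _ => Bool) v)]
  · simp only [Fin.snoc_init_self, if_true, fairCoin, PMF.uniformOfFintype_apply]
    simp only [Fintype.card_fun, Fintype.card_fin, Fintype.card_bool, Nat.cast_pow, Nat.cast_ofNat, Nat.cast_mul,
      pow_succ]
    rw [ENNReal.mul_inv (by simp) (by simp), mul_comm]
  · intro w hw
    refine if_neg fun h => hw ?_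
    rw [h, Fin.init_snoc]
  · intro b hb
    refine mul_eq_zero_of_right _ ?_
    rw [PMF.map_apply, ENNReal.tsum_eq_zero]
    intro w
    refine if_neg fun h => hb ?_
    rw [h, Fin.snoc_last]

theorem randomBits_succ (n : ℕ) :
    randomBits (n + 1) = fairCoin >>= fun b => (fun l => l ++ [b]) <$> randomBits n := by
  rw [randomBits, uniform_snoc, ← PMF.monad_map_eq_map, map_bind]
  congr 1; funext b
  rw [randomBits, ← PMF.monad_map_eq_map, Functor.map_map, Functor.map_map]
  congr 1; funext v
  rw [List.ofFn_succ']
  simp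

theorem randomBits_ppt : PPT randomBits := by
  have h := PPT.foldlM (L := fun n : ℕ => List.replicate n Data.nil) (C := fun _ => Data.nil)
    (B := fun _ => ([] : List Bool)) (by fun_prop) (by fun_prop) (by fun_prop)
    (G := fun x => (fun b => b :: x.2.1) <$> fairCoin)
    (PPT.map (g := fun (x : Data × List Bool × Data) b => b :: x.2.1) flip_ppt (by fun_prop)) 4
    (fun c b a y hy => by
      rw [PMF.mem_support_map'] at hy
      obtain ⟨x, -, rfl⟩ := hy
      have := len_bool x
      simp only [len_cons, Polynomial.eval_ofNat]; omega)
  refine h.of_eq fun n => ?_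
  have key : ∀ (n : ℕ) (acc : List Bool), (List.replicate n Data.nil).foldlM
      (fun b _ => (fun x => x :: b) <$> fairCoin) acc = (fun l => l ++ acc) <$> randomBits n := by
    intro n
    induction n with
    | zero =>
      intro acc
      rw [randomBits, ← PMF.monad_map_eq_map, Functor.map_map]
      simp only [List.ofFn_zero, List.nil_append, List.replicate_zero, List.foldlM_nil]
      exact (PMF.map_const _ _).symm
    | succ n ih =>
      intro acc
      rw [List.replicate_succ, List.foldlM_cons, bind_map_left, randomBits_succ, map_bind]
      congr 1; funext b
      rw [ih, Functor.map_map]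
      simp
  rw [key n []]
  simp

end

/-! ## Rearranging data -/

/-- Programs that only rearrange their input. -/
def Prog.IsGlue : Prog → Prop
  | .id | .nil | .fst | .snd => True
  | .pair p q | .comp p q => p.IsGlue ∧ q.IsGlue
  | _ => False

/-- The value of a rearranging program. -/
def Prog.gval : Prog → Data → Data
  | .id, x => x
  | .fst, x => x.left
  | .snd, x => x.right
  | .pair p q, x => .pair (p.gval x) (q.gval x)
  | .comp p q, x => p.gval (q.gval x)
  | _, _ => .nil

/-- The cost of a rearranging program, per node of the input. -/
def Prog.gcost : Prog → ℕ
  | .pair p q => 3 + 2 * p.gcost + 2 * q.gcost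
  | .comp p q => 2 + q.gcost + 2 * (p.gcost * q.gcost)
  | _ => 3

/-- Rearranging takes linear time. The factor for a composition involves the product of the factors
because the intermediate result is no longer than the cost of producing it. -/
theorem Prog.IsGlue.outcomes {p : Prog} (hp : p.IsGlue) (O : Data → Set Data) (x : Data)
    (y : Data × ℕ) (hy : y ∈ p.outcomes O x) : y.1 = p.gval x ∧ y.2 ≤ p.gcost * x.size := by
  induction p generalizing x y with
  | id =>
    rw [mem_outcomes_id] at hy; subst hy
    have := x.size_pos
    exact ⟨rfl, by simp only [charge, Prog.gcost]; omega⟩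
  | nil =>
    rw [mem_outcomes_nil] at hy; subst hy
    have := x.size_pos
    exact ⟨rfl, by simp only [charge, Prog.gcost, Data.size]; omega⟩
  | fst =>
    rw [mem_outcomes_fst] at hy; subst hy
    have := x.size_pos
    have := x.size_left
    exact ⟨rfl, by simp only [charge, Prog.gcost]; omega⟩
  | snd =>
    rw [mem_outcomes_snd] at hy; subst hy
    have := x.size_pos
    have := x.size_right
    exact ⟨rfl, by simp only [charge, Prog.gcost]; omega⟩
  | pair p q ihp ihq =>
    rw [mem_outcomes_pair] at hy
    obtain ⟨u, hu, v, hv, rfl⟩ := hy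
    obtain ⟨h1, h2⟩ := ihp hp.1 x u hu
    obtain ⟨h3, h4⟩ := ihq hp.2 x v hv
    have h5 := Prog.size_le_cost _ _ _ _ hu
    have h6 := Prog.size_le_cost _ _ _ _ hv
    refine ⟨by simp only [charge, Prog.gval, h1, h3], ?_⟩
    simp only [charge, Prog.gcost, Data.size]
    have := x.size_pos
    nlinarith
  | comp p q ihp ihq =>
    rw [mem_outcomes_comp] at hy
    obtain ⟨u, hu, v, hv, rfl⟩ := hy
    obtain ⟨h1, h2⟩ := ihq hp.2 x u hu
    obtain ⟨h3, h4⟩ := ihp hp.1 _ v hv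
    have h5 := Prog.size_le_cost _ _ _ _ hu
    have h6 := Prog.size_le_cost _ _ _ _ hv
    refine ⟨by simp only [charge, Prog.gval, h1, h3], ?_⟩
    simp only [charge, Prog.gcost]
    have := x.size_pos
    have h7 : p.gcost * u.1.size ≤ p.gcost * (q.gcost * x.size) := by gcongr; omega
    nlinarith
  | _ => exact hp.elim

theorem Prog.IsGlue.eval {m : Type → Type} [Monad m] [LawfulMonad m] {p : Prog} (hp : p.IsGlue)
    (coin : m Bool) (O : Data → m Data) (x : Data) : p.eval coin O x = pure (p.gval x) := by
  induction p generalizing x with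
  | id => exact Prog.eval_id ..
  | nil => exact Prog.eval_nil ..
  | fst => exact Prog.eval_fst ..
  | snd => exact Prog.eval_snd ..
  | pair p q ihp ihq => rw [Prog.eval_pair, ihp hp.1, ihq hp.2, pure_bind, pure_bind]; rfl
  | comp p q ihp ihq => rw [Prog.eval_comp, ihq hp.2, pure_bind, ihp hp.1]; rfl
  | _ => exact hp.elim

/-! ## Answering the queries of a program by a stateful program -/

/-- From `((x, s), (y, s'))` to `(x, s')`. -/
def Prog.restart : Prog := .pair (.comp .fst .fst) (.comp .snd .snd)

/-- From `((x, s), (y, s'))` to `y`. -/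
def Prog.result : Prog := .comp .fst .snd

/-- From `(y, (z, s))` to `((y, z), s)`. -/
def Prog.assoc : Prog := .pair (.pair .fst (.comp .fst .snd)) (.comp .snd .snd)

/-- From `((c, x), s)` to `(c, (x, s))`. -/
def Prog.unassoc : Prog := .pair (.comp .fst .fst) (.pair (.comp .snd .fst) .snd)

/-- Run a program, with queries answered by the program `Q`, which maps a query and a state to the
answer and the new state. The input and the output of the resulting program are paired with the
state. -/
def Prog.subst (p Q : Prog) : Prog :=
  match p with
  | .id => .id
  | .nil => .pair .nil .snd
  | .fst => .pair (.comp .fst .fst) .snd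
  | .snd => .pair (.comp .snd .fst) .snd
  | .eq => .pair (.comp .eq .fst) .snd
  | .flip => .pair .flip .snd
  | .query => Q
  | .pair p q => .comp .assoc
      (.comp (.pair .result (.comp (q.subst Q) .restart)) (.pair .id (p.subst Q)))
  | .comp p q => .comp (p.subst Q) (q.subst Q)
  | .ite p q r => .comp
      (.ite .result (.comp (q.subst Q) .restart) (.comp (r.subst Q) .restart))
      (.pair .id (p.subst Q))
  | .loop p => .ite .fst (.comp (.loop (p.subst Q)) .unassoc) .id

/-! ### The cost of the substituted program. -/

section cost

variable (O OA : Data → Set Data) (Q : Prog) (Inv : Data → Prop) (g h : ℕ → ℕ)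

/-- The bounds on the state and the cost of a simulated run of cost `c`. -/
def SimBound (s s' : Data) (c c' : ℕ) : Prop :=
  ∀ T S, c ≤ T → s.size + c * g T ≤ S →
    s'.size ≤ s.size + c * g T ∧ c' ≤ c * (10000 * (T + S + 1) + h (T + S))

/-- The program `p'` simulates the program `p` on the input `x` and the state `s`. -/
def Simulates (out out' : Set (Data × ℕ)) (s : Data) : Prop :=
  ∀ y ∈ out', ∃ z s' c, y.1 = .pair z s' ∧ (z, c) ∈ out ∧ Inv s' ∧ SimBound g h s s' c y.2

variable {O OA Q Inv g h}

theorem SimBound.one {s s' z x : Data} {c' : ℕ} (hs : s'.size ≤ s.size)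
    (hc : c' ≤ 1000 * (x.size + s.size + z.size)) (c₀ : ℕ) :
    SimBound g h s s' (1 + x.size + z.size + c₀) c' := by
  intro T S hT hS
  refine ⟨hs.trans (Nat.le_add_right _ _), ?_⟩
  have h1 : s.size ≤ S := by omega
  calc c' ≤ 1 * (10000 * (T + S + 1) + h (T + S)) := by omega
    _ ≤ _ := Nat.mul_le_mul_right _ (by omega)

theorem simulates_simple {p p' : Prog} {x s : Data} (hs : Inv s)
    (hp : ∀ y ∈ p'.outcomes O (.pair x s), ∃ z, y.1 = .pair z s ∧ (z, 1 + x.size + z.size + 0) ∈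
      p.outcomes OA x ∧ y.2 ≤ 1000 * (x.size + s.size + z.size)) :
    Simulates Inv g h (p.outcomes OA x) (p'.outcomes O (.pair x s)) s := by
  intro y hy
  obtain ⟨z, h1, h2, h3⟩ := hp y hy
  exact ⟨z, s, _, h1, h2, hs, SimBound.one le_rfl h3 0⟩

/-- Additivity is the reason why `SimBound` quantifies over all upper bounds `T` and `S`: both parts
can be measured against the bounds for the whole run. -/
theorem SimBound.trans {s₀ s₁ s₂ : Data} {c₁ c₁' c₂ c₂' : ℕ}
    (h1 : SimBound g h s₀ s₁ c₁ c₁') (h2 : SimBound g h s₁ s₂ c₂ c₂') :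
    SimBound g h s₀ s₂ (c₁ + c₂) (c₁' + c₂') := by
  intro T S hT hS
  rw [add_mul] at hS
  obtain ⟨e1, e2⟩ := h1 T S (by omega) (by omega)
  obtain ⟨e3, e4⟩ := h2 T S (by omega) (by omega)
  rw [add_mul, add_mul]
  omega

/-- One more step of the simulated program pays for the overhead of the simulation. -/
theorem SimBound.trans_overhead {s₀ s₁ s₂ : Data} {c₁ c₁' c₂ c₂' k c' : ℕ}
    (h1 : SimBound g h s₀ s₁ c₁ c₁') (h2 : SimBound g h s₁ s₂ c₂ c₂') (hk : 0 < k)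
    (he : ∀ T S, k + (c₁ + c₂) ≤ T → s₀.size ≤ S → s₁.size ≤ S → s₂.size ≤ S →
      c' ≤ 10000 * (T + S + 1) + (c₁' + c₂')) : SimBound g h s₀ s₂ (k + (c₁ + c₂)) c' := by
  intro T S hT hS
  rw [add_mul, add_mul] at hS
  obtain ⟨e1, e2⟩ := h1 T S (by omega) (by omega)
  obtain ⟨e3, e4⟩ := h2 T S (by omega) (by omega)
  have e5 := he T S hT (by omega) (by omega) (by omega)
  rw [add_mul, add_mul, add_mul k, add_mul c₁]
  have e6 : 1 * (10000 * (T + S + 1) + h (T + S)) ≤ k * (10000 * (T + S + 1) + h (T + S)) :=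
    Nat.mul_le_mul_right _ hk
  omega

theorem SimBound.refl (s : Data) : SimBound g h s s 0 0 := fun T S _ _ => by simp

theorem simulates_iter {f f' : Data → Set (Data × ℕ)}
    (hf : ∀ x s, Inv s → Simulates Inv g h (f x) (f' (.pair x s)) s) (k : ℕ) (x s : Data)
    (hs : Inv s) : Simulates Inv g h (iterOutcomes f k x) (iterOutcomes f' k (.pair x s)) s := by
  induction k generalizing x s with
  | zero =>
    intro y hy
    simp only [iterOutcomes, Set.mem_singleton_iff] at hy
    subst hy
    exact ⟨x, s, 0, rfl, rfl, hs, fun T S _ _ => by simp⟩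
  | succ k ih =>
    rintro y ⟨u, hu, v, hv, rfl⟩
    obtain ⟨z, s', c, h1, h2, h3, h4⟩ := hf x s hs u hu
    rw [h1] at hv
    obtain ⟨z', s'', c', h1', h2', h3', h4'⟩ := ih z s' h3 v hv
    exact ⟨z', s'', c + c', h1', ⟨(z, c), h2, (z', c'), h2', rfl⟩, h3', h4.trans h4'⟩

/-- A simulated run of cost `c` makes at most `c` queries, each of length at most `T`, so the state
grows by at most `c * g T`. Each simulated step costs an overhead linear in `T + S`, plus at most `h
(T + S)` if it is a query. The number `c` is the cost of an outcome of `p` itself with answers from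
`OA`, so a running-time bound for `p` against such oracles bounds the simulation as well. -/
theorem simulates_subst (hg : Monotone g) (hh : Monotone h)
    (hQ : ∀ v s, Inv s → ∀ y ∈ Q.outcomes O (.pair v s), ∃ a s', y.1 = .pair a s' ∧ a ∈ OA v ∧
      Inv s' ∧ s'.size ≤ s.size + g v.size ∧ y.2 ≤ h (v.size + s.size)) (p : Prog) (x s : Data)
    (hs : Inv s) :
    Simulates Inv g h (p.outcomes OA x) ((p.subst Q).outcomes O (.pair x s)) s := by
  induction p generalizing x s with
  | id =>
    refine simulates_simple hs fun y hy => ?_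
    rw [Prog.subst, mem_outcomes_id] at hy
    subst hy
    refine ⟨x, rfl, (mem_outcomes_id _ _ _).2 rfl, ?_⟩
    have := x.size_pos; have := s.size_pos
    simp only [charge, Data.size]; omega
  | nil =>
    refine simulates_simple hs fun y hy => ?_
    obtain ⟨h1, h2⟩ := Prog.IsGlue.outcomes (p := .pair .nil .snd) (by simp [Prog.IsGlue]) _ _ _ hy
    refine ⟨.nil, h1, (mem_outcomes_nil _ _ _).2 rfl, ?_⟩
    have := x.size_pos; have := s.size_pos
    simp only [Prog.gcost, Data.size] at h2 ⊢; omega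
  | fst =>
    refine simulates_simple hs fun y hy => ?_
    obtain ⟨h1, h2⟩ := Prog.IsGlue.outcomes (p := .pair (.comp .fst .fst) .snd)
      (by simp [Prog.IsGlue]) _ _ _ hy
    refine ⟨x.left, h1, (mem_outcomes_fst _ _ _).2 rfl, ?_⟩
    have := x.size_pos; have := s.size_pos
    simp only [Prog.gcost, Data.size] at h2 ⊢; omega
  | snd =>
    refine simulates_simple hs fun y hy => ?_
    obtain ⟨h1, h2⟩ := Prog.IsGlue.outcomes (p := .pair (.comp .snd .fst) .snd)
      (by simp [Prog.IsGlue]) _ _ _ hy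
    refine ⟨x.right, h1, (mem_outcomes_snd _ _ _).2 rfl, ?_⟩
    have := x.size_pos; have := s.size_pos
    simp only [Prog.gcost, Data.size] at h2 ⊢; omega
  | eq =>
    refine simulates_simple hs fun y hy => ?_
    rw [Prog.subst, mem_outcomes_pair] at hy
    obtain ⟨u, hu, v, hv, rfl⟩ := hy
    rw [mem_outcomes_comp] at hu
    obtain ⟨u, hu, w, hw, rfl⟩ := hu
    rw [mem_outcomes_fst] at hu
    rw [mem_outcomes_snd] at hv
    subst hu hv
    rw [mem_outcomes_eq] at hw
    subst hw
    refine ⟨x.eqTest, rfl, (mem_outcomes_eq _ _ _).2 rfl, ?_⟩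
    have := x.size_pos; have := s.size_pos
    simp only [charge, Data.size, Data.left, Data.right]; omega
  | flip =>
    refine simulates_simple hs fun y hy => ?_
    rw [Prog.subst, mem_outcomes_pair] at hy
    obtain ⟨u, hu, v, hv, rfl⟩ := hy
    rw [mem_outcomes_flip] at hu
    rw [mem_outcomes_snd] at hv
    obtain ⟨b, rfl⟩ := hu
    subst hv
    refine ⟨Coded.code b, rfl, (mem_outcomes_flip _ _ _).2 ⟨b, rfl⟩, ?_⟩
    have := x.size_pos; have := s.size_pos
    simp only [charge, Data.size, Data.right]; omega
  | query =>
    intro y hy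
    obtain ⟨a, s', h1, h2, h3, h4, h5⟩ := hQ x s hs y hy
    refine ⟨a, s', _, h1, (mem_outcomes_query _ _ _).2 ⟨a, h2, rfl⟩, h3, fun T S hT hS => ?_⟩
    simp only [add_zero] at hT hS ⊢
    have e1 := hg (show x.size ≤ T by omega)
    have e2 := hh (show x.size + s.size ≤ T + S by omega)
    -- Every query is charged at least one step, which pays for one growth of the state and one run
    -- of `Q`.
    have e3 : 1 * g T ≤ (1 + x.size + a.size) * g T := Nat.mul_le_mul_right _ (by omega)
    have e4 : 1 * (10000 * (T + S + 1) + h (T + S)) ≤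
      (1 + x.size + a.size) * (10000 * (T + S + 1) + h (T + S)) :=
      Nat.mul_le_mul_right _ (by omega)
    omega
  | pair p q ihp ihq =>
    intro y hy
    rw [Prog.subst, mem_outcomes_comp] at hy
    obtain ⟨y₃, hy₃, y₄, hy₄, rfl⟩ := hy
    rw [mem_outcomes_comp] at hy₃
    obtain ⟨y₁, hy₁, y₂, hy₂, rfl⟩ := hy₃
    rw [mem_outcomes_pair] at hy₁
    obtain ⟨u, hu, v, hv, rfl⟩ := hy₁
    rw [mem_outcomes_id] at hu
    subst hu
    obtain ⟨z, s₁, c₁, h1, h2, h3, h4⟩ := ihp x s hs v hv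
    simp only [charge, h1] at hy₂
    rw [mem_outcomes_pair] at hy₂
    obtain ⟨u, hu, w, hw, rfl⟩ := hy₂
    obtain ⟨e1, e2⟩ := Prog.IsGlue.outcomes (p := .result)
      (by simp [Prog.result, Prog.IsGlue]) _ _ _ hu
    simp only [Prog.result, Prog.gval, Data.left_pair, Data.right_pair] at e1
    rw [mem_outcomes_comp] at hw
    obtain ⟨w₁, hw₁, w₂, hw₂, rfl⟩ := hw
    obtain ⟨e3, e4⟩ := Prog.IsGlue.outcomes (p := .restart)
      (by simp [Prog.restart, Prog.IsGlue]) _ _ _ hw₁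
    simp only [Prog.restart, Prog.gval, Data.left_pair, Data.right_pair] at e3
    rw [e3] at hw₂
    obtain ⟨z', s₂, c₂, h1', h2', h3', h4'⟩ := ihq x s₁ h3 w₂ hw₂
    obtain ⟨e5, e6⟩ := Prog.IsGlue.outcomes (p := .assoc)
      (by simp [Prog.assoc, Prog.IsGlue]) _ _ _ hy₄
    simp only [charge, Prog.assoc, Prog.gval, Data.left_pair, Data.right_pair, e1, h1'] at e5
    refine ⟨.pair z z', s₂, (1 + x.size + (Data.pair z z').size) + (c₁ + c₂), ?_,
      (mem_outcomes_pair _ _ _ _ _).2 ⟨_, h2, _, h2', rfl⟩, h3', ?_⟩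
    · simp only [charge, e5]
    · have f1 := Prog.size_le_cost _ _ _ _ h2
      have f2 := Prog.size_le_cost _ _ _ _ h2'
      refine h4.trans_overhead h4' (by omega) fun T S hT hS hS₁ hS₂ => ?_
      simp only [charge, h1, h1', e1, e5, Data.size, Prog.result, Prog.restart, Prog.assoc,
        Prog.gcost] at *
      omega
  | comp p q ihp ihq =>
    intro y hy
    rw [Prog.subst, mem_outcomes_comp] at hy
    obtain ⟨u, hu, v, hv, rfl⟩ := hy
    obtain ⟨z, s₁, c₁, h1, h2, h3, h4⟩ := ihq x s hs u hu
    rw [h1] at hv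
    obtain ⟨z', s₂, c₂, h1', h2', h3', h4'⟩ := ihp z s₁ h3 v hv
    refine ⟨z', s₂, (1 + x.size + z'.size) + (c₁ + c₂), h1',
      (mem_outcomes_comp _ _ _ _ _).2 ⟨_, h2, _, h2', rfl⟩, h3', ?_⟩
    simp only [charge]
    refine h4.trans_overhead h4' (by omega) fun T S hT hS hS₁ hS₂ => ?_
    simp only [h1', Data.size]
    omega
  | ite p q r ihp ihq ihr =>
    intro y hy
    rw [Prog.subst, mem_outcomes_comp] at hy
    obtain ⟨y₁, hy₁, y₂, hy₂, rfl⟩ := hy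
    rw [mem_outcomes_pair] at hy₁
    obtain ⟨u, hu, v, hv, rfl⟩ := hy₁
    rw [mem_outcomes_id] at hu
    subst hu
    obtain ⟨z, s₁, c₁, h1, h2, h3, h4⟩ := ihp x s hs v hv
    simp only [charge, h1] at hy₂
    rw [mem_outcomes_ite] at hy₂
    obtain ⟨u, hu, w, hw, rfl⟩ := hy₂
    obtain ⟨e1, e2⟩ := Prog.IsGlue.outcomes (p := .result)
      (by simp [Prog.result, Prog.IsGlue]) _ _ _ hu
    simp only [Prog.result, Prog.gval, Data.left_pair, Data.right_pair] at e1
    -- The chosen branch is written as a single program, so that both branches can be treated at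
    -- once.
    have hw' : w ∈ (Prog.comp ((if z = .nil then r else q).subst Q) .restart).outcomes O
        (.pair (.pair x s) (.pair z s₁)) := by
      rw [e1] at hw
      split at hw
      · rw [if_pos ‹_›]; exact hw
      · rw [if_neg ‹_›]; exact hw
    have ih : ∀ s, Inv s → Simulates Inv g h ((if z = .nil then r else q).outcomes OA x)
        (((if z = .nil then r else q).subst Q).outcomes O (.pair x s)) s := by
      intro s hs
      split
      · exact ihr x s hs
      · exact ihq x s hs
    rw [mem_outcomes_comp] at hw'
    obtain ⟨w₁, hw₁, w₂, hw₂, rfl⟩ := hw'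
    obtain ⟨e3, e4⟩ := Prog.IsGlue.outcomes (p := .restart)
      (by simp [Prog.restart, Prog.IsGlue]) _ _ _ hw₁
    simp only [Prog.restart, Prog.gval, Data.left_pair, Data.right_pair] at e3
    rw [e3] at hw₂
    obtain ⟨z', s₂, c₂, h1', h2', h3', h4'⟩ := ih s₁ h3 w₂ hw₂
    refine ⟨z', s₂, (1 + x.size + z'.size) + (c₁ + c₂), ?_,
      (mem_outcomes_ite _ _ _ _ _ _).2 ⟨_, h2, (z', c₂), ?_, rfl⟩, h3', ?_⟩
    · simp only [charge, h1']
    · simp only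
      split at h2'
      · rw [if_pos ‹_›]; exact h2'
      · rw [if_neg ‹_›]; exact h2'
    · have f1 := Prog.size_le_cost _ _ _ _ h2
      have f2 := Prog.size_le_cost _ _ _ _ h2'
      refine h4.trans_overhead h4' (by omega) fun T S hT hS hS₁ hS₂ => ?_
      simp only [charge, h1, h1', e1, Data.size, Prog.result, Prog.restart,
        Prog.gcost] at *
      omega
  | loop p ih =>
    cases x with
    | nil =>
      refine simulates_simple hs fun y hy => ?_
      rw [Prog.subst, mem_outcomes_ite] at hy
      obtain ⟨u, hu, v, hv, rfl⟩ := hy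
      rw [mem_outcomes_fst] at hu
      subst hu
      rw [if_pos (by simp [charge]), mem_outcomes_id] at hv
      subst hv
      refine ⟨.nil, rfl, (mem_outcomes_loop_nil _ _ _).2 rfl, ?_⟩
      have := s.size_pos
      simp only [charge, Data.size, Data.left]; omega
    | pair a x =>
      intro y hy
      rw [Prog.subst, mem_outcomes_ite] at hy
      obtain ⟨u, hu, v, hv, rfl⟩ := hy
      rw [mem_outcomes_fst] at hu
      subst hu
      rw [if_neg (by simp [charge]), mem_outcomes_comp] at hv
      obtain ⟨w₁, hw₁, w₂, hw₂, rfl⟩ := hv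
      obtain ⟨e3, e4⟩ := Prog.IsGlue.outcomes (p := .unassoc)
        (by simp [Prog.unassoc, Prog.IsGlue]) _ _ _ hw₁
      simp only [Prog.unassoc, Prog.gval, Data.left_pair, Data.right_pair] at e3
      rw [e3, mem_outcomes_loop_pair] at hw₂
      obtain ⟨t, ht, rfl⟩ := hw₂
      obtain ⟨z, s', c, h1, h2, h3, h4⟩ := simulates_iter (fun x s hs => ih x s hs) a.size x s
        hs t ht
      refine ⟨z, s', 1 + (Data.pair a x).size + z.size + c, h1,
        (mem_outcomes_loop_pair _ _ _ _ _).2 ⟨_, h2, rfl⟩, h3, ?_⟩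
      -- A loop has only one sub-run; the empty run takes the place of the first one.
      rw [← Nat.zero_add c]
      refine (SimBound.refl s).trans_overhead h4 (by omega) fun T S hT hS hS₁ hS₂ => ?_
      simp only [charge, h1, Data.size, Prog.unassoc, Prog.gcost, Data.left] at *
      omega

end cost

/-! ## Runs with a stateful oracle -/

section interact

variable {σ S : Type}

/-- A coin in the state monad. -/
def coinT (σ : Type) : StateT σ PMF Bool := fun s => fairCoin.map fun b => (b, s)

/-- Run a program with a stateful oracle and forget the costs. -/
def Prog.runT (p : Prog) (O : Data → σ → PMF (Data × σ)) (x : Data) : StateT σ PMF Data :=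
  p.eval (m := StateT σ PMF) (coinT σ) O x

/-- A run without queries does not touch the state. -/
theorem Prog.runT_noQuery (p : Prog) (O : Data → σ → PMF (Data × σ)) (x : Data) (s : σ) :
    p.noQuery.runT O x s = (fun y => (y, s)) <$> p.val x := by
  have h := Prog.exec_hom (m := PMF) (m' := StateT σ PMF)
    (fun d s => (fun y => (y, s)) <$> d)
    (fun a => by funext s; exact map_pure _ _)
    (fun d f => by
      funext s
      change _ = ((fun y => (y, s)) <$> d) >>= _
      rw [map_bind, bind_map_left])
    fairCoin (fun _ => pure .nil) p x
  rw [Prog.runT, Prog.eval, Prog.exec_noQuery, Prog.val, Prog.eval]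
  have h2 : (fun s => (fun y => (y, s)) <$> fairCoin) = coinT σ := rfl
  have h3 : (fun _ : Data => fun s : σ => (fun y => (y, s)) <$> (pure Data.nil : PMF Data)) =
      fun _ => (pure Data.nil : StateT σ PMF Data) := by
    funext _ s; exact map_pure _ _
  rw [h2, h3] at h
  rw [← h]
  change (fun r : (Data × ℕ) × σ => (r.1.1, r.2)) <$>
    ((fun y => (y, s)) <$> p.exec fairCoin (fun _ => pure .nil) x : PMF ((Data × ℕ) × σ)) = _
  rw [Functor.map_map, Functor.map_map]

/-- The oracle that the inner program sees when its queries are answered by a stateful procedure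
which has access to another oracle. -/
def substOracle (F : Data → S → StateT σ PMF (Data × S)) (v : Data) (s : S × σ) :
    PMF (Data × S × σ) :=
  (fun r => (r.1.1, r.1.2, r.2)) <$> F v s.1 s.2

/-- Hide a part of the state in the value. -/
def hideState [Coded S] (m : StateT (S × σ) PMF Data) (s : S) : StateT σ PMF Data :=
  fun t => (fun r : Data × S × σ => (Data.pair r.1 (Coded.code r.2.1), r.2.2)) <$> m (s, t)

theorem hideState_pure [Coded S] (x : Data) (s : S) :
    hideState (pure x : StateT (S × σ) PMF Data) s = pure (.pair x (Coded.code s)) := by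
  funext t
  exact map_pure _ _

/-- Hiding the state is compatible with sequencing as soon as the continuation `K` reads the hidden
state back from the value. This drives the induction in `Prog.runT_subst`. -/
theorem hideState_bind [Coded S] (m : StateT (S × σ) PMF Data)
    (f : Data → StateT (S × σ) PMF Data) (K : Data → StateT σ PMF Data)
    (hK : ∀ y s, K (.pair y (Coded.code s)) = hideState (f y) s) (s : S) :
    hideState m s >>= K = hideState (m >>= f) s := by
  funext t
  change (fun r : Data × S × σ => (Data.pair r.1 (Coded.code r.2.1), r.2.2)) <$> m (s, t) >>=
    (fun r => K r.1 r.2) = _ <$> (m (s, t) >>= fun r => f r.1 r.2)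
  rw [bind_map_left, map_bind]
  simp only [hK]
  rfl

theorem iterM_hideState [Coded S] (f : Data → StateT (S × σ) PMF Data)
    (K : Data → StateT σ PMF Data)
    (hK : ∀ y s, K (.pair y (Coded.code s)) = hideState (f y) s) (k : ℕ) (x : Data) (s : S) :
    iterM K k (.pair x (Coded.code s)) = hideState (iterM f k x) s := by
  induction k generalizing x s with
  | zero => exact (hideState_pure _ _).symm
  | succ k ih =>
    rw [iterM, iterM, hK]
    exact hideState_bind _ _ _ ih _

/-- The counterpart of `simulates_subst` for distributions: the substituted program behaves exactly
like `p` talking to the composite oracle, whose own state is carried along inside the data. -/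
theorem Prog.runT_subst [Coded S] {Q : Prog} {O : Data → σ → PMF (Data × σ)}
    {F : Data → S → StateT σ PMF (Data × S)}
    (hQ : ∀ v s, Q.runT O (.pair v (Coded.code s)) =
      (fun r => Data.pair r.1 (Coded.code r.2)) <$> F v s)
    (p : Prog) (x : Data) (s : S) :
    (p.subst Q).runT O (.pair x (Coded.code s)) = hideState (p.runT (substOracle F) x) s := by
  unfold Prog.runT at *
  induction p generalizing x s with
  | id => rw [Prog.subst, Prog.eval_id, Prog.eval_id, hideState_pure]
  | nil =>
    rw [Prog.subst, Prog.IsGlue.eval (by simp [Prog.IsGlue]), Prog.eval_nil, hideState_pure]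
    rfl
  | fst =>
    rw [Prog.subst, Prog.IsGlue.eval (by simp [Prog.IsGlue]), Prog.eval_fst, hideState_pure]
    rfl
  | snd =>
    rw [Prog.subst, Prog.IsGlue.eval (by simp [Prog.IsGlue]), Prog.eval_snd, hideState_pure]
    rfl
  | eq =>
    rw [Prog.subst, Prog.eval_pair, Prog.eval_comp, Prog.eval_fst, pure_bind, Prog.eval_eq,
      pure_bind, Prog.eval_snd, pure_bind, Prog.eval_eq, hideState_pure]
    rfl
  | flip =>
    rw [Prog.subst, Prog.eval_pair, Prog.eval_flip, Prog.eval_flip, Prog.eval_snd]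
    simp only [pure_bind, Data.right_pair, bind_map_left]
    funext t
    change (fairCoin.map fun b => (b, t)) >>= (fun r => (pure (_, r.2) : PMF _)) =
      _ <$> (fun r => (Coded.code r.1, r.2)) <$> (fairCoin.map fun b => (b, (s, t)))
    rw [← PMF.monad_map_eq_map, ← PMF.monad_map_eq_map, Functor.map_map, Functor.map_map,
      bind_map_left, bind_pure_comp]
  | query =>
    rw [Prog.subst, hQ, Prog.eval_query]
    funext t
    change (fun r : (Data × S) × σ => (Data.pair r.1.1 (Coded.code r.1.2), r.2)) <$> F x s t =
      _ <$> substOracle F x (s, t)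
    rw [substOracle, Functor.map_map]
  | pair p q ihp ihq =>
    rw [Prog.subst, Prog.eval_comp, Prog.eval_comp, Prog.eval_pair, Prog.eval_id, pure_bind, ihp,
      bind_assoc, bind_assoc, Prog.eval_pair]
    refine hideState_bind _ _ _ (fun y s' => ?_) s
    rw [pure_bind, Prog.eval_pair, Prog.IsGlue.eval (p := .result)
      (by simp [Prog.result, Prog.IsGlue]), pure_bind, Prog.eval_comp,
      Prog.IsGlue.eval (p := .restart) (by simp [Prog.restart, Prog.IsGlue]), pure_bind]
    simp only [Prog.result, Prog.restart, Prog.gval, Data.left_pair, Data.right_pair]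
    rw [ihq, bind_assoc]
    refine hideState_bind _ _ _ (fun z s'' => ?_) s'
    rw [pure_bind, Prog.IsGlue.eval (by simp [Prog.assoc, Prog.IsGlue]), hideState_pure]
    rfl
  | comp p q ihp ihq =>
    rw [Prog.subst, Prog.eval_comp, Prog.eval_comp, ihq]
    exact hideState_bind _ _ _ ihp _
  | ite p q r ihp ihq ihr =>
    rw [Prog.subst, Prog.eval_comp, Prog.eval_pair, Prog.eval_id, pure_bind, ihp,
      bind_assoc, Prog.eval_ite]
    refine hideState_bind _ _ _ (fun y s' => ?_) s
    rw [pure_bind, Prog.eval_ite, Prog.IsGlue.eval (p := .result)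
      (by simp [Prog.result, Prog.IsGlue]), pure_bind, Prog.eval_comp, Prog.eval_comp,
      Prog.IsGlue.eval (p := .restart) (by simp [Prog.restart, Prog.IsGlue]), pure_bind, pure_bind]
    simp only [Prog.result, Prog.restart, Prog.gval, Data.left_pair, Data.right_pair]
    split
    · exact ihr _ _
    · exact ihq _ _
  | loop p ih =>
    rw [Prog.subst, Prog.eval_ite, Prog.eval_fst, pure_bind]
    cases x with
    | nil =>
      rw [if_pos (by rfl), Prog.eval_id, Prog.eval_loop_nil, hideState_pure]
    | pair c x =>
      rw [if_neg (by simp), Prog.eval_comp,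
        Prog.IsGlue.eval (p := .unassoc) (by simp [Prog.unassoc, Prog.IsGlue]), pure_bind]
      simp only [Prog.unassoc, Prog.gval, Data.left_pair, Data.right_pair]
      rw [Prog.eval_loop_pair, Prog.eval_loop_pair]
      exact iterM_hideState _ _ ih _ _ _

end interact

/-! ## Relating runs with different oracles -/

/-- Relations between computations in two monads that are compatible with sequencing relate the
two runs of a program. -/
theorem Prog.eval_rel {m m' : Type → Type} [Monad m] [LawfulMonad m] [Monad m'] [LawfulMonad m']
    {Rel : m Data → m' Data → Prop} (hpure : ∀ x, Rel (pure x) (pure x))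
    (hbind : ∀ a a' f f', Rel a a' → (∀ x, Rel (f x) (f' x)) → Rel (a >>= f) (a' >>= f'))
    {coin : m Bool} {coin' : m' Bool} (hcoin : Rel (Coded.code <$> coin) (Coded.code <$> coin'))
    {O : Data → m Data} {O' : Data → m' Data} (hO : ∀ v, Rel (O v) (O' v)) (p : Prog) (x : Data) :
    Rel (p.eval coin O x) (p.eval coin' O' x) := by
  induction p generalizing x with
  | id => rw [Prog.eval_id, Prog.eval_id]; exact hpure _
  | nil => rw [Prog.eval_nil, Prog.eval_nil]; exact hpure _
  | fst => rw [Prog.eval_fst, Prog.eval_fst]; exact hpure _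
  | snd => rw [Prog.eval_snd, Prog.eval_snd]; exact hpure _
  | eq => rw [Prog.eval_eq, Prog.eval_eq]; exact hpure _
  | flip => rw [Prog.eval_flip, Prog.eval_flip]; exact hcoin
  | query => rw [Prog.eval_query, Prog.eval_query]; exact hO _
  | pair p q ihp ihq =>
    rw [Prog.eval_pair, Prog.eval_pair]
    exact hbind _ _ _ _ (ihp x) fun y => hbind _ _ _ _ (ihq x) fun z => hpure _
  | comp p q ihp ihq =>
    rw [Prog.eval_comp, Prog.eval_comp]
    exact hbind _ _ _ _ (ihq x) ihp
  | ite p q r ihp ihq ihr =>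
    rw [Prog.eval_ite, Prog.eval_ite]
    refine hbind _ _ _ _ (ihp x) fun y => ?_
    split
    · exact ihr x
    · exact ihq x
  | loop p ih =>
    cases x with
    | nil => rw [Prog.eval_loop_nil, Prog.eval_loop_nil]; exact hpure _
    | pair c s =>
      rw [Prog.eval_loop_pair, Prog.eval_loop_pair]
      generalize c.size = k
      induction k generalizing s with
      | zero => exact hpure _
      | succ k ihk => exact hbind _ _ _ _ (ih s) ihk

/-- If a map between the states of two oracles commutes with their answers as long as an invariant
holds, then it commutes with runs of programs. -/
theorem Prog.runT_map {σ σ' : Type} {O : Data → σ → PMF (Data × σ)}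
    {O' : Data → σ' → PMF (Data × σ')} (f : σ → σ') (Inv : σ → Prop)
    (hO : ∀ v s, Inv s → O' v (f s) = (fun r => (r.1, f r.2)) <$> O v s)
    (hInv : ∀ v s, Inv s → ∀ r ∈ (O v s).support, Inv r.2) (p : Prog) (x : Data) (s : σ)
    (hs : Inv s) :
    p.runT O' x (f s) = (fun r => (r.1, f r.2)) <$> p.runT O x s ∧
      ∀ r ∈ (p.runT O x s).support, Inv r.2 := by
  refine Prog.eval_rel (m := StateT σ PMF) (m' := StateT σ' PMF)
    (Rel := fun a a' => ∀ s, Inv s → a' (f s) = (fun r => (r.1, f r.2)) <$> a s ∧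
      ∀ r ∈ (a s).support, Inv r.2) ?_ ?_ ?_ ?_ p x s hs
  · intro x s hs
    refine ⟨?_, fun r hr => ?_⟩
    · change (pure (x, f s) : PMF (Data × σ')) = _ <$> (pure (x, s) : PMF (Data × σ))
      rw [map_pure]
    obtain rfl := (PMF.mem_support_pure' _ _).1 hr
    exact hs
  · intro a a' g g' ha hg s hs
    obtain ⟨h1, h2⟩ := ha s hs
    refine ⟨?_, fun r hr => ?_⟩
    · change (a' (f s) >>= fun r => g' r.1 r.2) = _ <$> (a s >>= fun r => g r.1 r.2)
      rw [h1, bind_map_left, map_bind]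
      exact PMF.bind_congr' fun r hr => (hg _ _ (h2 r hr)).1
    · obtain ⟨u, hu, hr⟩ := (PMF.mem_support_bind' _ _ _).1 hr
      exact (hg _ _ (h2 u hu)).2 r hr
  · intro s hs
    refine ⟨?_, fun r hr => ?_⟩
    · change (fun r : Bool × σ' => (Coded.code r.1, r.2)) <$> (fun b => (b, f s)) <$> fairCoin =
        _ <$> (fun r : Bool × σ => (Coded.code r.1, r.2)) <$> (fun b => (b, s)) <$> fairCoin
      simp only [Functor.map_map]
    · obtain ⟨u, hu, rfl⟩ := (PMF.mem_support_map' _ _ _).1 hr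
      obtain ⟨b, -, rfl⟩ := (PMF.mem_support_map' _ _ _).1 hu
      exact hs
  · exact fun v s hs => ⟨hO v s hs, hInv v s hs⟩

/-! ## Reductions that relay queries -/

section reduction

variable {α β S X σ : Type} [Coded α] [Coded β] [Coded S] [Coded X]

/-- Prepare a query with `pre`, ask it, and compute the answer and the new state with `post`. -/
def relay (pre : Data × S → PMF (Data × X)) (post : X × Data → Data × S)
    (O : Data → σ → PMF (Data × σ)) (v : Data) (s : S) : StateT σ PMF (Data × S) := fun t =>
  pre (v, s) >>= fun e => O e.1 t >>= fun r => pure (post (e.2, r.1), r.2)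

/-- The program computing `relay`. -/
def Prog.relay (p q : Prog) : Prog :=
  .comp q.noQuery (.comp (.pair .snd (.comp .query .fst)) p.noQuery)

theorem Prog.Computes.runT {p : Prog} {t : Polynomial ℕ} {F : α → PMF β} (h : p.Computes t F)
    (O : Data → σ → PMF (Data × σ)) (a : α) (s : σ) :
    p.noQuery.runT O (Coded.code a) s = (fun b => (Coded.code b, s)) <$> F a := by
  rw [Prog.runT_noQuery, h.val_eq, Functor.map_map]

theorem Prog.Computes.mem_noQuery {p : Prog} {t : Polynomial ℕ} {F : α → PMF β}
    (h : p.Computes t F) {O : Data → Set Data} {a : α} {y : Data × ℕ}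
    (hy : y ∈ p.noQuery.outcomes O (Coded.code a)) :
    ∃ b ∈ (F a).support, y.1 = Coded.code b ∧ y.2 ≤ t.eval (len a) ∧
      1 + len a + len b ≤ y.2 := by
  rw [Prog.outcomes_noQuery, Prog.support_run] at hy
  exact h.mem_outcomes hy

theorem Prog.runT_comp (p q : Prog) (O : Data → σ → PMF (Data × σ)) (x : Data) (s : σ) :
    (Prog.comp p q).runT O x s = q.runT O x s >>= fun r => p.runT O r.1 r.2 := by
  rw [Prog.runT, Prog.eval_comp]; rfl

theorem Prog.runT_relay {p q : Prog} {s t : Polynomial ℕ} {pre : Data × S → PMF (Data × X)}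
    {post : X × Data → Data × S} (hp : p.Computes s pre)
    (hq : q.Computes t fun x => (pure (post x) : PMF (Data × S)))
    (O : Data → σ → PMF (Data × σ)) (v : Data) (s : S) :
    (Prog.relay p q).runT O (.pair v (Coded.code s)) =
      (fun r => Data.pair r.1 (Coded.code r.2)) <$> _root_.relay pre post O v s := by
  funext t
  have h1 := hp.runT O (v, s) t
  rw [Prog.relay, Prog.runT_comp, Prog.runT_comp]
  change p.noQuery.runT O (.pair v (Coded.code s)) t = _ at h1
  rw [h1, bind_map_left, bind_assoc]
  change _ = (fun r : (Data × S) × σ => (Data.pair r.1.1 (Coded.code r.1.2), r.2)) <$>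
    (pre (v, s) >>= fun e => O e.1 t >>= fun r => pure (post (e.2, r.1), r.2))
  rw [map_bind]
  congr 1; funext e
  have h2 : (Prog.pair .snd (.comp .query .fst)).runT O (Coded.code e) t =
      O e.1 t >>= fun r => pure (Data.pair (Coded.code e.2) r.1, r.2) := by
    rw [Prog.runT, Prog.eval_pair, Prog.eval_snd, pure_bind, Prog.eval_comp, Prog.eval_fst,
      pure_bind, Prog.eval_query]
    rfl
  rw [h2, bind_assoc, map_bind]
  congr 1; funext r
  have h3 := hq.runT O (e.2, r.1) r.2
  rw [map_pure] at h3
  rw [pure_bind, map_pure]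
  exact h3

/-- The lengths chain: the prepared query is no longer than the cost of preparing it, the answer is
bounded by `b` of that, and the postprocessing time is bounded through both. The bound is stated for
every `n` above the input size in order to be monotone. -/
theorem Prog.outcomes_relay {p q : Prog} {sp tp : Polynomial ℕ} {pre : Data × S → PMF (Data × X)}
    {post : X × Data → Data × S} (hp : p.Computes sp pre)
    (hq : q.Computes tp fun x => (pure (post x) : PMF (Data × S)))
    (b : ℕ → ℕ) (hb : Monotone b) (v : Data) (s : S) (y : Data × ℕ)
    (hy : y ∈ (Prog.relay p q).outcomes (fun w => {r | r.size ≤ b w.size})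
      (.pair v (Coded.code s))) :
    ∃ e ∈ (pre (v, s)).support, ∃ r : Data, r.size ≤ b e.1.size ∧
      y.1 = Coded.code (post (e.2, r)) ∧ ∀ n, v.size + len s ≤ n →
        y.2 ≤ 20 + 20 * n + 20 * sp.eval (1 + n) + 20 * b (sp.eval (1 + n)) +
          20 * tp.eval (1 + sp.eval (1 + n) + b (sp.eval (1 + n))) := by
  rw [Prog.relay, mem_outcomes_comp] at hy
  obtain ⟨u, hu, w, hw, rfl⟩ := hy
  rw [mem_outcomes_comp] at hu
  obtain ⟨u₁, hu₁, u₂, hu₂, rfl⟩ := hu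
  obtain ⟨e, he, h1, h2, h3⟩ := hp.mem_noQuery (a := (v, s)) hu₁
  rw [h1, mem_outcomes_pair] at hu₂
  obtain ⟨w₁, hw₁, w₂, hw₂, rfl⟩ := hu₂
  rw [mem_outcomes_snd] at hw₁
  rw [mem_outcomes_comp] at hw₂
  obtain ⟨w₃, hw₃, w₄, hw₄, rfl⟩ := hw₂
  rw [mem_outcomes_fst] at hw₃
  rw [mem_outcomes_query] at hw₄
  subst hw₁ hw₃
  obtain ⟨r, hr, rfl⟩ := hw₄
  obtain ⟨o, ho, h4, h5, h6⟩ := hq.mem_noQuery (a := (e.2, r)) hw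
  rw [PMF.mem_support_pure'] at ho
  subst ho
  have hr' : r.size ≤ b e.1.size := hr
  refine ⟨e, he, r, hr', h4, fun n hn => ?_⟩
  simp only [len_prod, len_data] at h2 h3 h5 h6
  have e1 := sp.eval_mono_nat (show 1 + v.size + len s ≤ 1 + n by omega)
  have e2 := hb (show e.1.size ≤ sp.eval (1 + n) by omega)
  have e3 := tp.eval_mono_nat (show 1 + len e.2 + r.size ≤
    1 + sp.eval (1 + n) + b (sp.eval (1 + n)) by omega)
  have e4 : (Coded.code e).left = e.1 := rfl
  have e5 : (Coded.code e).right = Coded.code e.2 := rfl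
  simp only [charge, e4, e5, h4, len_code, Data.size, len_prod, len_data]
  omega

/-- The composed program: initialise, run `A` with relayed queries, and process its output. -/
theorem exists_reduction {A : Prog} (hA : A.IsOraclePPT) {ini : α → PMF (Data × S)}
    {pre : Data × S → PMF (Data × X)} {post : X × Data → Data × S} {fin : Data × S → PMF β}
    (hini : PPT ini) (hpre : PPT pre) (hpost : PolyTime post) (hfin : PPT fin)
    (hb : ∀ q : Polynomial ℕ, ∃ (qA g : Polynomial ℕ) (Inv : ℕ → S → Prop),
      (∀ a, ∀ r ∈ (ini a).support, len a ≤ r.1.size ∧ Inv r.1.size r.2) ∧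
      ∀ N v s, Inv N s → ∀ e ∈ (pre (v, s)).support, ∀ r : Data,
        r.size ≤ q.eval (N + e.1.size) → Inv N (post (e.2, r)).2 ∧
          (post (e.2, r)).1.size ≤ qA.eval (N + v.size) ∧
          len (post (e.2, r)).2 ≤ len s + g.eval (N + v.size)) :
    ∃ B : Prog,
      (∀ (σ : Type) (O : Data → σ → PMF (Data × σ)) (a : α) (t : σ),
        B.runT O (Coded.code a) t = ini a >>= fun r =>
          A.runT (substOracle (relay pre post O)) r.1 (r.2, t) >>= fun y =>
            (fun b => (Coded.code b, y.2.2)) <$> fin (y.1, y.2.1)) ∧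
      ∀ q : Polynomial ℕ, ∃ t : Polynomial ℕ, ∀ a : α,
        ∀ y ∈ B.outcomes (fun v => {r | r.size ≤ q.eval (len a + v.size)}) (Coded.code a),
          y.2 ≤ t.eval (len a) := by
  obtain ⟨pi, ti, hi⟩ := ppt_iff.1 hini
  obtain ⟨pp, tp, hp⟩ := ppt_iff.1 hpre
  obtain ⟨po, tq, ho⟩ := ppt_iff.1 hpost.ppt
  obtain ⟨pf, tf, hf⟩ := ppt_iff.1 hfin
  refine ⟨.comp pf.noQuery (.comp (A.subst (Prog.relay pp po)) pi.noQuery), ?_, ?_⟩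
  · intro σ O a t
    rw [Prog.runT_comp, Prog.runT_comp, hi.runT, bind_map_left, bind_assoc]
    congr 1; funext r
    have h1 := congrFun (Prog.runT_subst (Prog.runT_relay hp ho O) A r.1 r.2) t
    change (A.subst (Prog.relay pp po)).runT O (Coded.code r) t = _ at h1
    rw [h1, hideState, bind_map_left]
    congr 1; funext y
    exact hf.runT O (y.1, y.2.1) y.2.2
  · intro q
    obtain ⟨qA, g, Inv, hb1, hb2⟩ := hb q
    obtain ⟨tA, hA⟩ := hA qA
    -- In terms of the length of `a`: `T` bounds the steps of `A`, `Sz` the length of the state, `K`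
    -- the cost of preparing a query and hence its length, `R` the length of the answer, and `M` the
    -- cost of the whole simulation.
    let T : Polynomial ℕ := tA.comp ti
    let Sz : Polynomial ℕ := ti + T * g.comp (ti + T)
    let K : Polynomial ℕ := tp.comp (1 + (T + Sz))
    let R : Polynomial ℕ := q.comp (ti + K)
    let M : Polynomial ℕ := T * (10000 * (T + Sz + 1) +
      (20 + 20 * (T + Sz) + 20 * K + 20 * R + 20 * tq.comp (1 + K + R)))
    refine ⟨20 + 20 * Polynomial.X + 20 * ti + 20 * M + 20 * tf.comp M, fun a y hy => ?_⟩
    rw [mem_outcomes_comp] at hy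
    obtain ⟨u, hu, w, hw, rfl⟩ := hy
    rw [mem_outcomes_comp] at hu
    obtain ⟨u₁, hu₁, u₂, hu₂, rfl⟩ := hu
    obtain ⟨⟨x, s⟩, hxs, h1, h2, h3⟩ := hi.mem_noQuery hu₁
    obtain ⟨hN, hs⟩ := hb1 a _ hxs
    simp only at hN hs
    rw [h1] at hu₂
    set N := x.size with hNdef
    simp only [len_prod, len_data] at h3
    have hN' : N ≤ ti.eval (len a) := by omega
    let b : ℕ → ℕ := fun k => q.eval (N + k)
    have hbm : Monotone b := fun i j hij => q.eval_mono_nat (by omega)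
    let h : ℕ → ℕ := fun n => 20 + 20 * n + 20 * tp.eval (1 + n) + 20 * b (tp.eval (1 + n)) +
          20 * tq.eval (1 + tp.eval (1 + n) + b (tp.eval (1 + n)))
    have hh : Monotone h := fun i j hij => by
      have e1 := tp.eval_mono_nat (show 1 + i ≤ 1 + j by omega)
      have e2 := hbm e1
      have e3 := tq.eval_mono_nat (show 1 + tp.eval (1 + i) + b (tp.eval (1 + i)) ≤
        1 + tp.eval (1 + j) + b (tp.eval (1 + j)) by omega)
      simp only [h]; omega
    have hsim := simulates_subst (O := fun v => {r | r.size ≤ q.eval (len a + v.size)})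
      (OA := fun v => {r | r.size ≤ qA.eval (x.size + v.size)}) (Q := Prog.relay pp po)
      (Inv := fun d => ∃ s, d = Coded.code s ∧ Inv N s) (g := fun k => g.eval (N + k)) (h := h)
      (fun i j hij => g.eval_mono_nat (by omega)) hh
      (by
        rintro v _ ⟨s, rfl, hs⟩ y hy
        obtain ⟨e, he, r, hr, h4, h5⟩ := Prog.outcomes_relay hp ho
          (fun k => q.eval (len a + k)) (fun i j hij => q.eval_mono_nat (by omega)) v s y hy
        -- The input of `A` is at least as long as `a`, so a bound in terms of `len a` is also one
        -- in terms of `N`, the only length known to the invariant.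
        have hr' : r.size ≤ q.eval (N + e.1.size) := hr.trans (q.eval_mono_nat (by omega))
        obtain ⟨i1, i2, i3⟩ := hb2 N v s hs e he r hr'
        refine ⟨_, _, h4, i2, ⟨_, rfl, i1⟩, i3, ?_⟩
        have h6 := h5 (v.size + len s) le_rfl
        have e2 : q.eval (len a + tp.eval (1 + (v.size + len s))) ≤
          b (tp.eval (1 + (v.size + len s))) := q.eval_mono_nat (by omega)
        have e3 := tq.eval_mono_nat (show 1 + tp.eval (1 + (v.size + len s)) +
          q.eval (len a + tp.eval (1 + (v.size + len s))) ≤ 1 + tp.eval (1 + (v.size + len s)) +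
          b (tp.eval (1 + (v.size + len s))) by omega)
        simp only [h, len_code] at h6 ⊢
        omega)
      A x (Coded.code s) ⟨s, rfl, hs⟩ u₂ hu₂
    obtain ⟨z, s', c, j1, j2, ⟨s'', rfl, -⟩, j4⟩ := hsim
    -- The simulated run is a run of `A` against an oracle with answers bounded by `qA`, so the
    -- running-time bound of `A` applies.
    have hc : c ≤ tA.eval N := hA x (z, c) j2
    have hT : tA.eval N ≤ T.eval (len a) := by
      simp only [T, Polynomial.eval_comp]; exact tA.eval_mono_nat hN'
    have hSz : (Coded.code s).size + c * g.eval (N + T.eval (len a)) ≤ Sz.eval (len a) := by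
      simp only [Sz, Polynomial.eval_add, Polynomial.eval_mul, Polynomial.eval_comp, len_code]
      have e1 := Nat.mul_le_mul (hc.trans hT)
        (g.eval_mono_nat (show N + T.eval (len a) ≤ ti.eval (len a) + T.eval (len a) by omega))
      omega
    obtain ⟨-, j5⟩ := j4 (T.eval (len a)) (Sz.eval (len a)) (hc.trans hT) hSz
    have hM : u₂.2 ≤ M.eval (len a) := by
      refine j5.trans ?_
      simp only [M, Polynomial.eval_mul, Polynomial.eval_add, Polynomial.eval_ofNat,
        Polynomial.eval_one]
      refine Nat.mul_le_mul (hc.trans hT) ?_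
      have hK : tp.eval (1 + (T.eval (len a) + Sz.eval (len a))) = K.eval (len a) := by
        simp only [K, Polynomial.eval_comp, Polynomial.eval_add, Polynomial.eval_one]
      have hR : b (K.eval (len a)) ≤ R.eval (len a) := by
        simp only [R, b, Polynomial.eval_comp, Polynomial.eval_add]
        exact q.eval_mono_nat (by omega)
      have e3 := tq.eval_mono_nat (show 1 + K.eval (len a) + b (K.eval (len a)) ≤
        1 + K.eval (len a) + R.eval (len a) by omega)
      simp only [h, hK, Polynomial.eval_comp, Polynomial.eval_add, Polynomial.eval_one]
      omega
    have j6 := Prog.size_le_cost _ _ _ _ hu₂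
    simp only [charge, j1] at hw
    obtain ⟨o, -, k1, k2, k3⟩ := hf.mem_noQuery (a := (z, s'')) hw
    have k4 := tf.eval_mono_nat (show len (z, s'') ≤ M.eval (len a) by
      have : u₂.1.size = len (z, s'') := by rw [j1]; rfl
      omega)
    have k5 : u₂.1.size = len (z, s'') := by rw [j1]; rfl
    simp only [charge, k1, len_code, Polynomial.eval_add, Polynomial.eval_mul,
      Polynomial.eval_comp, Polynomial.eval_X, Polynomial.eval_ofNat]
    omega

end reduction

/-! ## The bookkeeping of the simulated experiment -/

/-- The parameters of an experiment: security parameter, reference string, public key, and a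
secret key or a trapdoor. -/
structure Params where
  n : ℕ
  crs : Data
  pk : Data
  key : Data

/-- The tables of an experiment, as lists. -/
structure Log where
  cu : List Data
  vm : List (Data × Data)
  reg : List Data
  usk : List (Data × Data × Data × Data)
  comm : List (Data × Data × Data × Data × Data)
  rl : List Data

/-- At most one new entry for every table. -/
structure Delta where
  cu : Option Data := none
  vm : Option (Data × Data) := none
  reg : Option Data := none
  usk : Option (Data × Data × Data × Data) := none
  comm : Option (Data × Data × Data × Data × Data) := none
  rl : Option Data := none

/-- What an oracle has to know in order to answer a query: the parsed query, the parameters, and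
what the tables say about the user in question. -/
structure Info where
  query : ℕ × Data × Data × Data
  par : Params
  corrupted : Bool
  entry : Option (Data × Data)
  verified : Bool
  registered : Bool

/-- Encode a type through an injection with a left inverse. -/
abbrev Coded.ofLeftInverse {α β : Type} [Coded β] (f : α → β) (g : β → α) (h : ∀ a, g (f a) = a) :
    Coded α where
  code a := Coded.code (f a)
  decode d := (Coded.decode d).map g
  decode_code a := by simp [Coded.decode_code, h]

instance : Coded Params := .ofLeftInverse (fun x => (x.n, x.crs, x.pk, x.key))
  (fun x => ⟨x.1, x.2.1, x.2.2.1, x.2.2.2⟩) fun _ => rfl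

instance : Coded Log := .ofLeftInverse (fun x => (x.cu, x.vm, x.reg, x.usk, x.comm, x.rl))
  (fun x => ⟨x.1, x.2.1, x.2.2.1, x.2.2.2.1, x.2.2.2.2.1, x.2.2.2.2.2⟩) fun _ => rfl

instance : Coded Delta := .ofLeftInverse (fun x => (x.cu, x.vm, x.reg, x.usk, x.comm, x.rl))
  (fun x => ⟨x.1, x.2.1, x.2.2.1, x.2.2.2.1, x.2.2.2.2.1, x.2.2.2.2.2⟩) fun _ => rfl

instance : Coded Info := .ofLeftInverse
  (fun x => (x.query, x.par, x.corrupted, x.entry, x.verified, x.registered))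
  (fun x => ⟨x.1, x.2.1, x.2.2.1, x.2.2.2.1, x.2.2.2.2.1, x.2.2.2.2.2⟩) fun _ => rfl

theorem len_log (x : Log) : len x = len (x.cu, x.vm, x.reg, x.usk, x.comm, x.rl) := rfl
theorem len_delta (x : Delta) : len x = len (x.cu, x.vm, x.reg, x.usk, x.comm, x.rl) := rfl
theorem len_info (x : Info) :
    len x = len (x.query, x.par, x.corrupted, x.entry, x.verified, x.registered) := rfl

section

variable {α : Type} [Coded α]

theorem Params.toTuple_poly : PolyTime fun x : Params => (x.n, x.crs, x.pk, x.key) :=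
  .of_code_eq fun _ => rfl
theorem Log.toTuple_poly : PolyTime fun x : Log => (x.cu, x.vm, x.reg, x.usk, x.comm, x.rl) :=
  .of_code_eq fun _ => rfl
theorem Delta.toTuple_poly : PolyTime fun x : Delta => (x.cu, x.vm, x.reg, x.usk, x.comm, x.rl) :=
  .of_code_eq fun _ => rfl
theorem Info.toTuple_poly : PolyTime fun x : Info =>
    (x.query, x.par, x.corrupted, x.entry, x.verified, x.registered) :=
  .of_code_eq fun _ => rfl

@[fun_prop] theorem Params.n_poly {f : α → Params} (hf : PolyTime f) :
    PolyTime fun a => (f a).n := (Params.toTuple_poly.comp hf).fst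
@[fun_prop] theorem Params.crs_poly {f : α → Params} (hf : PolyTime f) :
    PolyTime fun a => (f a).crs := (Params.toTuple_poly.comp hf).snd.fst
@[fun_prop] theorem Params.pk_poly {f : α → Params} (hf : PolyTime f) :
    PolyTime fun a => (f a).pk := (Params.toTuple_poly.comp hf).snd.snd.fst
@[fun_prop] theorem Params.key_poly {f : α → Params} (hf : PolyTime f) :
    PolyTime fun a => (f a).key := (Params.toTuple_poly.comp hf).snd.snd.snd

@[fun_prop] theorem Params.mk_poly {f₁ : α → ℕ} {f₂ f₃ f₄ : α → Data} (h₁ : PolyTime f₁)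
    (h₂ : PolyTime f₂) (h₃ : PolyTime f₃) (h₄ : PolyTime f₄) :
    PolyTime fun a => Params.mk (f₁ a) (f₂ a) (f₃ a) (f₄ a) :=
  (h₁.prodMk (h₂.prodMk (h₃.prodMk h₄))).congr_code fun _ => rfl

@[fun_prop] theorem Log.cu_poly {f : α → Log} (hf : PolyTime f) :
    PolyTime fun a => (f a).cu := (Log.toTuple_poly.comp hf).fst
@[fun_prop] theorem Log.vm_poly {f : α → Log} (hf : PolyTime f) :
    PolyTime fun a => (f a).vm := (Log.toTuple_poly.comp hf).snd.fst
@[fun_prop] theorem Log.reg_poly {f : α → Log} (hf : PolyTime f) :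
    PolyTime fun a => (f a).reg := (Log.toTuple_poly.comp hf).snd.snd.fst
@[fun_prop] theorem Log.usk_poly {f : α → Log} (hf : PolyTime f) :
    PolyTime fun a => (f a).usk := (Log.toTuple_poly.comp hf).snd.snd.snd.fst
@[fun_prop] theorem Log.comm_poly {f : α → Log} (hf : PolyTime f) :
    PolyTime fun a => (f a).comm := (Log.toTuple_poly.comp hf).snd.snd.snd.snd.fst
@[fun_prop] theorem Log.rl_poly {f : α → Log} (hf : PolyTime f) :
    PolyTime fun a => (f a).rl := (Log.toTuple_poly.comp hf).snd.snd.snd.snd.snd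

@[fun_prop] theorem Log.mk_poly {f₁ : α → List Data} {f₂ : α → List (Data × Data)}
    {f₃ : α → List Data} {f₄ : α → List (Data × Data × Data × Data)}
    {f₅ : α → List (Data × Data × Data × Data × Data)} {f₆ : α → List Data} (h₁ : PolyTime f₁)
    (h₂ : PolyTime f₂) (h₃ : PolyTime f₃) (h₄ : PolyTime f₄) (h₅ : PolyTime f₅)
    (h₆ : PolyTime f₆) :
    PolyTime fun a => Log.mk (f₁ a) (f₂ a) (f₃ a) (f₄ a) (f₅ a) (f₆ a) :=
  (h₁.prodMk (h₂.prodMk (h₃.prodMk (h₄.prodMk (h₅.prodMk h₆))))).congr_code fun _ => rfl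

@[fun_prop] theorem Delta.cu_poly {f : α → Delta} (hf : PolyTime f) :
    PolyTime fun a => (f a).cu := (Delta.toTuple_poly.comp hf).fst
@[fun_prop] theorem Delta.vm_poly {f : α → Delta} (hf : PolyTime f) :
    PolyTime fun a => (f a).vm := (Delta.toTuple_poly.comp hf).snd.fst
@[fun_prop] theorem Delta.reg_poly {f : α → Delta} (hf : PolyTime f) :
    PolyTime fun a => (f a).reg := (Delta.toTuple_poly.comp hf).snd.snd.fst
@[fun_prop] theorem Delta.usk_poly {f : α → Delta} (hf : PolyTime f) :
    PolyTime fun a => (f a).usk := (Delta.toTuple_poly.comp hf).snd.snd.snd.fst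
@[fun_prop] theorem Delta.comm_poly {f : α → Delta} (hf : PolyTime f) :
    PolyTime fun a => (f a).comm := (Delta.toTuple_poly.comp hf).snd.snd.snd.snd.fst
@[fun_prop] theorem Delta.rl_poly {f : α → Delta} (hf : PolyTime f) :
    PolyTime fun a => (f a).rl := (Delta.toTuple_poly.comp hf).snd.snd.snd.snd.snd

@[fun_prop] theorem Delta.mk_poly {f₁ : α → Option Data} {f₂ : α → Option (Data × Data)}
    {f₃ : α → Option Data} {f₄ : α → Option (Data × Data × Data × Data)}
    {f₅ : α → Option (Data × Data × Data × Data × Data)} {f₆ : α → Option Data} (h₁ : PolyTime f₁)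
    (h₂ : PolyTime f₂) (h₃ : PolyTime f₃) (h₄ : PolyTime f₄) (h₅ : PolyTime f₅)
    (h₆ : PolyTime f₆) :
    PolyTime fun a => Delta.mk (f₁ a) (f₂ a) (f₃ a) (f₄ a) (f₅ a) (f₆ a) :=
  (h₁.prodMk (h₂.prodMk (h₃.prodMk (h₄.prodMk (h₅.prodMk h₆))))).congr_code fun _ => rfl

@[fun_prop] theorem Info.query_poly {f : α → Info} (hf : PolyTime f) :
    PolyTime fun a => (f a).query := (Info.toTuple_poly.comp hf).fst
@[fun_prop] theorem Info.par_poly {f : α → Info} (hf : PolyTime f) :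
    PolyTime fun a => (f a).par := (Info.toTuple_poly.comp hf).snd.fst
@[fun_prop] theorem Info.corrupted_poly {f : α → Info} (hf : PolyTime f) :
    PolyTime fun a => (f a).corrupted := (Info.toTuple_poly.comp hf).snd.snd.fst
@[fun_prop] theorem Info.entry_poly {f : α → Info} (hf : PolyTime f) :
    PolyTime fun a => (f a).entry := (Info.toTuple_poly.comp hf).snd.snd.snd.fst
@[fun_prop] theorem Info.verified_poly {f : α → Info} (hf : PolyTime f) :
    PolyTime fun a => (f a).verified := (Info.toTuple_poly.comp hf).snd.snd.snd.snd.fst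
@[fun_prop] theorem Info.registered_poly {f : α → Info} (hf : PolyTime f) :
    PolyTime fun a => (f a).registered := (Info.toTuple_poly.comp hf).snd.snd.snd.snd.snd

@[fun_prop] theorem Info.mk_poly {f₁ : α → ℕ × Data × Data × Data} {f₂ : α → Params}
    {f₃ : α → Bool} {f₄ : α → Option (Data × Data)} {f₅ f₆ : α → Bool} (h₁ : PolyTime f₁)
    (h₂ : PolyTime f₂) (h₃ : PolyTime f₃) (h₄ : PolyTime f₄) (h₅ : PolyTime f₅)
    (h₆ : PolyTime f₆) :
    PolyTime fun a => Info.mk (f₁ a) (f₂ a) (f₃ a) (f₄ a) (f₅ a) (f₆ a) :=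
  (h₁.prodMk (h₂.prodMk (h₃.prodMk (h₄.prodMk (h₅.prodMk h₆))))).congr_code fun _ => rfl

end

/-! ## Parsing queries -/

/-- The queries of the trolling experiment as a number and three arguments; the number `5` stands
for a malformed query. -/
def parseQuery (v : Data) : ℕ × Data × Data × Data :=
  if v = .pair (Coded.code 0) v.right then (0, v.right, .nil, .nil)
  else if v = .pair (Coded.code 1) (.pair v.right.left v.right.right) then
    (1, v.right.left, v.right.right, .nil)
  else if v = .pair (Coded.code 2) (.pair v.right.left v.right.right) then
    (2, v.right.left, v.right.right, .nil)
  else if v = .pair (Coded.code 3)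
      (.pair v.right.left (.pair v.right.right.left v.right.right.right)) then
    (3, v.right.left, v.right.right.left, v.right.right.right)
  else if v = .pair (Coded.code 4)
      (.pair v.right.left (.pair v.right.right.left v.right.right.right)) then
    (4, v.right.left, v.right.right.left, v.right.right.right)
  else (5, .nil, .nil, .nil)

@[fun_prop]
theorem parseQuery_poly : PolyTime parseQuery := by
  unfold parseQuery
  fun_prop

/-- The query described by a number and arguments. -/
def toQuery : ℕ × Data × Data × Data → Option TrollQuery
  | (0, U, _, _) => some (.corruptUser U)
  | (1, U, V, _) => some (.corruptVer U V)
  | (2, U, V, _) => some (.createHonestUser U V)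
  | (3, U, V, msg) => some (.joinSystem U V msg)
  | (4, U, dom, m) => some (.createComment U dom m)
  | _ => none

theorem Data.ofNat_of_toNat {d : Data} {n : ℕ} (h : Data.toNat d = some n) : d = Data.ofNat n := by
  induction n generalizing d with
  | zero =>
    match d with
    | .nil => rfl
    | .pair .nil b => simp [Data.toNat] at h
    | .pair (.pair _ _) _ => simp [Data.toNat] at h
  | succ n ih =>
    match d with
    | .nil => simp [Data.toNat] at h
    | .pair .nil b =>
      simp only [Data.toNat, Option.map_eq_some_iff, Nat.add_right_cancel_iff, exists_eq_right] at h
      rw [ih h]; rfl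
    | .pair (.pair _ _) _ => simp [Data.toNat] at h

theorem decode_natData {v a : Data} {n : ℕ} (h : (Coded.decode v : Option (ℕ × Data)) = some (n, a)) :
    v = .pair (Coded.code n) a := by
  match v with
  | .nil => simp [Coded.decode] at h
  | .pair x y =>
    have h' : (Data.toNat x).bind (fun k => (some y).map fun y => (k, y)) = some (n, a) := h
    simp only [Option.map_some, Option.bind_eq_some_iff, Option.some.injEq, Prod.mk.injEq] at h'
    obtain ⟨k, hk, rfl, rfl⟩ := h'
    rw [Data.ofNat_of_toNat hk]; rfl

theorem decode_dataData {v : Data} {x : Data × Data}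
    (h : (Coded.decode v : Option (Data × Data)) = some x) : v = .pair x.1 x.2 := by
  match v with
  | .nil => simp [Coded.decode] at h
  | .pair a b =>
    have h' : some (a, b) = some x := h
    simp only [Option.some.injEq] at h'
    rw [← h']

theorem decode_dataDataData {v : Data} {x : Data × Data × Data}
    (h : (Coded.decode v : Option (Data × Data × Data)) = some x) :
    v = .pair x.1 (.pair x.2.1 x.2.2) := by
  match v with
  | .nil => simp [Coded.decode] at h
  | .pair a .nil => simp [Coded.decode] at h
  | .pair a (.pair b c) =>
    have h' : some (a, b, c) = some x := h
    simp only [Option.some.injEq] at h'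
    rw [← h']

/-- `parseQuery` recognises a shape by rebuilding the datum from its components and comparing, which
needs only projections and equality tests. A query that can be decoded has one of these shapes,
since decoding pairs and numerals inverts encoding. -/
theorem toQuery_parseQuery (v : Data) : toQuery (parseQuery v) = TrollQuery.decode v := by
  unfold parseQuery
  split_ifs with h0 h1 h2 h3 h4
  · rw [h0]; rfl
  · rw [h1]; rfl
  · rw [h2]; rfl
  · rw [h3]; rfl
  · rw [h4]; rfl
  · unfold TrollQuery.decode
    split
    · rename_i a h
      rw [decode_natData h] at h0
      simp at h0
    · rename_i a h
      cases ha : (Coded.decode a : Option (Data × Data)) with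
      | none => rfl
      | some x => rw [decode_natData h, decode_dataData ha] at h1; simp at h1
    · rename_i a h
      cases ha : (Coded.decode a : Option (Data × Data)) with
      | none => rfl
      | some x => rw [decode_natData h, decode_dataData ha] at h2; simp at h2
    · rename_i a h
      cases ha : (Coded.decode a : Option (Data × Data × Data)) with
      | none => rfl
      | some x => rw [decode_natData h, decode_dataDataData ha] at h3; simp at h3
    · rename_i a h
      cases ha : (Coded.decode a : Option (Data × Data × Data)) with
      | none => rfl
      | some x => rw [decode_natData h, decode_dataDataData ha] at h4; simp at h4
    · rfl

/-! ## Looking up and updating tables -/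

/-- The user key and credential recorded for `U`. -/
def Log.find (l : Log) (U : Data) : Option (Data × Data) :=
  l.usk.findSome? fun e => if e.1 = U then some (e.2.1, e.2.2.1) else none

/-- `verified` consults only confirmations by `corruptVer`. Those by `createHonestUser` concern
users that are honest or corrupted, whom `joinSystem` refuses in any case. An entry stays in the
table after its user is corrupted. -/
def lookup (x : Data × Params × Log) : Info where
  query := parseQuery x.1
  par := x.2.1
  corrupted := x.2.2.cu.any fun U => decide (U = (parseQuery x.1).2.1)
  entry := x.2.2.find (parseQuery x.1).2.1
  verified := x.2.2.vm.any fun e => decide (e = ((parseQuery x.1).2.2.1, (parseQuery x.1).2.1))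
  registered := x.2.2.reg.any fun U => decide (U = (parseQuery x.1).2.1)

theorem lookup_poly : PolyTime lookup := by
  unfold lookup Log.find
  refine Info.mk_poly (by fun_prop) (by fun_prop) (PolyTime.listAny (by fun_prop) (by fun_prop))
    (PolyTime.listFindSome (by fun_prop) (by fun_prop)) (PolyTime.listAny (by fun_prop)
    (by fun_prop)) (PolyTime.listAny (by fun_prop) (by fun_prop))

/-- Add an optional element to a list. -/
def consOpt {α : Type} (o : Option α) (l : List α) : List α := o.elim l fun a => a :: l

@[fun_prop]
theorem consOpt_poly {α β : Type} [Coded α] [Coded β] {f : β → Option α} {g : β → List α}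
    (hf : PolyTime f) (hg : PolyTime g) : PolyTime fun b => consOpt (f b) (g b) :=
  PolyTime.optionElim hf hg (by fun_prop)

theorem len_consOpt {α : Type} [Coded α] (o : Option α) (l : List α) :
    len (consOpt o l) ≤ len l + len o := by
  cases o <;> simp [consOpt]; omega

def Log.add (l : Log) (d : Delta) : Log :=
  ⟨consOpt d.cu l.cu, consOpt d.vm l.vm, consOpt d.reg l.reg, consOpt d.usk l.usk,
    consOpt d.comm l.comm, consOpt d.rl l.rl⟩

@[fun_prop]
theorem Log.add_poly {α : Type} [Coded α] {f : α → Log} {g : α → Delta} (hf : PolyTime f)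
    (hg : PolyTime g) : PolyTime fun a => (f a).add (g a) := by
  unfold Log.add; fun_prop

theorem Log.len_add (l : Log) (d : Delta) : len (l.add d) ≤ len l + len d := by
  have h1 := len_consOpt d.cu l.cu
  have h2 := len_consOpt d.vm l.vm
  have h3 := len_consOpt d.reg l.reg
  have h4 := len_consOpt d.usk l.usk
  have h5 := len_consOpt d.comm l.comm
  have h6 := len_consOpt d.rl l.rl
  simp only [len_log, len_delta, len_prod, Log.add]
  omega

/-- The empty tables. -/
def Log.empty : Log := ⟨[], [], [], [], [], []⟩

/-! ## Simulating the experiment for an adversary -/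

section simulation

variable {α β X σ : Type} [Coded α] [Coded β] [Coded X]

/-- Prepare a query after looking up the tables. -/
def simPre (pre : Info → PMF (Data × X)) (x : Data × Params × Log) :
    PMF (Data × X × Params × Log) :=
  (fun e => (e.1, e.2, x.2)) <$> pre (lookup x)

/-- Compute the answer and update the tables. -/
def simPost (post : X × Data → Data × Delta) (x : (X × Params × Log) × Data) :
    Data × Params × Log :=
  ((post (x.1.1, x.2)).1, x.1.2.1, x.1.2.2.add (post (x.1.1, x.2)).2)

/-- The case of `exists_reduction` in which the state consists of parameters and tables. The bound
on answers must not depend on the growing tables. It does not: an answer depends on them only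
through the looked-up `Info`, whose one component of variable length coming from the tables is the
entry of a user `U`, and `husk` bounds each entry, when it is stored, by `N` and the length of `U`.
The hypothesis `hlen` makes lengths in terms of `a` comparable with `N`. -/
theorem exists_simulation {A : Prog} (hA : A.IsOraclePPT) {ini : α → PMF (Data × Params)}
    {pre : Info → PMF (Data × X)} {post : X × Data → Data × Delta}
    {fin : Data × Params × Log → PMF β} (hini : PPT ini) (hpre : PPT pre) (hpost : PolyTime post)
    (hfin : PPT fin) (hlen : ∀ a, ∀ r ∈ (ini a).support, len a ≤ r.1.size)
    (husk : ∀ q c : Polynomial ℕ, ∃ b : Polynomial ℕ, ∀ N i, len i.par ≤ c.eval N →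
      ∀ e ∈ (pre i).support, ∀ r : Data, r.size ≤ q.eval (N + e.1.size) →
        ∀ u, (post (e.2, r)).2.usk = some u → len (u.2.1, u.2.2.1) ≤ b.eval (N + u.1.size)) :
    ∃ B : Prog,
      (∀ (σ : Type) (O : Data → σ → PMF (Data × σ)) (a : α) (t : σ),
        B.runT O (Coded.code a) t = ini a >>= fun r =>
          A.runT (substOracle (relay (simPre pre) (simPost post) O)) r.1 ((r.2, Log.empty), t) >>=
            fun y => (fun b => (Coded.code b, y.2.2)) <$> fin (y.1, y.2.1)) ∧
      ∀ q : Polynomial ℕ, ∃ t : Polynomial ℕ, ∀ a : α,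
        ∀ y ∈ B.outcomes (fun v => {r | r.size ≤ q.eval (len a + v.size)}) (Coded.code a),
          y.2 ≤ t.eval (len a) := by
  have h1 : PPT fun a => (fun r => (r.1, r.2, Log.empty)) <$> ini a :=
    PPT.map (g := fun _ r => (r.1, r.2, Log.empty)) hini (by fun_prop)
  have h2 : PPT (simPre pre) :=
    PPT.map (F := fun x => pre (lookup x)) (g := fun x e => (e.1, e.2, x.2))
      (hpre.comp_polyTime lookup_poly) (by fun_prop)
  have h3 : PolyTime (simPost post) := by unfold simPost; fun_prop
  obtain ⟨ti, hti⟩ := hini.exists_len_le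
  obtain ⟨tl, htl⟩ := parseQuery_poly.exists_len_le
  obtain ⟨tp, htp⟩ := hpre.exists_len_le
  obtain ⟨tq, htq⟩ := hpost.exists_len_le
  obtain ⟨B, hB1, hB2⟩ := exists_reduction hA h1 h2 h3 hfin fun q => by
    obtain ⟨b, hb⟩ := husk q ti
    -- `I` bounds the looked-up information and `K` the result of `post`, that is, both the answer
    -- and the new entries. The invariant bounds the parameters and every stored key and credential.
    let I : Polynomial ℕ := 100 + tl + ti + b.comp (Polynomial.X + tl)
    let K : Polynomial ℕ := tq.comp (1 + tp.comp I + q.comp (Polynomial.X + tp.comp I))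
    refine ⟨K, K, fun N s => len s.1 ≤ ti.eval N ∧ ∀ e ∈ s.2.usk,
      len (e.2.1, e.2.2.1) ≤ b.eval (N + e.1.size), fun a r hr => ?_, ?_⟩
    · obtain ⟨r, hr', rfl⟩ := (PMF.mem_support_map' _ _ _).1 hr
      have e1 := hlen a r hr'
      have e2 := hti a r hr'
      have e3 := ti.eval_mono_nat e1
      simp only [len_prod] at e2
      exact ⟨e1, by simp only; omega, by simp [Log.empty]⟩
    · intro N v s hs e he r hr
      obtain ⟨e, he', rfl⟩ := (PMF.mem_support_map' _ _ _).1 he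
      simp only at hr
      have hI : len (lookup (v, s)) ≤ I.eval (N + v.size) := by
        have e1 := htl v
        have e2 : len ((lookup (v, s)).entry) ≤ 2 + b.eval (N + (parseQuery v).2.1.size) := by
          change len (s.2.find (parseQuery v).2.1) ≤ _
          cases hf : s.2.find (parseQuery v).2.1 with
          | none => simp only [len_none]; omega
          | some y =>
            obtain ⟨u, hu, hu'⟩ := List.exists_of_findSome?_eq_some hf
            split at hu'
            · rename_i h
              simp only [Option.some.injEq] at hu'
              have := hs.2 u hu
              rw [hu', h] at this
              rw [len_some]; omega
            · simp at hu'
        have e3 := b.eval_mono_nat (show N + (parseQuery v).2.1.size ≤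
          N + v.size + tl.eval (N + v.size) by
            have := tl.eval_mono_nat (show v.size ≤ N + v.size by omega)
            simp only [len_data, len_prod] at e1
            omega)
        have e4 := tl.eval_mono_nat (show v.size ≤ N + v.size by omega)
        have e5 := ti.eval_mono_nat (show N ≤ N + v.size by omega)
        have e6 := len_bool (lookup (v, s)).corrupted
        have e7 := len_bool (lookup (v, s)).verified
        have e8 := len_bool (lookup (v, s)).registered
        have e9 := hs.1
        have e10 : (lookup (v, s)).par = s.1 := rfl
        have e11 : (lookup (v, s)).query = parseQuery v := rfl
        rw [len_info]
        simp only [len_prod (α := ℕ × Data × Data × Data), len_prod (α := Params),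
          len_prod (α := Bool), len_prod (α := Option (Data × Data)), e10, e11,
          I, Polynomial.eval_add, Polynomial.eval_ofNat, Polynomial.eval_comp, Polynomial.eval_X]
        rw [len_data] at e1
        omega
      have e1 := (htp _ _ he').trans (tp.eval_mono_nat hI)
      rw [len_prod] at e1
      have e2 := hr.trans (q.eval_mono_nat (show N + e.1.size ≤
        N + v.size + tp.eval (I.eval (N + v.size)) by rw [len_data] at e1; omega))
      have e3 := (htq (e.2, r)).trans (tq.eval_mono_nat (show len (e.2, r) ≤
        1 + tp.eval (I.eval (N + v.size)) +
        q.eval (N + v.size + tp.eval (I.eval (N + v.size))) by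
          change 1 + len e.2 + r.size ≤ _; omega))
      have e4 : K.eval (N + v.size) = tq.eval (1 + tp.eval (I.eval (N + v.size)) +
        q.eval (N + v.size + tp.eval (I.eval (N + v.size)))) := by
        simp only [K, Polynomial.eval_add, Polynomial.eval_comp, Polynomial.eval_X,
          Polynomial.eval_one]
      rw [← e4, len_prod, len_data] at e3
      refine ⟨⟨hs.1, fun u hu => ?_⟩, ?_, ?_⟩
      · simp only [simPost, Log.add, consOpt] at hu
        cases hd : (post (e.2, r)).2.usk with
        | none => rw [hd] at hu; exact hs.2 u hu
        | some u' =>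
          rw [hd] at hu
          rcases List.mem_cons.1 hu with rfl | hu
          · exact hb N _ hs.1 e he' r hr _ hd
          · exact hs.2 u hu
      · simp only [simPost]; omega
      · have e5 := Log.len_add s.2 (post (e.2, r)).2
        simp only [simPost, len_prod (α := Params)]
        omega
  refine ⟨B, fun σ O a t => ?_, hB2⟩
  rw [hB1, bind_map_left]

end simulation

/-! ## Runs without an oracle -/

/-- The oracle that answers nothing. -/
def nilOracle (_ : Data) (t : Unit) : PMF (Data × Unit) := pure (.nil, t)

theorem Prog.runT_nilOracle (p : Prog) (x : Data) :
    p.runT nilOracle x () = (fun y => (y, ())) <$> p.val x := by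
  rw [← Prog.runT_noQuery p nilOracle, Prog.runT, Prog.runT, Prog.eval, Prog.eval,
    Prog.exec_noQuery]
  rfl

theorem Data.size_le_one {r : Data} : r.size ≤ 1 ↔ r = .nil := by
  cases r with
  | nil => simp [Data.size]
  | pair a b =>
    have := a.size_pos
    simp only [Data.size, reduceCtorEq, iff_false]; omega

section game

variable {α : Type} [Coded α]

/-- The oracle of an experiment with tables, in which `game` answers the queries. -/
def gameOracle (game : Info → PMF (Data × Delta)) (v : Data) (s : Params × Log) :
    PMF (Data × Params × Log) :=
  (fun o => (o.1, s.1, s.2.add o.2)) <$> game (lookup (v, s))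

/-- A polynomial-time experiment with a polynomial-time adversary runs in polynomial time. -/
theorem game_ppt {A : Prog} (hA : A.IsOraclePPT) {ini : α → PMF (Data × Params)}
    {game : Info → PMF (Data × Delta)} (hini : PPT ini) (hgame : PPT game)
    (hlen : ∀ a, ∀ r ∈ (ini a).support, len a ≤ r.1.size)
    (husk : ∀ c : Polynomial ℕ, ∃ b : Polynomial ℕ, ∀ N i, len i.par ≤ c.eval N →
      ∀ o ∈ (game i).support, ∀ u, o.2.usk = some u →
        len (u.2.1, u.2.2.1) ≤ b.eval (N + u.1.size)) :
    PPT fun a => ini a >>= fun r => A.runT (gameOracle game) r.1 (r.2, Log.empty) := by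
  -- The whole answer is computed while preparing a dummy query, and the postprocessing only passes
  -- it on.
  obtain ⟨B, hB1, hB2⟩ := exists_simulation (α := α) (β := Data × Params × Log)
    (pre := fun i => (fun o => (Data.nil, o)) <$> game i) (post := fun x => x.1)
    (fin := fun x => pure x) hA hini
    (PPT.map (g := fun _ o => (Data.nil, o)) hgame (by fun_prop)) (by fun_prop)
    (PolyTime.id').ppt hlen (fun q c => by
      obtain ⟨b, hb⟩ := husk c
      refine ⟨b, fun N i hi e he r _ u hu => ?_⟩
      obtain ⟨o, ho, rfl⟩ := (PMF.mem_support_map' _ _ _).1 he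
      exact hb N i hi o ho u hu)
  -- The leaf is the only datum of size at most `1`, so the bound `1` describes runs without an
  -- oracle.
  obtain ⟨t, ht⟩ := hB2 1
  have h1 : ∀ (x : Data) (s : Params × Log), A.runT (substOracle (relay (simPre fun i =>
      (fun o => (Data.nil, o)) <$> game i) (simPost fun x => x.1) nilOracle)) x (s, ()) =
      (fun r => (r.1, r.2, ())) <$> A.runT (gameOracle game) x s := fun x s => by
    refine (Prog.runT_map (fun s => (s, ())) (fun _ => True) (fun v s _ => ?_)
      (fun _ _ _ _ _ => trivial) A x s trivial).1
    simp only [substOracle, relay, simPre, nilOracle, Functor.map_map, bind_map_left, pure_bind,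
      gameOracle, map_bind, map_pure, simPost]
    exact bind_pure_comp _ _
  refine ppt_iff.2 ⟨B, t, fun a => ?_, fun a y hy => ?_⟩
  · have h2 := hB1 Unit nilOracle a ()
    rw [Prog.runT_nilOracle] at h2
    have h3 := congrArg (fun d => Prod.fst <$> d) h2
    simp only [Functor.map_map, id_map'] at h3
    rw [h3]
    simp only [h1, bind_map_left, map_bind, map_pure]
    congr 1
  · have h2 : (fun v : Data => {r : Data | r.size ≤ (1 : Polynomial ℕ).eval (len a + v.size)}) =
        fun _ => {.nil} := by
      funext v; ext r
      simp only [Polynomial.eval_one]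
      exact Data.size_le_one
    have h3 := ht a
    rw [h2] at h3
    exact h3 y hy

end game

/-! ## The experiment and the reduction for TrollThrottle -/

theorem PolyTime.optionMap {α β δ : Type} [Coded α] [Coded β] [Coded δ] {o : δ → Option α}
    (ho : PolyTime o) {f : δ → α → β} (hf : PolyTime fun x : δ × α => f x.1 x.2) :
    PolyTime fun d => (o d).map (f d) :=
  (PolyTime.optionElim ho (.const none) (g := fun d a => some (f d a))
    (PolyTime.optionSome.comp hf)).of_eq fun d => by cases o d <;> rfl

@[fun_prop]
theorem PolyTime.isSome {α δ : Type} [Coded α] [Coded δ] {o : δ → Option α} (ho : PolyTime o) :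
    PolyTime fun d => (o d).isSome :=
  PolyTime.optionIsSome.comp ho

@[fun_prop]
theorem PolyTime.decide_true {α : Type} [Coded α] {f : α → Bool} (hf : PolyTime f) :
    PolyTime fun a => decide (f a = true) := hf.bool_of_prop

/-- Neither honest nor corrupted. -/
def Info.fresh (i : Info) : Bool := !i.corrupted && !i.entry.isSome

@[fun_prop]
theorem Info.fresh_poly {α : Type} [Coded α] {f : α → Info} (hf : PolyTime f) :
    PolyTime fun a => (f a).fresh := by
  unfold Info.fresh; fun_prop

/-- The user concerned, and the other arguments of the query. -/
abbrev Info.user (i : Info) : Data := i.query.2.1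
abbrev Info.arg (i : Info) : Data := i.query.2.2.1
abbrev Info.msg (i : Info) : Data := i.query.2.2.2

section troll

variable (D : DAAScheme) (N : NymAlgorithms) (H : HashFunction) (P : ProofSystem D.RJoin)

/-- What the oracle has to do: the number of the query, or `5` if it refuses. -/
def action (i : Info) : ℕ :=
  if i.query.1 = 0 then 0
  else if i.query.1 = 1 then 1
  else if i.query.1 = 2 then if i.fresh = true then 2 else 5
  else if i.query.1 = 3 then
    if i.fresh = true then if i.verified = true then if i.registered = true then 5
      else if i.msg = .nil then 5
      else if P.verifyProof i.par.crs (i.msg.left, i.par.pk) i.msg.right = true then 3 else 5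
      else 5 else 5
  else if i.query.1 = 4 then
    if i.corrupted = true then 5 else if i.entry.isSome = true then 4 else 5
  else 5

@[fun_prop]
theorem action_poly : PolyTime (action D P) := by
  have h : PolyTime fun i : Info =>
      P.verifyProof i.par.crs (i.msg.left, i.par.pk) i.msg.right :=
    P.verifyProof_poly.comp (f := fun i : Info =>
      (i.par.crs, (i.msg.left, i.par.pk), i.msg.right)) (by fun_prop)
  unfold action
  refine PolyTime.ite (by fun_prop) (by fun_prop) (PolyTime.ite (by fun_prop) (by fun_prop)
    (PolyTime.ite (by fun_prop) (by fun_prop) (PolyTime.ite (by fun_prop)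
    (PolyTime.ite (by fun_prop) (PolyTime.ite (by fun_prop) (PolyTime.ite (by fun_prop)
      (by fun_prop) (PolyTime.ite (by fun_prop) (by fun_prop)
        (PolyTime.ite h.bool_of_prop (by fun_prop) (by fun_prop))))
      (by fun_prop)) (by fun_prop)) (by fun_prop))))

/-- A fresh key and the credential for it. -/
def newUser (x : Params) : PMF (Data × Data) :=
  D.userKey x.n x.pk >>= fun sk => randomBits (D.joinCoins.eval x.n) >>= fun r =>
    (fun cred => (sk, cred)) <$> D.issue x.key (D.join x.pk sk r)

theorem newUser_ppt : PPT (newUser D) := by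
  have h1 : PPT fun x : Params => D.userKey x.n x.pk :=
    D.userKey_ppt.comp_polyTime (f := fun x : Params => (x.n, x.pk)) (by fun_prop)
  have h2 : PPT fun x : Params × Data => randomBits (D.joinCoins.eval x.1.n) :=
    randomBits_ppt.comp_polyTime (f := fun x : Params × Data => D.joinCoins.eval x.1.n)
      ((PolyTime.polynomial _).comp (by fun_prop))
  have h3 : PolyTime fun x : (Params × Data) × List Bool => D.join x.1.1.pk x.1.2 x.2 :=
    D.join_poly.comp (f := fun x : (Params × Data) × List Bool => (x.1.1.pk, x.1.2, x.2))
      (by fun_prop)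
  have h4 : PPT fun x : (Params × Data) × List Bool =>
      D.issue x.1.1.key (D.join x.1.1.pk x.1.2 x.2) :=
    D.issue_ppt.comp_polyTime (f := fun x : (Params × Data) × List Bool =>
      (x.1.1.key, D.join x.1.1.pk x.1.2 x.2)) (PolyTime.prodMk (by fun_prop) h3)
  have h5 : PPT fun x : (Params × Data) × List Bool =>
      (fun cred => (x.1.2, cred)) <$> D.issue x.1.1.key (D.join x.1.1.pk x.1.2 x.2) :=
    PPT.map (g := fun (x : (Params × Data) × List Bool) (cred : Data) => (x.1.2, cred)) h4
      (by fun_prop)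
  have h6 : PPT fun x : Params × Data => randomBits (D.joinCoins.eval x.1.n) >>= fun r =>
      (fun cred => (x.2, cred)) <$> D.issue x.1.key (D.join x.1.pk x.2 r) :=
    PPT.bind (F := fun x : Params × Data => randomBits (D.joinCoins.eval x.1.n))
      (G := fun x : (Params × Data) × List Bool =>
        (fun cred => (x.1.2, cred)) <$> D.issue x.1.1.key (D.join x.1.1.pk x.1.2 x.2)) h2 h5
  exact PPT.bind (F := fun x : Params => D.userKey x.n x.pk) (G := fun x : Params × Data =>
    randomBits (D.joinCoins.eval x.1.n) >>= fun r =>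
      (fun cred => (x.2, cred)) <$> D.issue x.1.key (D.join x.1.pk x.2 r)) h1 h6

/-- The answer and the record for a comment with the given signature and pseudonym. -/
def commentResult (i : Info) (σ nym : Data) : Data × Delta :=
  (Coded.code (some (Coded.code (Coded.code (σ, nym, i.arg, H.hash i.par.n i.msg), nym))),
    { comm := some (i.user, nym, i.arg, i.msg,
        Coded.code (σ, nym, i.arg, H.hash i.par.n i.msg)) })

@[fun_prop]
theorem hash_poly' {α : Type} [Coded α] {f : α → ℕ} {g : α → Data} (hf : PolyTime f)
    (hg : PolyTime g) : PolyTime fun a => H.hash (f a) (g a) :=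
  H.hash_poly.comp (hf.prodMk hg)

theorem commentResult_poly {α : Type} [Coded α] {f : α → Info} {σ nym : α → Data}
    (hf : PolyTime f) (hσ : PolyTime σ) (hn : PolyTime nym) :
    PolyTime fun a => commentResult H (f a) (σ a) (nym a) := by
  unfold commentResult
  have h := hash_poly' H (Params.n_poly (Info.par_poly hf)) (Info.query_poly hf).snd.snd.snd
  have h2 : PolyTime fun a =>
      (Coded.code (σ a, nym a, (f a).arg, H.hash (f a).par.n (f a).msg)) :=
    PolyTime.code.comp (hσ.prodMk (hn.prodMk (PolyTime.prodMk (by fun_prop) h)))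
  refine PolyTime.prodMk (PolyTime.code.comp (PolyTime.optionSome.comp
    (PolyTime.code.comp (h2.prodMk hn)))) (Delta.mk_poly (by fun_prop) (by fun_prop) (by fun_prop)
    (by fun_prop) (PolyTime.optionSome.comp (PolyTime.prodMk (by fun_prop) (hn.prodMk
    (PolyTime.prodMk (by fun_prop) (PolyTime.prodMk (by fun_prop) h2))))) (by fun_prop))

/-- The answers of the trolling experiment, where honest users join without a proof. -/
def game (i : Info) : PMF (Data × Delta) :=
  if action D P i = 0 then
    pure (Coded.code (i.entry.map (Coded.code : Data × Data → Data)), { cu := some i.user })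
  else if action D P i = 1 then
    pure (Coded.code (none : Option Data), { vm := some (i.arg, i.user) })
  else if action D P i = 2 then
    (fun k => (Coded.code (some k.2), { usk := some (i.user, k.1, k.2, i.arg) })) <$>
      newUser D i.par
  else if action D P i = 3 then
    (fun cred => (Coded.code (some cred), { reg := some i.user })) <$>
      D.issue i.par.key i.msg.left
  else if action D P i = 4 then
    (fun σ => commentResult H i σ (N.nymGen (i.entry.getD (.nil, .nil)).1 i.arg)) <$>
      D.sign (i.entry.getD (.nil, .nil)).1 (i.entry.getD (.nil, .nil)).2 (some i.arg)
        (H.hash i.par.n i.msg)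
  else pure (Coded.code (none : Option Data), {})

theorem PolyTime.optionGetD {α δ : Type} [Coded α] [Coded δ] {o : δ → Option α}
    (ho : PolyTime o) (a : α) : PolyTime fun d => (o d).getD a :=
  (PolyTime.optionElim ho (.const a) (g := fun _ a => a) (by fun_prop)).of_eq fun d => by
    cases o d <;> rfl

theorem game_poly : PPT (game D N H P) := by
  have he : PolyTime fun i : Info => i.entry.getD (.nil, .nil) :=
    PolyTime.optionGetD (by fun_prop) _
  have hs : PPT fun i : Info => D.sign (i.entry.getD (.nil, .nil)).1
      (i.entry.getD (.nil, .nil)).2 (some i.arg) (H.hash i.par.n i.msg) :=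
    D.sign_ppt.comp_polyTime (f := fun i : Info => ((i.entry.getD (.nil, .nil)).1,
      (i.entry.getD (.nil, .nil)).2, some i.arg, H.hash i.par.n i.msg))
      (he.fst.prodMk (he.snd.prodMk (by fun_prop)))
  have hn : PolyTime fun i : Info => N.nymGen (i.entry.getD (.nil, .nil)).1 i.arg :=
    N.nymGen_poly.comp (f := fun i : Info => ((i.entry.getD (.nil, .nil)).1, i.arg))
      (he.fst.prodMk (by fun_prop))
  have hi : PPT fun i : Info => D.issue i.par.key i.msg.left :=
    D.issue_ppt.comp_polyTime (f := fun i : Info => (i.par.key, i.msg.left)) (by fun_prop)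
  unfold game
  refine PPT.ite (by fun_prop) (PolyTime.ppt (PolyTime.prodMk (PolyTime.code.comp
    (PolyTime.optionMap (by fun_prop) (by fun_prop))) (by fun_prop)))
    (PPT.ite (by fun_prop) (PolyTime.ppt (by fun_prop)) (PPT.ite (by fun_prop) ?_
    (PPT.ite (by fun_prop) ?_ (PPT.ite (by fun_prop) ?_ (PolyTime.ppt (by fun_prop))))))
  · exact PPT.map (F := fun i : Info => newUser D i.par)
      (g := fun i k => ((Coded.code (some k.2),
        ({ usk := some (i.user, k.1, k.2, i.arg) } : Delta)) : Data × Delta))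
      ((newUser_ppt D).comp_polyTime (by fun_prop)) (by fun_prop)
  · exact PPT.map (g := fun (i : Info) (cred : Data) => ((Coded.code (some cred),
        ({ reg := some i.user } : Delta)) : Data × Delta)) hi (by fun_prop)
  · exact PPT.map (g := fun (i : Info) (σ : Data) => commentResult H i σ
      (N.nymGen (i.entry.getD (.nil, .nil)).1 i.arg)) hs
      (commentResult_poly H (by fun_prop) (by fun_prop) (hn.comp (by fun_prop)))

/-- Only the creation of an honest user writes to this table, and the key and credential have a
length polynomial in that of the parameters. -/
theorem game_usk (c : Polynomial ℕ) : ∃ b : Polynomial ℕ, ∀ n i, len i.par ≤ c.eval n →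
    ∀ o ∈ (game D N H P i).support, ∀ u, o.2.usk = some u →
      len (u.2.1, u.2.2.1) ≤ b.eval (n + u.1.size) := by
  obtain ⟨t, ht⟩ := (newUser_ppt D).exists_len_le
  refine ⟨t.comp c, fun n i hi o ho u hu => ?_⟩
  unfold game at ho
  split_ifs at ho
  · rw [PMF.mem_support_pure'] at ho; subst ho; simp at hu
  · rw [PMF.mem_support_pure'] at ho; subst ho; simp at hu
  · obtain ⟨k, hk, rfl⟩ := (PMF.mem_support_map' _ _ _).1 ho
    simp only [Option.some.injEq] at hu
    subst hu
    rw [Polynomial.eval_comp]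
    exact (ht _ _ hk).trans (t.eval_mono_nat (hi.trans (c.eval_mono_nat (by omega))))
  · obtain ⟨k, hk, rfl⟩ := (PMF.mem_support_map' _ _ _).1 ho
    simp at hu
  · obtain ⟨k, hk, rfl⟩ := (PMF.mem_support_map' _ _ _).1 ho
    simp [commentResult] at hu
  · rw [PMF.mem_support_pure'] at ho; subst ho; simp at hu

/-- The identities under which the reduction joins honest users and the adversary's users. -/
def honestId (U : Data) : Data := Coded.code ((0 : ℕ), U)
def joinedId (U : Data) : Data := Coded.code ((1 : ℕ), U)

/-! ### The queries and answers of the reduction. -/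

variable (E₂ : Data → Data → Data × Data → Data → PMF (Data × List Bool))

/-- The query of the reduction to the traceability game. -/
def redPre (i : Info) : PMF (Data × Info × Data) :=
  if action D P i = 0 then
    pure (if i.entry.isSome = true then Coded.code ((3 : ℕ), honestId i.user) else .nil, i, .nil)
  else if action D P i = 2 then
    pure (Coded.code ((1 : ℕ), honestId i.user), i, .nil)
  else if action D P i = 3 then
    (fun w => (Coded.code ((2 : ℕ), (Coded.code (joinedId i.user, w.1, w.2))), i, w.1)) <$>
      E₂ i.par.crs i.par.key (i.msg.left, i.par.pk) i.msg.right
  else if action D P i = 4 then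
    pure (Coded.code ((0 : ℕ), (Coded.code (honestId i.user, some i.arg,
      H.hash i.par.n i.msg))), i, .nil)
  else pure (.nil, i, .nil)

/-- The reduction's answer to the adversary. -/
def redPost (x : (Info × Data) × Data) : Data × Delta :=
  if action D P x.1.1 = 0 then
    (Coded.code (x.1.1.entry.map fun e => (Coded.code (x.2.right, e.2) : Data)),
      { cu := some x.1.1.user, rl := x.1.1.entry.map fun _ => x.2.right })
  else if action D P x.1.1 = 1 then
    (Coded.code (none : Option Data), { vm := some (x.1.1.arg, x.1.1.user) })
  else if action D P x.1.1 = 2 then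
    (Coded.code (some x.2.right), { usk := some (x.1.1.user, .nil, x.2.right, x.1.1.arg) })
  else if action D P x.1.1 = 3 then
    (Coded.code (some x.2.right), { reg := some x.1.1.user, rl := some x.1.2 })
  else if action D P x.1.1 = 4 then
    commentResult H x.1.1 x.2.right (N.nymExtract x.2.right)
  else (Coded.code (none : Option Data), {})

@[fun_prop]
theorem honestId_poly : PolyTime honestId := by unfold honestId; fun_prop
@[fun_prop]
theorem joinedId_poly : PolyTime joinedId := by unfold joinedId; fun_prop

theorem redPre_poly (hE : PPT fun x : Data × Data × (Data × Data) × Data =>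
    E₂ x.1 x.2.1 x.2.2.1 x.2.2.2) : PPT (redPre D H P E₂) := by
  have hE' : PPT fun i : Info => E₂ i.par.crs i.par.key (i.msg.left, i.par.pk) i.msg.right :=
    hE.comp_polyTime (f := fun i : Info =>
      (i.par.crs, i.par.key, (i.msg.left, i.par.pk), i.msg.right)) (by fun_prop)
  unfold redPre
  refine PPT.ite (by fun_prop) (PolyTime.ppt (by fun_prop)) (PPT.ite (by fun_prop)
    (PolyTime.ppt (by fun_prop)) (PPT.ite (by fun_prop) ?_ (PPT.ite (by fun_prop)
    (PolyTime.ppt ?_) (PolyTime.ppt (by fun_prop)))))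
  · exact PPT.map (g := fun (i : Info) (w : Data × List Bool) => (Coded.code ((2 : ℕ),
      (Coded.code (joinedId i.user, w.1, w.2))), i, w.1)) hE' (by fun_prop)
  · fun_prop

theorem redPost_poly : PolyTime (redPost D N H P) := by
  unfold redPost
  have h1 : PolyTime fun x : (Info × Data) × Data =>
      x.1.1.entry.map fun e => (Coded.code (x.2.right, e.2) : Data) :=
    PolyTime.optionMap (by fun_prop) (f := fun (x : (Info × Data) × Data) (e : Data × Data) =>
      (Coded.code (x.2.right, e.2) : Data))
      (by fun_prop)
  have h2 : PolyTime fun x : (Info × Data) × Data => x.1.1.entry.map fun _ => x.2.right :=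
    PolyTime.optionMap (by fun_prop) (f := fun (x : (Info × Data) × Data) (_ : Data × Data) =>
      x.2.right) (by fun_prop)
  have h3 : PolyTime fun x : (Info × Data) × Data => N.nymExtract x.2.right :=
    N.nymExtract_poly.comp (by fun_prop)
  refine PolyTime.ite (by fun_prop) (PolyTime.prodMk (PolyTime.code.comp h1)
    (Delta.mk_poly (by fun_prop) (by fun_prop) (by fun_prop) (by fun_prop) (by fun_prop) h2))
    (PolyTime.ite (by fun_prop) (by fun_prop) (PolyTime.ite (by fun_prop) (by fun_prop)
    (PolyTime.ite (by fun_prop) (by fun_prop) (PolyTime.ite (by fun_prop)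
    (commentResult_poly H (by fun_prop) (by fun_prop) h3) (by fun_prop)))))

/-- The stored credential is part of the challenger's answer to an `hjoin` query of length `6 +
|U|`; the slot for the key holds a leaf. -/
theorem red_usk (q c : Polynomial ℕ) : ∃ b : Polynomial ℕ, ∀ n i, len i.par ≤ c.eval n →
    ∀ e ∈ (redPre D H P E₂ i).support, ∀ r : Data, r.size ≤ q.eval (n + e.1.size) →
      ∀ u, (redPost D N H P (e.2, r)).2.usk = some u →
        len (u.2.1, u.2.2.1) ≤ b.eval (n + u.1.size) := by
  refine ⟨10 + q.comp (Polynomial.X + 10), fun n i _ e he r hr u hu => ?_⟩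
  unfold redPre at he
  by_cases h0 : action D P i = 0
  · rw [if_pos h0, PMF.mem_support_pure'] at he; subst he; simp [redPost, h0] at hu
  rw [if_neg h0] at he
  split_ifs at he with h2 h3 h4
  · rw [PMF.mem_support_pure'] at he; subst he; simp [redPost, h2] at hu
    subst hu
    have e1 := r.size_right
    have e2 : (Coded.code ((1 : ℕ), honestId i.user)).size = 6 + i.user.size := by
      simp only [len_code, honestId, len_prod, len_data]
      rw [show len (1 : ℕ) = 3 from rfl, len_zero]
      omega
    simp only [e2] at hr
    have e3 := q.eval_mono_nat (show n + (6 + i.user.size) ≤ n + i.user.size + 10 by omega)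
    simp only [len_prod, len_data, Data.size, Polynomial.eval_add, Polynomial.eval_comp,
      Polynomial.eval_ofNat, Polynomial.eval_X]
    omega
  · obtain ⟨w, -, rfl⟩ := (PMF.mem_support_map' _ _ _).1 he
    simp [redPost, h3] at hu
  · rw [PMF.mem_support_pure'] at he; subst he; simp [redPost, h4, commentResult] at hu
  · rw [PMF.mem_support_pure'] at he; subst he
    simp only [redPost, h0, h2, h3, h4, if_false] at hu
    split at hu <;> simp at hu

end troll

/-! ## The trolling experiment in terms of tables -/

theorem Prog.runT_support {σ : Type} {O : Data → σ → PMF (Data × σ)} (Inv : σ → Prop)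
    (hInv : ∀ v s, Inv s → ∀ r ∈ (O v s).support, Inv r.2) (p : Prog) (x : Data) (s : σ)
    (hs : Inv s) : ∀ r ∈ (p.runT O x s).support, Inv r.2 :=
  (Prog.runT_map (fun s => s) Inv (fun v s _ => (id_map (O v s)).symm) hInv p x s hs).2

theorem gameOracle_par {g : Info → PMF (Data × Delta)} (p : Params) (v : Data) (s : Params × Log)
    (hs : s.1 = p) (r : Data × Params × Log) (hr : r ∈ (gameOracle g v s).support) :
    r.2.1 = p := by
  obtain ⟨o, -, rfl⟩ := (PMF.mem_support_map' _ _ _).1 hr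
  exact hs

theorem length_of_mem_randomBits {n : ℕ} {r : List Bool} (hr : r ∈ (randomBits n).support) :
    r.length = n := by
  obtain ⟨f, -, rfl⟩ := (PMF.mem_support_map_iff _ _ _).1 hr
  exact List.length_ofFn

/-- The state of the trolling experiment described by tables. -/
def Log.toState (l : Log) : TrollState where
  CU := l.cu.toFinset
  HU := (l.usk.map Prod.fst).toFinset \ l.cu.toFinset
  VM := l.vm.toFinset
  ver := l.vm.toFinset ∪ (l.usk.map fun e => (e.2.2.2, e.1)).toFinset
  REG := l.reg.toFinset
  USK := l.usk
  COMM := l.comm.toFinset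

theorem Log.find_eq (l : Log) (U : Data) :
    l.find U = (l.usk.find? fun e => e.1 = U).map fun e => (e.2.1, e.2.2.1) := by
  unfold Log.find
  induction l.usk with
  | nil => rfl
  | cons e t ih =>
    by_cases h : e.1 = U
    · simp [h]
    · simp only [List.findSome?_cons, List.find?_cons, h, if_false, decide_false]
      exact ih

theorem Log.find_isSome (l : Log) (U : Data) :
    (l.find U).isSome = true ↔ U ∈ l.usk.map Prod.fst := by
  rw [Log.find_eq]
  simp [List.find?_isSome]

/-- `i` is what the tables say about a user. -/
structure Info.Reflects (i : Info) (p : Params) (l : Log) : Prop where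
  par : i.par = p
  entry : i.entry = l.find i.user
  corrupted : i.corrupted = true ↔ i.user ∈ l.cu
  verified : i.verified = true ↔ (i.arg, i.user) ∈ l.vm
  registered : i.registered = true ↔ i.user ∈ l.reg

theorem lookup_reflects (v : Data) (p : Params) (l : Log) :
    (lookup (v, p, l)).Reflects p l := by
  constructor <;> simp [lookup]

theorem Info.Reflects.fresh_iff {i : Info} {p : Params} {l : Log} (h : i.Reflects p l) :
    i.fresh = true ↔ i.user ∉ l.toState.HU ∪ l.toState.CU := by
  have h1 := l.find_isSome i.user
  have h2 := h.corrupted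
  simp only [Info.fresh, Bool.and_eq_true, Bool.not_eq_true', Log.toState, Finset.mem_union,
    Finset.mem_sdiff, List.mem_toFinset, not_or, ← h1, ← h2, ← Bool.not_eq_true, h.entry]
  tauto

/-! ### The oracles of TrollThrottle on tables. -/

section troll

variable (D : DAAScheme) (N : NymAlgorithms) (H : HashFunction) (P : ProofSystem D.RJoin)

/-- Joining honestly amounts to `newUser`, since the proof system is complete. -/
theorem honestJoin_eq {n : ℕ} {ρ : Data} (hρ : ρ ∈ (P.setup n).support) (pk skI U : Data)
    {β : Type} (F : Data → Option Data → PMF β) :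
    (((trollThrottle D N H P).userKey (n, ρ) pk) >>= fun sk =>
      ((trollThrottle D N H P).join (n, ρ) pk sk U) >>= fun msg =>
      ((trollThrottle D N H P).issue (n, ρ) (pk, skI) U msg) >>= fun c => F sk c) =
    newUser D ⟨n, ρ, pk, skI⟩ >>= fun k => F k.1 (some k.2) := by
  simp only [newUser, bind_assoc, bind_map_left]
  refine PMF.bind_congr' fun sk _ => ?_
  change ((randomBits (D.joinCoins.eval n) >>= fun r => _) >>= _) = _
  rw [bind_assoc]
  refine PMF.bind_congr' fun r hr => ?_
  rw [bind_assoc]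
  have hR : D.RJoin n (D.join pk sk r, pk) (sk, r) := ⟨length_of_mem_randomBits hr, rfl⟩
  have h : ∀ π ∈ (P.createProof ρ (D.join pk sk r, pk) (sk, r)).support,
      ((pure (Coded.code (D.join pk sk r, π)) : PMF Data) >>= fun msg =>
        ((trollThrottle D N H P).issue (n, ρ) (pk, skI) U msg) >>= fun c => F sk c) =
      D.issue skI (D.join pk sk r) >>= fun cred => F sk (some cred) := by
    intro π hπ
    rw [pure_bind]
    change ((if P.verifyProof ρ (D.join pk sk r, pk) π = true then
      (some <$> D.issue skI (D.join pk sk r)) else pure none) >>= _) = _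
    rw [if_pos (P.complete n ρ hρ _ _ hR π hπ), bind_map_left]
  -- By perfect completeness every honest proof is accepted, and the continuation then no longer
  -- depends on `π`, so sampling it has no effect.
  rw [PMF.bind_congr' h]
  exact PMF.bind_const _ _

theorem game_eq {i : Info} {k : ℕ} : action D P i = k → game D N H P i =
    match k with
    | 0 => pure (Coded.code (i.entry.map (Coded.code : Data × Data → Data)), { cu := some i.user })
    | 1 => pure (Coded.code (none : Option Data), { vm := some (i.arg, i.user) })
    | 2 => (fun k => (Coded.code (some k.2), { usk := some (i.user, k.1, k.2, i.arg) })) <$>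
        newUser D i.par
    | 3 => (fun cred => (Coded.code (some cred), { reg := some i.user })) <$>
        D.issue i.par.key i.msg.left
    | 4 => (fun σ => commentResult H i σ (N.nymGen (i.entry.getD (.nil, .nil)).1 i.arg)) <$>
        D.sign (i.entry.getD (.nil, .nil)).1 (i.entry.getD (.nil, .nil)).2 (some i.arg)
          (H.hash i.par.n i.msg)
    | _ => pure (Coded.code (none : Option Data), {}) := by
  intro h
  unfold game
  rw [h]
  match k with
  | 0 => rfl
  | 1 => rfl
  | 2 => rfl
  | 3 => rfl
  | 4 => rfl
  | k + 5 => rfl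

theorem PMF.map_eq_functor_map {α β : Type} (f : α → β) (d : PMF α) : d.map f = f <$> d := rfl

theorem trollAnswer_corruptUser {n : ℕ} {ρ : Data} (pk skI : Data)
    {l : Log} {i : Info} {U a m : Data} (h : i.Reflects ⟨n, ρ, pk, skI⟩ l)
    (hqi : i.query = (0, U, a, m)) :
    (fun x => (Coded.code x.1, x.2)) <$> (trollThrottle D N H P).trollAnswer (n, ρ) pk (pk, skI)
      l.toState (.corruptUser U) =
      (fun o => (o.1, (l.add o.2).toState)) <$> game D N H P i := by
  have hU : i.user = U := by rw [Info.user, hqi]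
  have ha : i.arg = a := by rw [Info.arg, hqi]
  have hm : i.msg = m := by rw [Info.msg, hqi]
  have hf := h.fresh_iff
  obtain ⟨hp, he, hc, hv, hr⟩ := h
  rw [hU] at hf he hc hr
  rw [hU, ha] at hv
  rw [game_eq D N H P (k := 0) (by simp [action, hqi])]
  simp only [CommentingScheme.trollAnswer, map_pure]
  refine congrArg (pure : Data × TrollState → PMF _) (Prod.ext ?_ ?_)
  · simp only [he, Log.find_eq, Option.map_map]; rfl
  · simp only [Log.toState, Log.add, consOpt, TrollState.mk.injEq, and_true, hU, Option.elim]
    refine ⟨by simp, ?_⟩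
    ext x
    simp only [Finset.mem_erase, Finset.mem_sdiff, List.toFinset_cons, Finset.mem_insert, not_or]
    exact and_left_comm

theorem trollAnswer_corruptVer {n : ℕ} {ρ : Data} (pk skI : Data)
    {l : Log} {i : Info} {U a m : Data} (h : i.Reflects ⟨n, ρ, pk, skI⟩ l)
    (hqi : i.query = (1, U, a, m)) :
    (fun x => (Coded.code x.1, x.2)) <$> (trollThrottle D N H P).trollAnswer (n, ρ) pk (pk, skI)
      l.toState (.corruptVer U a) =
      (fun o => (o.1, (l.add o.2).toState)) <$> game D N H P i := by
  have hU : i.user = U := by rw [Info.user, hqi]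
  have ha : i.arg = a := by rw [Info.arg, hqi]
  have hm : i.msg = m := by rw [Info.msg, hqi]
  have hf := h.fresh_iff
  obtain ⟨hp, he, hc, hv, hr⟩ := h
  rw [hU] at hf he hc hr
  rw [hU, ha] at hv
  rw [game_eq D N H P (k := 1) (by simp [action, hqi])]
  simp only [CommentingScheme.trollAnswer, map_pure]
  refine congrArg (pure : Data × TrollState → PMF _) (Prod.ext rfl ?_)
  simp [Log.toState, Log.add, consOpt, hU, ha]

theorem trollAnswer_createHonestUser {n : ℕ} {ρ : Data} (hρ : ρ ∈ (P.setup n).support) (pk skI : Data)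
    {l : Log} {i : Info} {U a m : Data} (h : i.Reflects ⟨n, ρ, pk, skI⟩ l)
    (hqi : i.query = (2, U, a, m)) :
    (fun x => (Coded.code x.1, x.2)) <$> (trollThrottle D N H P).trollAnswer (n, ρ) pk (pk, skI)
      l.toState (.createHonestUser U a) =
      (fun o => (o.1, (l.add o.2).toState)) <$> game D N H P i := by
  have hU : i.user = U := by rw [Info.user, hqi]
  have ha : i.arg = a := by rw [Info.arg, hqi]
  have hm : i.msg = m := by rw [Info.msg, hqi]
  have hf := h.fresh_iff
  obtain ⟨hp, he, hc, hv, hr⟩ := h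
  rw [hU] at hf he hc hr
  rw [hU, ha] at hv
  simp only [CommentingScheme.trollAnswer]
  by_cases h : U ∈ l.toState.HU ∪ l.toState.CU
  · rw [if_pos h, game_eq D N H P (k := 5) (by simp [action, hqi, hf, h])]
    simp only [map_pure]
    rfl
  · rw [if_neg h, game_eq D N H P (k := 2) (by simp [action, hqi, hf, h]),
      honestJoin_eq D N H P hρ pk skI U, map_bind, hp]
    simp only [map_pure, Functor.map_map]
    rw [← bind_pure_comp]
    refine PMF.bind_congr' fun x _ => ?_
    refine congrArg (pure : Data × TrollState → PMF _) (Prod.ext rfl ?_)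
    simp only [Log.toState, Log.add, consOpt, hU, ha, Finset.mem_union, not_or,
      List.mem_toFinset] at h ⊢
    simp only [TrollState.mk.injEq, and_true, true_and, Option.elim]
    constructor
    -- Adding `U` to the honest users commutes with removing the corrupted ones because `U` is not
    -- corrupted.
    · ext x
      have := h.2
      by_cases hx : x = U <;> simp [hx, this]
    · simp

theorem trollAnswer_joinSystem {n : ℕ} {ρ : Data} (pk skI : Data)
    {l : Log} {i : Info} {U a m : Data} (h : i.Reflects ⟨n, ρ, pk, skI⟩ l)
    (hqi : i.query = (3, U, a, m)) :
    (fun x => (Coded.code x.1, x.2)) <$> (trollThrottle D N H P).trollAnswer (n, ρ) pk (pk, skI)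
      l.toState (.joinSystem U a m) =
      (fun o => (o.1, (l.add o.2).toState)) <$> game D N H P i := by
  have hU : i.user = U := by rw [Info.user, hqi]
  have ha : i.arg = a := by rw [Info.arg, hqi]
  have hm : i.msg = m := by rw [Info.msg, hqi]
  have hf := h.fresh_iff
  obtain ⟨hp, he, hc, hv, hr⟩ := h
  rw [hU] at hf he hc hr
  rw [hU, ha] at hv
  simp only [CommentingScheme.trollAnswer]
  by_cases h : U ∉ l.toState.HU ∪ l.toState.CU ∧ (a, U) ∈ l.toState.ver ∧ U ∉ l.toState.REG
  · rw [if_pos h]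
    -- Had the confirmation come from `createHonestUser`, then `U` would be honest or corrupted,
    -- which `h` excludes.
    have h2 : (a, U) ∈ l.vm := by
      obtain ⟨h1, h2, -⟩ := h
      simp only [Log.toState, Finset.mem_union, Finset.mem_sdiff, List.mem_toFinset,
        List.mem_map] at h1 h2
      rcases h2 with h2 | ⟨e, he, h2⟩
      · exact h2
      · simp only [Prod.mk.injEq] at h2
        refine absurd ?_ h1
        by_cases h3 : U ∈ l.cu
        · exact Or.inr h3
        · exact Or.inl ⟨⟨e, he, h2.2⟩, h3⟩
    have h3 : U ∉ l.reg := by simpa [Log.toState] using h.2.2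
    match m with
    | .nil =>
      have h4 : (trollThrottle D N H P).issue (n, ρ) (pk, skI) U .nil = pure none := rfl
      rw [h4, game_eq D N H P (k := 5) (by simp [action, hqi, hf, hv, hr, hm, h.1, h2, h3])]
      simp only [map_pure, pure_bind]
      rfl
    | .pair com π =>
      have h4 : (trollThrottle D N H P).issue (n, ρ) (pk, skI) U (.pair com π) =
          if P.verifyProof ρ (com, pk) π = true then some <$> D.issue skI com
          else pure none := rfl
      rw [h4]
      by_cases h5 : P.verifyProof ρ (com, pk) π = true
      · rw [if_pos h5, game_eq D N H P (k := 3) (by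
          simp [action, hqi, hf, hv, hr, hm, h.1, h2, h3, hp, Data.left, Data.right, h5])]
        simp only [bind_map_left, map_bind, map_pure, Functor.map_map, hm, hp, hU]
        rw [← bind_pure_comp]
        refine PMF.bind_congr' fun cred _ => ?_
        refine congrArg (pure : Data × TrollState → PMF _) (Prod.ext rfl ?_)
        simp [Log.toState, Log.add, consOpt]
      · rw [if_neg h5, game_eq D N H P (k := 5) (by
          simp [action, hqi, hf, hv, hr, hm, h.1, h2, h3, hp, Data.left, Data.right, h5])]
        simp only [map_pure, pure_bind]
        rfl
  · rw [if_neg h, game_eq D N H P (k := 5)]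
    · simp only [map_pure]
      rfl
    · by_cases h1 : U ∈ l.toState.HU ∪ l.toState.CU
      · simp [action, hqi, hf, h1]
      by_cases h2 : (a, U) ∈ l.vm
      · by_cases h3 : U ∈ l.reg
        · simp [action, hqi, hf, h1, hv, h2, hr, h3]
        · refine absurd ⟨h1, ?_, ?_⟩ h <;> simp [Log.toState, h2, h3]
      · simp [action, hqi, hf, h1, hv, h2]

theorem trollAnswer_createComment {n : ℕ} {ρ : Data} (pk skI : Data)
    {l : Log} {i : Info} {U a m : Data} (h : i.Reflects ⟨n, ρ, pk, skI⟩ l)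
    (hqi : i.query = (4, U, a, m)) :
    (fun x => (Coded.code x.1, x.2)) <$> (trollThrottle D N H P).trollAnswer (n, ρ) pk (pk, skI)
      l.toState (.createComment U a m) =
      (fun o => (o.1, (l.add o.2).toState)) <$> game D N H P i := by
  have hU : i.user = U := by rw [Info.user, hqi]
  have ha : i.arg = a := by rw [Info.arg, hqi]
  have hm : i.msg = m := by rw [Info.msg, hqi]
  have hf := h.fresh_iff
  obtain ⟨hp, he, hc, hv, hr⟩ := h
  rw [hU] at hf he hc hr
  rw [hU, ha] at hv
  simp only [CommentingScheme.trollAnswer]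
  have hfind := l.find_eq U
  cases h1 : l.usk.find? fun e => e.1 = U with
  | none =>
    rw [h1] at hfind
    have h2 : l.toState.USK.find? (fun e => e.1 = U) = none := h1
    rw [h2, game_eq D N H P (k := 5) (by simp [action, hqi, he, hfind])]
    simp only [ite_self, map_pure]
    rfl
  | some e =>
    rw [h1] at hfind
    have h2 : l.toState.USK.find? (fun e => e.1 = U) = some e := h1
    have h3 : U ∈ l.usk.map Prod.fst := by rw [← l.find_isSome, hfind]; rfl
    by_cases h4 : U ∈ l.cu
    · rw [if_neg (by simp [Log.toState, h4]),
        game_eq D N H P (k := 5) (by simp [action, hqi, hc, h4])]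
      simp only [map_pure]
      rfl
    · rw [if_pos (by
          simp only [Log.toState, Finset.mem_sdiff, List.mem_toFinset]; exact ⟨h3, h4⟩), h2,
        game_eq D N H P (k := 4) (by simp [action, hqi, hc, h4, he, hfind])]
      have h5 : (trollThrottle D N H P).comment (n, ρ) pk e.2.1 e.2.2.1 a m =
        (fun σ => (N.nymGen e.2.1 a, Coded.code (σ, N.nymGen e.2.1 a, a, H.hash n m))) <$>
          D.sign e.2.1 e.2.2.1 (some a) (H.hash n m) := bind_pure_comp _ _
      simp only [h5, bind_map_left, map_bind, map_pure, Functor.map_map, he, hfind, hp, ha, hm]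
      rw [← bind_pure_comp]
      refine PMF.bind_congr' fun σ _ => ?_
      refine congrArg (pure : Data × TrollState → PMF _) (Prod.ext ?_ ?_)
      · simp [commentResult, hp, ha, hm]
      · simp [commentResult, hp, ha, hm, hU, Log.toState, Log.add, consOpt]

/-- The original oracle depends on the tables only through the sets they list. The hypothesis on `ρ`
enters through perfect completeness, which allows honest users to join without a proof. -/
theorem trollOracle_toState {n : ℕ} {ρ : Data} (hρ : ρ ∈ (P.setup n).support) (pk skI : Data)
    (v : Data) (l : Log) :
    (trollThrottle D N H P).trollOracle (n, ρ) pk (pk, skI) v l.toState =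
      (fun r => (r.1, r.2.2.toState)) <$>
        gameOracle (game D N H P) v (⟨n, ρ, pk, skI⟩, l) := by
  unfold CommentingScheme.trollOracle gameOracle
  rw [← toQuery_parseQuery, Functor.map_map]
  have h := lookup_reflects v ⟨n, ρ, pk, skI⟩ l
  rcases hqi : parseQuery v with ⟨k, U, a, m⟩
  change (lookup (v, (⟨n, ρ, pk, skI⟩ : Params), l)).query = _ at hqi
  match k with
  | 0 => exact trollAnswer_corruptUser D N H P pk skI h hqi
  | 1 => exact trollAnswer_corruptVer D N H P pk skI h hqi
  | 2 => exact trollAnswer_createHonestUser D N H P hρ pk skI h hqi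
  | 3 => exact trollAnswer_joinSystem D N H P pk skI h hqi
  | 4 => exact trollAnswer_createComment D N H P pk skI h hqi
  | k + 5 =>
    rw [game_eq D N H P (k := 5) (by simp [action, hqi])]
    simp only [toQuery, map_pure]
    rfl

/-- Passing from single answers to runs is `Prog.runT_map` for `Log.toState`, with the invariant
that the parameters never change. -/
theorem trollExp_eq (A : Prog) (n : ℕ) : (trollThrottle D N H P).trollExp A n =
    P.setup n >>= fun ρ => D.setup n >>= fun k =>
      A.runT (gameOracle (game D N H P)) (Coded.code ((n, ρ), k.1))
        (⟨n, ρ, k.1, k.2⟩, Log.empty) >>= fun y =>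
      pure (∃ OUT, Coded.decode y.1 = some OUT ∧
        (trollThrottle D N H P).TrollWin (n, ρ) k.1 y.2.2.toState OUT) := by
  change ((fun ρ => (n, ρ)) <$> P.setup n) >>= _ = _
  rw [bind_map_left]
  refine PMF.bind_congr' fun ρ hρ => ?_
  change ((fun k => (k.1, k)) <$> D.setup n) >>= _ = _
  rw [bind_map_left]
  refine PMF.bind_congr' fun k _ => ?_
  have h := (Prog.runT_map (O := gameOracle (game D N H P))
    (O' := (trollThrottle D N H P).trollOracle (n, ρ) k.1 k) (fun s => s.2.toState)
    (fun s => s.1 = ⟨n, ρ, k.1, k.2⟩) (fun v s hs => by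
      obtain ⟨p, l⟩ := s
      obtain rfl : p = _ := hs
      exact trollOracle_toState D N H P hρ k.1 k.2 v l) (gameOracle_par _) A
    (Coded.code ((n, ρ), k.1)) (⟨n, ρ, k.1, k.2⟩, Log.empty) rfl).1
  change A.runT _ _ (Log.toState Log.empty) >>= _ = _
  rw [h, bind_map_left]

end troll

/-! ## The reduction to user-controlled traceability -/

theorem honestId_injective : Function.Injective honestId := fun _ _ h =>
  (Prod.ext_iff.1 (Coded.code_injective h)).2

theorem joinedId_injective : Function.Injective joinedId := fun _ _ h =>
  (Prod.ext_iff.1 (Coded.code_injective h)).2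

/-- Two families of identities are needed: a user registered through `joinSystem` may afterwards be
created as an honest user, whereas an identity of the traceability game joins only once. -/
theorem honestId_ne_joinedId (U V : Data) : honestId U ≠ joinedId V := fun h => by
  simpa using (Prod.ext_iff.1 (Coded.code_injective h)).1

theorem Log.find_eq_some {l : Log} {U : Data} {x : Data × Data} (h : l.find U = some x) :
    ∃ e ∈ l.usk, e.1 = U ∧ e.2.1 = x.1 ∧ e.2.2.1 = x.2 := by
  obtain ⟨e, he, h⟩ := List.exists_of_findSome?_eq_some h
  split at h
  · rename_i hU
    simp only [Option.some.injEq] at h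
    subst h
    exact ⟨e, he, hU, rfl, rfl⟩
  · simp at h

section trace

variable (D : DAAScheme) (n : ℕ) (pk skI : Data)

theorem traceOracle_nil (s : TraceState) :
    D.traceOracle n pk skI .nil s = pure (Coded.code (none : Option Data), s) := rfl

theorem traceOracle_sign (S m : Data) (dom : Option Data) (s : TraceState) :
    D.traceOracle n pk skI (Coded.code ((0 : ℕ), (Coded.code (S, dom, m)))) s =
      (fun x => (Coded.code x.1, x.2)) <$> D.traceAnswer n pk skI s (.sign S dom m) := by
  simp only [DAAScheme.traceOracle, TraceQuery.decode, Coded.decode_code, Option.map_some,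
    PMF.map_eq_functor_map]

theorem traceOracle_hjoin (S : Data) (s : TraceState) :
    D.traceOracle n pk skI (Coded.code ((1 : ℕ), S)) s =
      (fun x => (Coded.code x.1, x.2)) <$> D.traceAnswer n pk skI s (.hjoin S) := by
  simp only [DAAScheme.traceOracle, TraceQuery.decode, Coded.decode_code, PMF.map_eq_functor_map]

theorem traceOracle_join (S sk : Data) (r : List Bool) (s : TraceState) :
    D.traceOracle n pk skI (Coded.code ((2 : ℕ), (Coded.code (S, sk, r)))) s =
      (fun x => (Coded.code x.1, x.2)) <$> D.traceAnswer n pk skI s (.join S sk r) := by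
  simp only [DAAScheme.traceOracle, TraceQuery.decode, Coded.decode_code, Option.map_some,
    PMF.map_eq_functor_map]

theorem traceOracle_corrupt (S : Data) (s : TraceState) :
    D.traceOracle n pk skI (Coded.code ((3 : ℕ), S)) s =
      (fun x => (Coded.code x.1, x.2)) <$> D.traceAnswer n pk skI s (.corrupt S) := by
  simp only [DAAScheme.traceOracle, TraceQuery.decode, Coded.decode_code, PMF.map_eq_functor_map]

end trace

section troll

variable (D : DAAScheme) (N : NymAlgorithms) (H : HashFunction) (P : ProofSystem D.RJoin)
  (E₂ : Data → Data → Data × Data → Data → PMF (Data × List Bool))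

theorem redPre_eq {i : Info} {k : ℕ} : action D P i = k → redPre D H P E₂ i =
    match k with
    | 0 => pure (if i.entry.isSome = true then Coded.code ((3 : ℕ), honestId i.user) else .nil,
        i, .nil)
    | 2 => pure (Coded.code ((1 : ℕ), honestId i.user), i, .nil)
    | 3 => (fun w => (Coded.code ((2 : ℕ), (Coded.code (joinedId i.user, w.1, w.2))), i, w.1)) <$>
        E₂ i.par.crs i.par.key (i.msg.left, i.par.pk) i.msg.right
    | 4 => pure (Coded.code ((0 : ℕ), (Coded.code (honestId i.user, some i.arg,
        H.hash i.par.n i.msg))), i, .nil)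
    | _ => pure (.nil, i, .nil) := by
  intro h
  unfold redPre
  rw [h]
  match k with
  | 0 => rfl
  | 1 => rfl
  | 2 => rfl
  | 3 => rfl
  | 4 => rfl
  | k + 5 => rfl

/-- Here `r.right` strips the code of `some` from the challenger's answer. The key of an honest user
is unknown to the reduction, so a leaf is recorded in its place. -/
theorem redPost_eq {i : Info} {k : ℕ} (y r : Data) : action D P i = k →
    redPost D N H P ((i, y), r) =
    match k with
    | 0 => (Coded.code (i.entry.map fun e => (Coded.code (r.right, e.2) : Data)),
        { cu := some i.user, rl := i.entry.map fun _ => r.right })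
    | 1 => (Coded.code (none : Option Data), { vm := some (i.arg, i.user) })
    | 2 => (Coded.code (some r.right), { usk := some (i.user, .nil, r.right, i.arg) })
    | 3 => (Coded.code (some r.right), { reg := some i.user, rl := some y })
    | 4 => commentResult H i r.right (N.nymExtract r.right)
    | _ => (Coded.code (none : Option Data), {}) := by
  intro h
  unfold redPost
  rw [h]
  match k with
  | 0 => rfl
  | 1 => rfl
  | 2 => rfl
  | 3 => rfl
  | 4 => rfl
  | k + 5 => rfl

/-- Which action is taken depends on whether an entry exists but not on its content, nor on the
secret component of the parameters. So the experiment, which holds the issuer's key, and the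
reduction, which holds a trapdoor and dummy user keys, always decide alike. -/
theorem action_congr {i j : Info} (hq : i.query = j.query) (hρ : i.par.crs = j.par.crs)
    (hpk : i.par.pk = j.par.pk) (hc : i.corrupted = j.corrupted)
    (he : i.entry.isSome = j.entry.isSome) (hv : i.verified = j.verified)
    (hr : i.registered = j.registered) : action D P i = action D P j := by
  obtain ⟨q, ⟨n, ρ, pk, key⟩, c, e, v, r⟩ := i
  obtain ⟨q', ⟨n', ρ', pk', key'⟩, c', e', v', r'⟩ := j
  simp only at hq hρ hpk hc he hv hr
  subst hq hρ hpk hc hv hr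
  cases e <;> cases e' <;> first | rfl | simp at he

/-- The oracle that the adversary sees in the reduction. -/
def redOracle (n : ℕ) (pk skI : Data) :
    Data → (Params × Log) × TraceState → PMF (Data × (Params × Log) × TraceState) :=
  substOracle (relay (simPre (redPre D H P E₂)) (simPost (redPost D N H P))
    (D.traceOracle n pk skI))

theorem redOracle_eq (n : ℕ) (pk skI v : Data) (p : Params) (l : Log) (ts : TraceState) :
    redOracle D N H P E₂ n pk skI v ((p, l), ts) =
      redPre D H P E₂ (lookup (v, p, l)) >>= fun e =>
      (fun r => ((redPost D N H P (e.2, r.1)).1, (p, l.add (redPost D N H P (e.2, r.1)).2), r.2)) <$>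
        D.traceOracle n pk skI e.1 ts := by
  simp only [redOracle, substOracle, relay, simPre, simPost, bind_map_left, map_bind,
    bind_pure_comp, Functor.map_map]

/-- The secret key of an identity. -/
def TraceState.keyOf (ts : TraceState) (S : Data) : Data := (ts.signers S).elim .nil DAASigner.sk

/-- The tables of the experiment that the reduction simulates. -/
def simulated (n : ℕ) (skI : Data) (s : (Params × Log) × TraceState) : Params × Log :=
  (⟨n, s.1.1.crs, s.1.1.pk, skI⟩,
    { s.1.2 with
      usk := s.1.2.usk.map fun e => (e.1, s.2.keyOf (honestId e.1), e.2.2.1, e.2.2.2)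
      rl := [] })

/-- The relation between the tables of the reduction and the state of the challenger. -/
structure RedInv (n : ℕ) (ρ pk τ : Data) (s : (Params × Log) × TraceState) : Prop where
  par : s.1.1 = ⟨n, ρ, pk, τ⟩
  honest : ∀ e ∈ s.1.2.usk, ∃ u, s.2.signers (honestId e.1) = some u ∧ u.cred = e.2.2.1
  unused : ∀ U, U ∉ s.1.2.usk.map Prod.fst → s.2.signers (honestId U) = none
  unjoined : ∀ U, U ∉ s.1.2.reg → s.2.signers (joinedId U) = none
  revoked : s.2.RL = s.1.2.rl
  exposed : ∀ sk ∈ s.1.2.rl, (∃ U ∈ s.1.2.cu, ∃ u, s.2.signers (honestId U) = some u ∧ u.sk = sk) ∨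
    ∃ U ∈ s.1.2.reg, ∃ u, s.2.signers (joinedId U) = some u ∧ u.sk = sk
  signed : ∀ x ∈ s.2.signed, ∃ U d m, x.2.1 = some d ∧ x.2.2.1 = H.hash n m ∧
    (U, N.nymExtract x.2.2.2, d, m,
      Coded.code (x.2.2.2, N.nymExtract x.2.2.2, d, H.hash n m)) ∈ s.1.2.comm
  comm : ∀ c ∈ s.1.2.comm, ∃ σ : Data, c.2.2.2.2 = Coded.code (σ, c.2.1, c.2.2.1, H.hash n c.2.2.2.1)
  confirmed : ∀ U ∈ s.1.2.reg, ∃ V, (V, U) ∈ s.1.2.vm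

/-- What has to be shown about one query. -/
theorem red_step {n : ℕ} {ρ pk skI τ v : Data} {s : (Params × Log) × TraceState} {ι : Type}
    (d : PMF ι) (g : ι → Data × (Params × Log) × TraceState)
    (hred : redOracle D N H P E₂ n pk skI v s = g <$> d)
    (hgame : gameOracle (game D N H P) v (simulated n skI s) =
      (fun k => ((g k).1, simulated n skI (g k).2)) <$> d)
    (hinv : ∀ k ∈ d.support, RedInv N H n ρ pk τ (g k).2) :
    gameOracle (game D N H P) v (simulated n skI s) =
      (fun r => (r.1, simulated n skI r.2)) <$> redOracle D N H P E₂ n pk skI v s ∧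
    ∀ r ∈ (redOracle D N H P E₂ n pk skI v s).support, RedInv N H n ρ pk τ r.2 := by
  refine ⟨by rw [hgame, hred, Functor.map_map], fun r hr => ?_⟩
  rw [hred, PMF.mem_support_map'] at hr
  obtain ⟨k, hk, rfl⟩ := hr
  exact hinv k hk

theorem red_step_pure {n : ℕ} {ρ pk skI τ v : Data} {s : (Params × Log) × TraceState}
    (y : Data × (Params × Log) × TraceState)
    (hred : redOracle D N H P E₂ n pk skI v s = pure y)
    (hgame : gameOracle (game D N H P) v (simulated n skI s) = pure (y.1, simulated n skI y.2))
    (hinv : RedInv N H n ρ pk τ y.2) :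
    gameOracle (game D N H P) v (simulated n skI s) =
      (fun r => (r.1, simulated n skI r.2)) <$> redOracle D N H P E₂ n pk skI v s ∧
    ∀ r ∈ (redOracle D N H P E₂ n pk skI v s).support, RedInv N H n ρ pk τ r.2 :=
  red_step D N H P E₂ (pure ()) (fun _ => y) (by rw [hred, map_pure]) (by rw [hgame, map_pure])
    fun _ _ => hinv

theorem find_simulated (n : ℕ) (skI : Data) (p : Params) (l : Log) (ts : TraceState) (U : Data) :
    (simulated n skI ((p, l), ts)).2.find U =
      (l.find U).map fun x => (ts.keyOf (honestId U), x.2) := by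
  simp only [Log.find, simulated]
  induction l.usk with
  | nil => rfl
  | cons e t ih =>
    simp only [List.map_cons, List.findSome?_cons]
    by_cases h : e.1 = U
    · simp [h]
    · simp only [h, if_false]; exact ih

variable {N} in
theorem RedInv.signer {n : ℕ} {ρ pk τ : Data} {s : (Params × Log) × TraceState}
    (h : RedInv N H n ρ pk τ s) {U : Data} {x : Data × Data} (hx : s.1.2.find U = some x) :
    ∃ u, s.2.signers (honestId U) = some u ∧ u.cred = x.2 := by
  obtain ⟨e, he, rfl, -, h2⟩ := Log.find_eq_some hx
  obtain ⟨u, hu, hc⟩ := h.honest e he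
  exact ⟨u, hu, hc.trans h2⟩

theorem entry_of_action_two {i : Info} (h : action D P i = 2) : i.entry = none := by
  unfold action at h
  split_ifs at h <;> first | omega | skip
  rename_i h3
  simp only [Info.fresh, Bool.and_eq_true, Bool.not_eq_true', Option.isSome_eq_false_iff,
    Option.isNone_iff_eq_none] at h3
  exact h3.2

theorem of_action_three {i : Info} (h : action D P i = 3) : i.verified = true ∧
    i.registered ≠ true ∧
    P.verifyProof i.par.crs (i.msg.left, i.par.pk) i.msg.right = true := by
  unfold action at h
  split_ifs at h <;> first | omega | exact ⟨‹_›, ‹_›, ‹_›⟩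

theorem entry_of_action_four {i : Info} (h : action D P i = 4) : ∃ x, i.entry = some x := by
  unfold action at h
  split_ifs at h <;> first | omega | exact Option.isSome_iff_exists.1 ‹_›

/-- The challenger's signers matter only for recorded honest users. The revocation list is dropped
because the experiment itself keeps none. -/
theorem simulated_add (n : ℕ) (skI : Data) (p : Params) (l : Log) (ts : TraceState) (δ : Delta)
    (hu : δ.usk = none) (ts' : TraceState)
    (hts : ∀ e ∈ l.usk, ts'.signers (honestId e.1) = ts.signers (honestId e.1)) :
    simulated n skI ((p, l.add δ), ts') = ((simulated n skI ((p, l), ts)).1,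
      (simulated n skI ((p, l), ts)).2.add { δ with rl := none }) := by
  simp only [simulated, Log.add, consOpt, hu, Prod.mk.injEq, Log.mk.injEq, true_and, Option.elim,
    and_true]
  refine List.map_congr_left fun e he => ?_
  rw [TraceState.keyOf, TraceState.keyOf, hts e he]

/-! ### One query of the reduction. -/

variable {D P} {n : ℕ} {ρ pk skI τ : Data}

/-- The simulation is exact for each query. Creating an honest user runs the same algorithms as
`hjoin`. For a registration, the extracted witness reproduces the submitted commitment, so the
challenger issues on the same input. For a comment, the pseudonym extracted from the signature is
the one generated from the unknown key. -/
theorem red_spec (hL : D.InstantlyLinkable N)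
    (hE : ∀ x π, P.verifyProof ρ x π = true → ∀ w ∈ (E₂ ρ τ x π).support, D.RJoin n x w)
    (v : Data) (s : (Params × Log) × TraceState) (hs : RedInv N H n ρ pk τ s) :
    gameOracle (game D N H P) v (simulated n skI s) =
      (fun r => (r.1, simulated n skI r.2)) <$> redOracle D N H P E₂ n pk skI v s ∧
    ∀ r ∈ (redOracle D N H P E₂ n pk skI v s).support, RedInv N H n ρ pk τ r.2 := by
  obtain ⟨⟨p, l⟩, ts⟩ := s
  obtain rfl : p = _ := hs.par
  set p : Params := ⟨n, ρ, pk, τ⟩ with hp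
  obtain ⟨i, hi⟩ : ∃ i, i = lookup (v, (p, l)) := ⟨_, rfl⟩
  obtain ⟨j, hj⟩ : ∃ j, j = lookup (v, simulated n skI ((p, l), ts)) := ⟨_, rfl⟩
  -- Experiment and reduction see the same tables, except for the secret parameter and the honest
  -- users' keys.
  have hij : j = { i with
      par := ⟨n, ρ, pk, skI⟩
      entry := i.entry.map fun x => (ts.keyOf (honestId i.user), x.2) } := by
    have h := find_simulated n skI p l ts i.user
    rw [hi] at h ⊢
    rw [hj, lookup]
    simp only [Info.mk.injEq]
    exact ⟨rfl, rfl, rfl, h, rfl, rfl⟩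
  have hact : action D P j = action D P i := by
    rw [hij]
    exact action_congr D P rfl (by rw [hi]; rfl) (by rw [hi]; rfl) rfl (by simp) rfl rfl
  have hR : i.Reflects p l := by rw [hi]; exact lookup_reflects v p l
  have hred := redOracle_eq D N H P E₂ n pk skI v p l ts
  rw [← hi] at hred
  have hgame : gameOracle (game D N H P) v (simulated n skI ((p, l), ts)) =
      (fun o => (o.1, (simulated n skI ((p, l), ts)).1,
        (simulated n skI ((p, l), ts)).2.add o.2)) <$> game D N H P j := by
    rw [gameOracle, ← hj]
  clear hi hj
  obtain ⟨k, hk⟩ : ∃ k, action D P i = k := ⟨_, rfl⟩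
  rw [redPre_eq D H P E₂ hk] at hred
  rw [game_eq D N H P (hact.trans hk)] at hgame
  match k with
  | 0 =>
    cases he : i.entry with
    | none =>
      simp only [pure_bind, he, Option.isSome_none, Bool.false_eq_true, if_false, traceOracle_nil,
        redPost_eq D N H P _ _ hk, map_pure, Option.map_none] at hred hgame
      refine red_step_pure D N H P E₂ _ hred ?_ ?_
      · rw [hgame, simulated_add _ _ _ _ _ _ rfl _ (fun _ _ => rfl), hij, he]
        rfl
      · refine { hs with exposed := fun sk hsk => ?_ }
        exact (hs.exposed sk hsk).imp_left (fun ⟨U, hU, h⟩ => ⟨U, List.mem_cons_of_mem _ hU, h⟩)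
    | some x =>
      obtain ⟨u, hu, hc⟩ := hs.signer H (hR.entry.symm.trans he)
      change ts.signers _ = _ at hu
      simp only [pure_bind, he, Option.isSome_some, if_true, traceOracle_corrupt,
        DAAScheme.traceAnswer, hu, map_pure, redPost_eq D N H P _ _ hk, Option.map_some] at hred hgame
      refine red_step_pure D N H P E₂ _ hred ?_ ?_
      · have hkey : ts.keyOf (honestId i.user) = u.sk := by rw [TraceState.keyOf, hu]; rfl
        rw [hgame, simulated_add _ _ _ _ _ _ rfl _ (fun _ _ => rfl), hij, he]
        simp only [Option.map_some, hkey]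
        rfl
      · refine { hs with
          revoked := congrArg (u.sk :: ·) hs.revoked
          exposed := fun sk hsk => ?_ }
        rcases List.mem_cons.1 hsk with rfl | hsk
        · exact Or.inl ⟨i.user, List.mem_cons_self, u, hu, rfl⟩
        · exact (hs.exposed sk hsk).imp_left (fun ⟨U, hU, h⟩ => ⟨U, List.mem_cons_of_mem _ hU, h⟩)
  | 1 =>
    simp only [pure_bind, traceOracle_nil, redPost_eq D N H P _ _ hk, map_pure] at hred hgame
    refine red_step_pure D N H P E₂ _ hred ?_ ?_
    · rw [hgame, simulated_add _ _ _ _ _ _ rfl _ (fun _ _ => rfl), hij]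
    · refine { hs with confirmed := fun U hU => ?_ }
      exact (hs.confirmed U hU).imp (fun V hV => List.mem_cons_of_mem _ hV)
  | 2 =>
    have h1 : i.user ∉ l.usk.map Prod.fst := by
      rw [← l.find_isSome, ← hR.entry, entry_of_action_two D P hk]; simp
    have h0 : ts.signers _ = none := hs.unused i.user h1
    simp only [pure_bind, traceOracle_hjoin, DAAScheme.traceAnswer, h0,
      Functor.map_map, redPost_eq D N H P _ _ hk] at hred hgame
    have h2 : ∀ k : Data × Data, ∀ e ∈ l.usk,
        (Function.update ts.signers (honestId i.user) (some ⟨k.1, k.2⟩)) (honestId e.1) =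
          ts.signers (honestId e.1) := fun k e he =>
      Function.update_of_ne (fun h => h1 (by
        rw [← honestId_injective h]; exact List.mem_map_of_mem he)) _ _
    have h3 : ∀ (k : Data × Data) U,
        (Function.update ts.signers (honestId i.user) (some ⟨k.1, k.2⟩)) (joinedId U) =
          ts.signers (joinedId U) := fun k U =>
      Function.update_of_ne (honestId_ne_joinedId _ _).symm _ _
    refine red_step D N H P E₂ (newUser D ⟨n, ρ, pk, skI⟩) (fun k => (Coded.code (some k.2),
      (p, l.add { usk := some (i.user, .nil, k.2, i.arg) }), { ts with
        signers := Function.update ts.signers (honestId i.user) (some ⟨k.1, k.2⟩) }))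
      ?_ ?_ fun k _ => ?_
    · rw [hred]
      simp only [newUser, map_bind, Functor.map_map, bind_pure_comp]
      rfl
    · rw [hgame, hij]
      congr 1
      funext k
      refine Prod.ext rfl (Prod.ext rfl ?_)
      simp only [simulated, Log.add, consOpt, Option.elim, List.map_cons, TraceState.keyOf,
        Function.update_self, Log.mk.injEq, true_and, and_true, List.cons.injEq]
      exact List.map_congr_left fun e he => by rw [h2 k e he]
    · refine { hs with honest := ?_, unused := ?_, unjoined := ?_, exposed := ?_ }
      · intro e he
        rcases List.mem_cons.1 he with rfl | he
        · exact ⟨_, Function.update_self _ _ _, rfl⟩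
        · obtain ⟨u, hu⟩ := hs.honest e he
          exact ⟨u, (h2 k e he).trans hu.1, hu.2⟩
      · intro U hU
        have hU' := not_or.1 (mt List.mem_cons.2 hU)
        exact (Function.update_of_ne (fun h => hU'.1 (honestId_injective h)) _ _).trans
          (hs.unused U hU'.2)
      · intro U hU
        exact (h3 k U).trans (hs.unjoined U hU)
      · intro sk hsk
        -- The update cannot overwrite an exposed signer, since the identity it concerns had no
        -- signer before.
        rcases hs.exposed sk hsk with ⟨U, hU, u, hu⟩ | ⟨U, hU, u, hu⟩
        · refine Or.inl ⟨U, hU, u, (Function.update_of_ne (fun h => ?_) _ _).trans hu.1, hu.2⟩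
          rw [h, hs.unused i.user h1] at hu
          simp at hu
        · exact Or.inr ⟨U, hU, u, (h3 k U).trans hu.1, hu.2⟩
  | 3 =>
    obtain ⟨h1, h2, h3⟩ := of_action_three D P hk
    rw [hR.verified] at h1
    rw [ne_eq, hR.registered] at h2
    rw [hR.par] at h3 hred
    have h4 : ts.signers _ = none := hs.unjoined i.user h2
    have h5 : ∀ sk cred U, (Function.update ts.signers (joinedId i.user)
        (some ⟨sk, cred⟩)) (honestId U) = ts.signers (honestId U) := fun _ _ _ =>
      Function.update_of_ne (honestId_ne_joinedId _ _) _ _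
    simp only [bind_map_left, traceOracle_join, DAAScheme.traceAnswer, h4,
      Functor.map_map, redPost_eq D N H P _ _ hk] at hred hgame
    refine red_step D N H P E₂ (E₂ ρ τ (i.msg.left, pk) i.msg.right >>= fun w =>
      (fun cred => (w.1, cred)) <$> D.issue skI i.msg.left) (fun k => (Coded.code (some k.2),
      (p, l.add { reg := some i.user, rl := some k.1 }), { ts with
        signers := Function.update ts.signers (joinedId i.user) (some ⟨k.1, k.2⟩)
        RL := k.1 :: ts.RL }))
      ?_ ?_ fun k _ => ?_
    · rw [hred, map_bind]
      refine PMF.bind_congr' fun w hw => ?_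
      obtain ⟨hr1, hr2⟩ := hE _ _ h3 w hw
      simp only at hr1 hr2
      -- The extracted coins have the required length, so the challenger does not refuse; the
      -- commitment it computes is the adversary's own.
      rw [if_pos hr1, ← hr2]
      simp only [Functor.map_map, bind_pure_comp]
      rfl
    · rw [hgame, hij, map_bind]
      have h6 := fun k : Data × Data => simulated_add n skI p l ts
        { reg := some i.user, rl := some k.1 } rfl { ts with
          signers := Function.update ts.signers (joinedId i.user) (some ⟨k.1, k.2⟩)
          RL := k.1 :: ts.RL } fun e _ => h5 k.1 k.2 e.1
      simp only [Functor.map_map, h6]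
      -- The extracted witness does not influence the answer or the simulated tables, so its
      -- distribution integrates out.
      exact (PMF.bind_const _ _).symm
    · refine { hs with
        honest := ?_, unused := ?_, unjoined := ?_, exposed := ?_, confirmed := ?_
        revoked := congrArg (k.1 :: ·) hs.revoked }
      · intro e he
        obtain ⟨u, hu⟩ := hs.honest e he
        exact ⟨u, (h5 k.1 k.2 _).trans hu.1, hu.2⟩
      · intro U hU
        exact (h5 k.1 k.2 _).trans (hs.unused U hU)
      · intro U hU
        have hU' := not_or.1 (mt List.mem_cons.2 hU)
        exact (Function.update_of_ne (fun h => hU'.1 (joinedId_injective h)) _ _).trans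
          (hs.unjoined U hU'.2)
      · intro sk hsk
        rcases List.mem_cons.1 hsk with rfl | hsk
        · exact Or.inr ⟨i.user, List.mem_cons_self, _, Function.update_self _ _ _, rfl⟩
        rcases hs.exposed sk hsk with ⟨U, hU, u, hu⟩ | ⟨U, hU, u, hu⟩
        · exact Or.inl ⟨U, hU, u, (h5 k.1 k.2 _).trans hu.1, hu.2⟩
        -- Earlier registered users keep their signers because the present user was not registered.
        · refine Or.inr ⟨U, List.mem_cons_of_mem _ hU, u,
            (Function.update_of_ne (fun h => h2 ?_) _ _).trans hu.1, hu.2⟩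
          rwa [← joinedId_injective h]
      · intro U hU
        rcases List.mem_cons.1 hU with rfl | hU
        · exact ⟨_, h1⟩
        · exact hs.confirmed U hU
  | 4 =>
    obtain ⟨x, hx⟩ := entry_of_action_four D P hk
    obtain ⟨u, hu, hc⟩ := hs.signer H (hR.entry.symm.trans hx)
    change ts.signers _ = _ at hu
    have hkey : ts.keyOf (honestId i.user) = u.sk := by rw [TraceState.keyOf, hu]; rfl
    simp only [pure_bind, traceOracle_sign, DAAScheme.traceAnswer, hu,
      Functor.map_map, redPost_eq D N H P _ _ hk, bind_pure_comp] at hred hgame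
    have hn : i.par.n = n := by rw [hR.par]
    refine red_step D N H P E₂ (D.sign u.sk u.cred (some i.arg) (H.hash n i.msg))
      (fun σ => ((commentResult H i σ (N.nymExtract σ)).1,
        (p, l.add (commentResult H i σ (N.nymExtract σ)).2), { ts with
          signed := insert (honestId i.user, some i.arg, H.hash n i.msg, σ) ts.signed }))
      ?_ ?_ fun σ _ => ?_
    · rw [hred, hn]
      rfl
    · rw [hgame, hij, hx, hc]
      simp only [Option.map_some, Option.getD_some, hkey]
      rw [← bind_pure_comp, ← bind_pure_comp]
      refine PMF.bind_congr' fun σ hσ => ?_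
      -- The experiment generates the pseudonym from the key, the reduction extracts it from the
      -- signature; instant linkability makes them equal.
      rw [hL.nymGen_eq _ _ _ _ σ hσ, simulated_add _ _ _ _ _ _ rfl _ fun _ _ => rfl]
      simp only [commentResult, hn]
      rfl
    · refine { hs with signed := ?_, comm := ?_ }
      · intro y hy
        rcases hy with rfl | hy
        · exact ⟨i.user, i.arg, i.msg, rfl, rfl, by
            simp [commentResult, Log.add, consOpt, hn]⟩
        · obtain ⟨U, d, m, h1, h2, h3⟩ := hs.signed y hy
          exact ⟨U, d, m, h1, h2, List.mem_cons_of_mem _ h3⟩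
      · intro c hc
        rcases List.mem_cons.1 hc with rfl | hc
        · exact ⟨σ, by simp [hn]⟩
        · exact hs.comm c hc
  | k + 5 =>
    simp only [pure_bind, traceOracle_nil, redPost_eq D N H P _ _ hk, map_pure] at hred hgame
    refine red_step_pure D N H P E₂ _ hred ?_ ?_
    · rw [hgame, simulated_add _ _ _ _ _ _ rfl _ (fun _ _ => rfl)]
    · exact hs

end troll

/-! ## Deciding the winning condition -/

/-- A datum, read as a list of data. -/
def Data.spine : Data → List Data
  | .nil => []
  | .pair a b => a :: b.spine

theorem Data.code_spine (d : Data) : Coded.code d.spine = d := by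
  induction d with
  | nil => rfl
  | pair a b _ ih => exact congrArg (Data.pair a) ih

@[fun_prop]
theorem Data.spine_poly : PolyTime Data.spine := .of_code_eq Data.code_spine

theorem Data.spine_ofNat (n : ℕ) : (Data.ofNat n).spine.length = n := by
  induction n with
  | zero => rfl
  | succ n ih => simp [Data.ofNat, Data.spine, ih]

/-- Read a datum as a tuple of an output list. -/
def Data.tuple (d : Data) : Data × Data × Data × Data :=
  (d.left, d.right.left, d.right.right.left, d.right.right.right)

@[fun_prop]
theorem Data.tuple_poly : PolyTime Data.tuple := by unfold Data.tuple; fun_prop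

/-- Decoding is replaced by rebuilding and comparing, which is visibly polynomial time. -/
theorem decode_tuple (d : Data) : (Coded.decode d : Option (Data × Data × Data × Data)) =
    if d = Coded.code d.tuple then some d.tuple else none := by
  match d with
  | .nil => rw [if_neg (by simp [Coded.code])]; rfl
  | .pair _ .nil => rw [if_neg (by simp [Coded.code, Data.tuple, Data.right])]; rfl
  | .pair _ (.pair _ .nil) => rw [if_neg (by simp [Coded.code, Data.tuple, Data.right])]; rfl
  | .pair a (.pair b (.pair c e)) =>
    have h : Data.pair a (.pair b (.pair c e)) =
        Coded.code (Data.pair a (.pair b (.pair c e))).tuple := rfl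
    rw [if_pos h]
    rfl

/-- The datum encodes a list of tuples. -/
def Data.isOutput (d : Data) : Bool := d.spine.all fun x => decide (x = Coded.code x.tuple)

/-- The tuples in an output, without repetitions. -/
def Data.output (d : Data) : List (Data × Data × Data × Data) :=
  collect (fun x => some x.tuple) d.spine

@[fun_prop]
theorem Data.isOutput_poly : PolyTime Data.isOutput := by
  unfold Data.isOutput
  exact PolyTime.listAll (by fun_prop) (by fun_prop)

@[fun_prop]
theorem Data.output_poly : PolyTime Data.output := by
  unfold Data.output
  exact PolyTime.collect (by fun_prop) (by fun_prop)

theorem Data.mem_output (d : Data) (e : Data × Data × Data × Data) :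
    e ∈ d.output ↔ e ∈ d.spine.map Data.tuple := by
  rw [Data.output, (collect_spec _ _).2]
  simp

theorem decode_output (d : Data) (l : List (Data × Data × Data × Data)) :
    (Coded.decode d : Option (List (Data × Data × Data × Data))) = some l ↔
      d.isOutput = true ∧ l = d.spine.map Data.tuple := by
  change Data.toList d = some l ↔ _
  induction d generalizing l with
  | nil =>
    simp only [Data.toList, Data.isOutput, Data.spine, Option.some.injEq, List.all_nil, true_and,
      List.map_nil]
    exact eq_comm
  | pair a b _ ih =>
    simp only [Data.toList, decode_tuple, Data.isOutput, Data.spine, List.all_cons,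
      Bool.and_eq_true, decide_eq_true_eq, List.map_cons]
    split_ifs with h
    · simp only [Option.bind_some, Option.map_eq_some_iff, ih]
      constructor
      · rintro ⟨t, ⟨h1, rfl⟩, rfl⟩; exact ⟨⟨h, h1⟩, rfl⟩
      · rintro ⟨⟨-, h1⟩, rfl⟩; exact ⟨_, ⟨h1, rfl⟩, rfl⟩
    · simp [h]

theorem length_collect_some {α : Type} [DecidableEq α] (l : List α) :
    (collect some l).length = l.toFinset.card := by
  rw [← List.toFinset_card_of_nodup (collect_spec some l).1]
  congr 1
  ext x
  rw [List.mem_toFinset, List.mem_toFinset, (collect_spec some l).2]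
  simp

section troll

variable (D : DAAScheme) (N : NymAlgorithms) (H : HashFunction) (P : ProofSystem D.RJoin)

/-- The parts of a comment: the signature and the hash of the message. -/
abbrev sigOf (e : Data × Data × Data × Data) : Data := e.2.2.2.left
abbrev hashOf (e : Data × Data × Data × Data) : Data := e.2.2.2.right.right.right

/-- Verification of a tuple of TrollThrottle. -/
def tupleOk (p : Params) (e : Data × Data × Data × Data) : Bool :=
  decide (e.2.2.2 = Coded.code (sigOf e, e.1, e.2.1, hashOf e)) &&
    (D.verify p.pk (hashOf e) (some e.2.1) (sigOf e) [] &&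
      (decide (H.hash p.n e.2.2.1 = hashOf e) && (decide (N.nymExtract (sigOf e) = e.1) &&
        N.verifyBsn (sigOf e) e.2.1)))

theorem verify_eq_tupleOk (p : Params) (e : Data × Data × Data × Data) :
    (trollThrottle D N H P).verify (p.n, p.crs) p.pk e.1 e.2.1 e.2.2.1 e.2.2.2 =
      tupleOk D N H p e := by
  obtain ⟨nym, dom, m, γ⟩ := e
  match γ with
  | .nil => rfl
  | .pair _ .nil => simp [trollThrottle, tupleOk, Coded.code]
  | .pair _ (.pair _ .nil) => simp [trollThrottle, tupleOk, Coded.code]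
  | .pair σ (.pair nym' (.pair dom' h')) =>
    rw [Bool.eq_iff_iff]
    simp only [trollThrottle, tupleOk, Bool.and_eq_true, decide_eq_true_eq]
    simp only [sigOf, hashOf, Data.left, Data.right, Coded.code, Data.pair.injEq, true_and,
      and_true, and_assoc]

theorem tupleOk_poly {α : Type} [Coded α] {f : α → Params} {g : α → Data × Data × Data × Data}
    (hf : PolyTime f) (hg : PolyTime g) : PolyTime fun a => tupleOk D N H (f a) (g a) := by
  have h1 : PolyTime fun a => D.verify (f a).pk (hashOf (g a)) (some (g a).2.1) (sigOf (g a)) [] :=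
    D.verify_poly.comp (f := fun a => ((f a).pk, hashOf (g a), some (g a).2.1, sigOf (g a), []))
      (by fun_prop)
  have h2 : PolyTime fun a => N.nymExtract (sigOf (g a)) := N.nymExtract_poly.comp (by fun_prop)
  have h3 : PolyTime fun a => N.verifyBsn (sigOf (g a)) (g a).2.1 :=
    N.verifyBsn_poly.comp (f := fun a => (sigOf (g a), (g a).2.1)) (by fun_prop)
  unfold tupleOk
  refine .and (by fun_prop) (.and h1 (.and (.decide_eq (by fun_prop) (by fun_prop))
    (.and (.decide_eq h2 (by fun_prop)) h3)))

/-- The pseudonyms for a basename in the output, without the recorded comments. -/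
def newNyms (y : Data × Params × Log) (dom : Data) : List Data :=
  collect (fun e => if e.2.1 = dom then
    if (y.2.2.comm.any fun c => decide (c.2 = e)) = true then none else some e.1 else none)
    y.1.output

/-- Whether the adversary has won. -/
def won (y : Data × Params × Log) : Bool :=
  y.1.isOutput && (y.1.output.all (tupleOk D N H y.2.1) &&
    y.1.output.any fun e => decide ((collect some y.2.2.cu).length +
      (collect some y.2.2.vm).length < (newNyms y e.2.1).length))

theorem won_poly : PolyTime (won D N H) := by
  have h1 : PolyTime fun x : (Data × Params × Log) × Data × Data × Data × Data =>
      (newNyms x.1 x.2.2.1).length := by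
    refine PolyTime.listLength.comp (PolyTime.collect (by fun_prop) ?_)
    refine PolyTime.ite (by fun_prop) (PolyTime.ite (PolyTime.bool_of_prop ?_) (by fun_prop)
      (by fun_prop)) (by fun_prop)
    exact PolyTime.listAny (by fun_prop) (by fun_prop)
  unfold won
  refine .and (by fun_prop) (.and (.listAll (by fun_prop) (tupleOk_poly D N H (by fun_prop)
    (by fun_prop))) (.listAny (by fun_prop) (.decide_lt (.add ?_ ?_) h1)))
  · exact PolyTime.listLength.comp (.collect (by fun_prop) (by fun_prop))
  · exact PolyTime.listLength.comp (.collect (by fun_prop) (by fun_prop))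

theorem length_newNyms (y : Data × Params × Log) (dom : Data) : (newNyms y dom).length =
    (((((y.1.spine.map Data.tuple).toFinset \ y.2.2.toState.COMM.image fun e => e.2).image
      fun e => (e.1, e.2.1)).filter fun e => e.2 = dom).image Prod.fst).card := by
  rw [newNyms, ← List.toFinset_card_of_nodup (collect_spec _ _).1]
  congr 1
  ext nym
  rw [List.mem_toFinset, (collect_spec _ _).2]
  simp only [Data.mem_output, Finset.mem_image, Finset.mem_filter, Finset.mem_sdiff,
    List.mem_toFinset, Log.toState, List.any_eq_true, decide_eq_true_eq]
  constructor
  · rintro ⟨e, he, h⟩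
    split_ifs at h with h1 h2
    exact ⟨(e.1, e.2.1), ⟨⟨e, ⟨he, h2⟩, rfl⟩, h1⟩, by simpa using h⟩
  · rintro ⟨_, ⟨⟨e, ⟨he, h2⟩, rfl⟩, h1⟩, rfl⟩
    exact ⟨e, he, by rw [if_pos h1, if_neg h2]⟩

theorem won_iff (y : Data × Params × Log) : won D N H y = true ↔
    ∃ OUT, Coded.decode y.1 = some OUT ∧
      (trollThrottle D N H P).TrollWin (y.2.1.n, y.2.1.crs) y.2.1.pk y.2.2.toState OUT := by
  simp only [decode_output, and_assoc, exists_and_left, exists_eq_left, won, Bool.and_eq_true,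
    CommentingScheme.TrollWin, verify_eq_tupleOk]
  refine and_congr_right fun _ => and_congr ?_ ?_
  · simp [Data.mem_output]
  · simp only [gt_iff_lt, Finset.lt_sup_iff, ← length_newNyms, length_collect_some,
      List.any_eq_true, decide_eq_true_eq]
    constructor
    · rintro ⟨e, -, h⟩
      refine ⟨e.2.1, ?_, h⟩
      -- `won` tries the basenames of all tuples, the experiment only those of the new ones. A
      -- basename with more pseudonyms than the bound has at least one, hence belongs to a new
      -- tuple.
      rw [length_newNyms] at h
      obtain ⟨nym, h⟩ := Finset.card_pos.1 ((Nat.zero_le _).trans_lt h)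
      obtain ⟨x, hx, -⟩ := Finset.mem_image.1 h
      obtain ⟨hx, hdom⟩ := Finset.mem_filter.1 hx
      exact Finset.mem_image.2 ⟨x, hx, hdom⟩
    · rintro ⟨dom, hdom, h⟩
      obtain ⟨x, hx, rfl⟩ := Finset.mem_image.1 hdom
      obtain ⟨e, he, rfl⟩ := Finset.mem_image.1 hx
      exact ⟨e, (Data.mem_output _ _).2 (List.mem_toFinset.1 (Finset.mem_sdiff.1 he).1), h⟩

/-- Two messages with the same hash among the output and the recorded comments. -/
def findCollision (y : Data × Params × Log) : Data × Data :=
  (y.1.output.findSome? fun e => y.2.2.comm.findSome? fun c =>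
    if c.2.2.2.1 = e.2.2.1 then none
    else if H.hash y.2.1.n c.2.2.2.1 = H.hash y.2.1.n e.2.2.1 then some (c.2.2.2.1, e.2.2.1)
    else none).getD (.nil, .nil)

theorem findCollision_poly : PolyTime (findCollision H) := by
  have h : PolyTime fun y : Data × Params × Log => y.1.output.findSome? fun e =>
      y.2.2.comm.findSome? fun c =>
        if c.2.2.2.1 = e.2.2.1 then none
        else if H.hash y.2.1.n c.2.2.2.1 = H.hash y.2.1.n e.2.2.1 then
          some (c.2.2.2.1, e.2.2.1) else none := by
    refine PolyTime.listFindSome (by fun_prop) (PolyTime.listFindSome (by fun_prop) ?_)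
    exact .ite (by fun_prop) (by fun_prop) (.ite (.decide_eq (by fun_prop) (by fun_prop))
      (by fun_prop) (by fun_prop))
  exact PolyTime.optionGetD h _

/-- The pair found need not come from the given `c` and `e`; their existence only ensures that the
search does not fail, and whatever it returns is a collision. -/
theorem findCollision_spec (y : Data × Params × Log) {e : Data × Data × Data × Data}
    (he : e ∈ y.1.output) {c : Data × Data × Data × Data × Data} (hc : c ∈ y.2.2.comm)
    (hne : c.2.2.2.1 ≠ e.2.2.1)
    (heq : H.hash y.2.1.n c.2.2.2.1 = H.hash y.2.1.n e.2.2.1) :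
    (findCollision H y).1 ≠ (findCollision H y).2 ∧
      H.hash y.2.1.n (findCollision H y).1 = H.hash y.2.1.n (findCollision H y).2 := by
  rw [findCollision]
  cases h : y.1.output.findSome? fun e => y.2.2.comm.findSome? fun c =>
      if c.2.2.2.1 = e.2.2.1 then none
      else if H.hash y.2.1.n c.2.2.2.1 = H.hash y.2.1.n e.2.2.1 then some (c.2.2.2.1, e.2.2.1)
      else none with
  | none =>
    have h1 := List.findSome?_eq_none_iff.1 (List.findSome?_eq_none_iff.1 h e he) c hc
    rw [if_neg hne, if_pos heq] at h1
    simp at h1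
  | some x =>
    obtain ⟨e, -, h1⟩ := List.exists_of_findSome?_eq_some h
    obtain ⟨c, -, h1⟩ := List.exists_of_findSome?_eq_some h1
    split_ifs at h1 with h2 h3
    simp only [Option.some.injEq] at h1
    subst h1
    exact ⟨h2, h3⟩

/-- A tuple that the revocation list does not explain and that is not a recorded comment, as a
forgery in the traceability game. -/
def findForgery (y : Data × Params × Log) : Data × Data × Data × Option Data :=
  (y.1.output.findSome? fun e =>
    if (tupleOk D N H y.2.1 e && (D.verify y.2.1.pk (hashOf e) (some e.2.1) (sigOf e) y.2.2.rl &&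
      !y.2.2.comm.any fun c => decide (c.2.2.2.2 = e.2.2.2))) = true
    then some (.nil, sigOf e, hashOf e, some e.2.1) else none).getD (.nil, .nil, .nil, none)

theorem findForgery_poly : PolyTime (findForgery D N H) := by
  have h1 : PolyTime fun x : (Data × Params × Log) × Data × Data × Data × Data =>
      D.verify x.1.2.1.pk (hashOf x.2) (some x.2.2.1) (sigOf x.2) x.1.2.2.rl :=
    D.verify_poly.comp (f := fun x : (Data × Params × Log) × Data × Data × Data × Data =>
      (x.1.2.1.pk, hashOf x.2, some x.2.2.1, sigOf x.2, x.1.2.2.rl)) (by fun_prop)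
  have h2 : PolyTime fun x : (Data × Params × Log) × Data × Data × Data × Data =>
      x.1.2.2.comm.any fun c => decide (c.2.2.2.2 = x.2.2.2.2) :=
    PolyTime.listAny (by fun_prop) (by fun_prop)
  have h3 : PolyTime fun x : (Data × Params × Log) × Data × Data × Data × Data =>
      tupleOk D N H x.1.2.1 x.2 := tupleOk_poly D N H (by fun_prop) (by fun_prop)
  have h4 : PolyTime fun y : Data × Params × Log => y.1.output.findSome? fun e =>
      if (tupleOk D N H y.2.1 e && (D.verify y.2.1.pk (hashOf e) (some e.2.1) (sigOf e) y.2.2.rl &&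
        !y.2.2.comm.any fun c => decide (c.2.2.2.2 = e.2.2.2))) = true
      then some ((.nil : Data), sigOf e, hashOf e, some e.2.1) else none :=
    PolyTime.listFindSome (by fun_prop) (PolyTime.ite (.bool_of_prop (.and h3 (.and h1 (.not h2))))
      (by fun_prop) (by fun_prop))
  exact PolyTime.optionGetD h4 _

/-! ### From a win to a collision or a forgery. -/

variable {D N H}

/-- The number of revoked keys is bounded by the number of corrupted users and verifications. -/
theorem RedInv.card_revoked {n : ℕ} {ρ pk τ : Data} {s : (Params × Log) × TraceState}
    (h : RedInv N H n ρ pk τ s) :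
    s.1.2.rl.toFinset.card ≤ s.1.2.cu.toFinset.card + s.1.2.vm.toFinset.card := by
  have h1 : s.1.2.rl.toFinset ⊆ (s.1.2.cu.toFinset.image fun U => s.2.keyOf (honestId U)) ∪
      s.1.2.reg.toFinset.image fun U => s.2.keyOf (joinedId U) := by
    intro sk hsk
    rcases h.exposed sk (List.mem_toFinset.1 hsk) with ⟨U, hU, u, hu, rfl⟩ | ⟨U, hU, u, hu, rfl⟩
    · refine Finset.mem_union_left _ (Finset.mem_image.2 ⟨U, List.mem_toFinset.2 hU, ?_⟩)
      rw [TraceState.keyOf, hu]; rfl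
    · refine Finset.mem_union_right _ (Finset.mem_image.2 ⟨U, List.mem_toFinset.2 hU, ?_⟩)
      rw [TraceState.keyOf, hu]; rfl
  -- Registration requires a malicious confirmation of that very user, so registered users inject
  -- into the malicious verifications.
  have h2 : s.1.2.reg.toFinset ⊆ s.1.2.vm.toFinset.image Prod.snd := fun U hU => by
    obtain ⟨V, hV⟩ := h.confirmed U (List.mem_toFinset.1 hU)
    exact Finset.mem_image.2 ⟨(V, U), List.mem_toFinset.2 hV, rfl⟩
  refine (Finset.card_le_card h1).trans ((Finset.card_union_le _ _).trans ?_)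
  exact add_le_add Finset.card_image_le
    (Finset.card_image_le.trans ((Finset.card_le_card h2).trans Finset.card_image_le))

/-- If the adversary wins in the simulated experiment, then it has found a collision, or the
reduction wins the traceability game. -/
theorem win_of_won (hL : D.InstantlyLinkable N) {n : ℕ} {ρ pk skI τ : Data} {out : Data}
    {s : (Params × Log) × TraceState} (h : RedInv N H n ρ pk τ s)
    (hw : won D N H (out, simulated n skI s) = true) :
    ((findCollision H (out, simulated n skI s)).1 ≠ (findCollision H (out, simulated n skI s)).2 ∧
      H.hash n (findCollision H (out, simulated n skI s)).1 =
        H.hash n (findCollision H (out, simulated n skI s)).2) ∨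
    ∃ S σ m dom, findForgery D N H (out, s.1) = (S, σ, m, dom) ∧ D.TraceWin pk s.2 S σ m dom := by
  have hpar := h.par
  have hok' : ∀ e, tupleOk D N H (simulated n skI s).1 e = tupleOk D N H s.1.1 e := fun e => by
    rw [hpar, simulated, hpar]; rfl
  refine or_iff_not_imp_left.2 fun hcol => ?_
  -- A signature obtained from a `sign` query on this basename and hash is recorded in a comment
  -- with the extracted pseudonym. By `tupleOk` that comment coincides with the one in the tuple,
  -- contrary to the last assumption. The identity named in the forgery plays no role here.
  have hforge : ∀ e ∈ out.output, tupleOk D N H s.1.1 e = true →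
      D.verify pk (hashOf e) (some e.2.1) (sigOf e) s.1.2.rl = true →
      (∀ c ∈ s.1.2.comm, c.2.2.2.2 ≠ e.2.2.2) →
      D.TraceWin pk s.2 .nil (sigOf e) (hashOf e) (some e.2.1) := by
    intro e _ he hv hc
    refine Or.inl ⟨by rw [h.revoked]; exact hv, ?_⟩
    rintro ⟨S, hS⟩
    obtain ⟨U, d, m, h1, h2, h3⟩ := h.signed _ hS
    simp only [Option.some.injEq] at h1 h2
    subst h1
    refine hc _ h3 ?_
    simp only [tupleOk, Bool.and_eq_true, decide_eq_true_eq] at he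
    rw [he.1]
    simp only [← h2, he.2.2.2.1]
  have hex : ∃ e ∈ out.output, tupleOk D N H s.1.1 e = true ∧
      D.verify pk (hashOf e) (some e.2.1) (sigOf e) s.1.2.rl = true ∧
      ∀ c ∈ s.1.2.comm, c.2.2.2.2 ≠ e.2.2.2 := by
    simp only [won, Bool.and_eq_true, List.all_eq_true, List.any_eq_true, decide_eq_true_eq,
      length_collect_some, hok'] at hw
    obtain ⟨-, hok, e₀, -, hlt⟩ := hw
    rw [newNyms, ← List.toFinset_card_of_nodup (collect_spec _ _).1] at hlt
    -- Each revoked key accounts for one pseudonym on the basename, so by counting some new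
    -- pseudonym comes from no revoked key.
    have hle : (s.1.2.rl.toFinset.image fun sk => N.nymGen sk e₀.2.1).card ≤
        s.1.2.cu.toFinset.card + s.1.2.vm.toFinset.card :=
      Finset.card_image_le.trans h.card_revoked
    obtain ⟨nym, hnym, hnot⟩ := Finset.exists_mem_notMem_of_card_lt_card (hle.trans_lt hlt)
    obtain ⟨e, he, h1⟩ := ((collect_spec _ _).2 _).1 (List.mem_toFinset.1 hnym)
    split_ifs at h1 with hdom hnew
    obtain rfl : e.1 = nym := by simpa using h1
    have hee := hok e he
    have hee' := hee
    simp only [tupleOk, Bool.and_eq_true, decide_eq_true_eq] at hee'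
    obtain ⟨hγ, hv, hh, hn, -⟩ := hee'
    rw [hpar] at hv hh
    refine ⟨e, he, hee, (D.verify_revocation _ _ _ _ _).2 ⟨hv, fun sk hsk => ?_⟩, fun c hc hcγ => ?_⟩
    -- Linked signatures have the same pseudonym, and that of `σ'` is generated from the revoked key
    -- `sk`.
    · rintro ⟨cred, m', σ', hσ', hlink⟩
      refine hnot (Finset.mem_image.2 ⟨sk, List.mem_toFinset.2 hsk, ?_⟩)
      rw [← hdom, hL.nymGen_eq _ _ _ _ _ hσ', ← (hL.link_iff _ _).1 hlink, hn]
    -- The comment determines pseudonym, basename and hash. Since the tuple is not recorded, the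
    -- recorded message must differ from it while having the same hash.
    · obtain ⟨σ, hσ⟩ := h.comm c hc
      rw [hσ, hγ] at hcγ
      have h2 := Coded.code_injective hcγ
      simp only [Prod.mk.injEq] at h2
      obtain ⟨h1, h3, h4, h5⟩ := h2
      refine hcol (findCollision_spec H (out, simulated n skI s) he hc (fun h6 => hnew ?_)
        (h5.trans hh.symm))
      refine List.any_eq_true.2 ⟨c, hc, decide_eq_true ?_⟩
      refine Prod.ext h3 (Prod.ext h4 (Prod.ext h6 ?_))
      rw [hσ, hγ, h1, h3, h4, h5]
  -- The search may return a tuple other than the one found above, but `hforge` applies to any tuple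
  -- that passes its test.
  rw [findForgery]
  cases hf : out.output.findSome? fun e =>
      if (tupleOk D N H s.1.1 e && (D.verify s.1.1.pk (hashOf e) (some e.2.1) (sigOf e) s.1.2.rl &&
        !s.1.2.comm.any fun c => decide (c.2.2.2.2 = e.2.2.2))) = true
      then some ((.nil : Data), sigOf e, hashOf e, some e.2.1) else none with
  | none =>
    obtain ⟨e, he, h1, h2, h3⟩ := hex
    have h4 := List.findSome?_eq_none_iff.1 hf e he
    have h2' : D.verify s.1.1.pk (hashOf e) (some e.2.1) (sigOf e) s.1.2.rl = true := by
      rwa [hpar]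
    rw [if_pos] at h4
    · simp at h4
    · rw [h1, h2']
      simpa using h3
  | some x =>
    obtain ⟨e, he, h1⟩ := List.exists_of_findSome?_eq_some hf
    split_ifs at h1 with h2
    simp only [Option.some.injEq] at h1
    simp only [Bool.and_eq_true, Bool.not_eq_true', List.any_eq_false, decide_eq_true_eq] at h2
    refine ⟨_, _, _, _, h1.symm, hforge e he h2.1 ?_ h2.2.2⟩
    have := h2.2.1
    rwa [hpar] at this

end troll

/-! ## Probabilities of events -/

theorem bind_pure_apply_true {α : Type} (d : PMF α) (p : α → Prop) :
    (d >>= fun a => pure (p a)) True = d.toOuterMeasure {a | p a} := by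
  have h : {a | p a} = p ⁻¹' {True} := by ext; simp
  rw [h, ← PMF.toOuterMeasure_map_apply, PMF.toOuterMeasure_apply_singleton, bind_pure_comp]
  rfl

theorem prob_le_add {α : Type} (d : PMF α) (p q r : α → Prop)
    (h : ∀ a ∈ d.support, p a → q a ∨ r a) :
    prob (d >>= fun a => pure (p a)) ≤
      prob (d >>= fun a => pure (q a)) + prob (d >>= fun a => pure (r a)) := by
  rw [prob, prob, prob, ← ENNReal.toReal_add (PMF.apply_ne_top _ _) (PMF.apply_ne_top _ _)]
  refine ENNReal.toReal_mono
    (ENNReal.add_ne_top.2 ⟨PMF.apply_ne_top _ _, PMF.apply_ne_top _ _⟩) ?_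
  simp only [bind_pure_apply_true]
  refine (PMF.toOuterMeasure_mono d (t := {a | q a} ∪ {a | r a}) ?_).trans
    (MeasureTheory.measure_union_le _ _)
  exact fun a ha => h a ha.2 ha.1

theorem prob_nonneg (d : PMF Prop) : 0 ≤ prob d := ENNReal.toReal_nonneg

theorem of_prob_eq_one {d : PMF Prop} (h : prob d = 1) {p : Prop} (hp : p ∈ d.support) : p := by
  have h1 : d True = 1 := by
    rwa [prob, ENNReal.toReal_eq_one_iff] at h
  rw [(PMF.apply_eq_one_iff d True).1 h1] at hp
  exact of_eq_true hp

theorem Negligible.add {f g : ℕ → ℝ} (hf : Negligible f) (hg : Negligible g) :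
    Negligible fun n => f n + g n :=
  Asymptotics.SuperpolynomialDecay.add hf hg

theorem Negligible.of_le {f g : ℕ → ℝ} (hg : Negligible g) (h0 : ∀ n, 0 ≤ f n)
    (h : ∀ n, f n ≤ g n) : Negligible f :=
  Asymptotics.SuperpolynomialDecay.trans_abs_le hg fun n => by
    rw [abs_of_nonneg (h0 n), abs_of_nonneg ((h0 n).trans (h n))]
    exact h n

/-! ## The reduction -/

section troll

variable (D : DAAScheme) (N : NymAlgorithms) (H : HashFunction) (P : ProofSystem D.RJoin)

/-- The first input of the adversary and the parameters, for a given reference string. -/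
def gameIni (x : ℕ × Data) : PMF (Data × Params) :=
  (fun k => (Coded.code (x, k.1), ⟨x.1, x.2, k.1, k.2⟩)) <$> D.setup x.1

theorem gameIni_ppt : PPT (gameIni D) := by
  have h : PPT fun x : ℕ × Data => D.setup x.1 :=
    D.setup_ppt.comp_polyTime (f := fun x : ℕ × Data => x.1) (by fun_prop)
  exact PPT.map (g := fun (x : ℕ × Data) (k : Data × Data) =>
    ((Coded.code (x, k.1), (⟨x.1, x.2, k.1, k.2⟩ : Params)) : Data × Params)) h (by fun_prop)

theorem len_le_gameIni (x : ℕ × Data) (r : Data × Params) (hr : r ∈ (gameIni D x).support) :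
    len x ≤ r.1.size := by
  obtain ⟨k, -, rfl⟩ := (PMF.mem_support_map' _ _ _).1 hr
  simp only [len_code, len_prod (α := ℕ × Data)]
  omega

/-- A run of the experiment with a given reference string. -/
def gameRun (A : Prog) (x : ℕ × Data) : PMF (Data × Params × Log) :=
  gameIni D x >>= fun r => A.runT (gameOracle (game D N H P)) r.1 (r.2, Log.empty)

theorem gameRun_ppt {A : Prog} (hA : A.IsOraclePPT) : PPT (gameRun D N H P A) :=
  game_ppt hA (gameIni_ppt D) (game_poly D N H P) (len_le_gameIni D) (game_usk D N H P)

/-- This is the shape of the distinguishing game for reference strings: sample the string, then run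
an efficient algorithm that returns a bit. -/
theorem trollExp_eq_won (A : Prog) (n : ℕ) : (trollThrottle D N H P).trollExp A n =
    P.setup n >>= fun ρ => (won D N H <$> gameRun D N H P A (n, ρ)) >>= fun b =>
      pure (b = true) := by
  rw [trollExp_eq]
  refine PMF.bind_congr' fun ρ _ => ?_
  simp only [gameRun, gameIni, bind_map_left, map_bind, bind_assoc]
  refine PMF.bind_congr' fun k _ => PMF.bind_congr' fun y hy => ?_
  have hp := Prog.runT_support (fun s => s.1 = (⟨n, ρ, k.1, k.2⟩ : Params)) (gameOracle_par _)
    A _ _ rfl y hy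
  congr 1
  rw [won_iff D N H P, hp]

/-! ### The traceability adversary and its joint run with the challenger. -/

variable (E₁ : ℕ → PMF (Data × Data))
  (E₂ : Data → Data → Data × Data → Data → PMF (Data × List Bool))

/-- The first input of the adversary in the reduction. -/
def redIni (x : Data) : PMF (Data × Params) :=
  if x = .pair (Coded.code x.left.spine.length) x.right then
    (fun e => (Coded.code ((x.left.spine.length, e.1), x.right),
      (⟨x.left.spine.length, e.1, x.right, e.2⟩ : Params))) <$> E₁ x.left.spine.length
  else pure (x, ⟨0, .nil, .nil, .nil⟩)

theorem redIni_ppt (hE : PPT E₁) : PPT (redIni E₁) := by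
  refine PPT.ite (by fun_prop) ?_ (PolyTime.ppt (by fun_prop))
  exact PPT.map (g := fun (x : Data) (e : Data × Data) =>
    ((Coded.code ((x.left.spine.length, e.1), x.right),
      (⟨x.left.spine.length, e.1, x.right, e.2⟩ : Params)) : Data × Params))
    (hE.comp_polyTime (PolyTime.listLength.comp (by fun_prop))) (by fun_prop)

theorem redIni_code (n : ℕ) (pk : Data) : redIni E₁ (Coded.code (n, pk)) =
    (fun e => (Coded.code ((n, e.1), pk), (⟨n, e.1, pk, e.2⟩ : Params))) <$> E₁ n := by
  have h : (Coded.code (n, pk) : Data).left.spine.length = n := Data.spine_ofNat n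
  unfold redIni
  rw [h]
  exact if_pos rfl

/-- The running time of an oracle adversary is bounded on all inputs, including malformed ones.
Those are handed on unchanged, so the inequality holds for them too. -/
theorem len_le_redIni (x : Data) (r : Data × Params) (hr : r ∈ (redIni E₁ x).support) :
    len x ≤ r.1.size := by
  unfold redIni at hr
  split_ifs at hr with h
  · obtain ⟨e, -, rfl⟩ := (PMF.mem_support_map' _ _ _).1 hr
    have h2 : len x = 1 + len x.left.spine.length + len x.right := by
      conv_lhs => rw [h]
      rw [len_data, Data.size, len_code, len_data]
    rw [h2]
    simp only [len_code, len_prod]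
    omega
  · rw [PMF.mem_support_pure'] at hr
    subst hr
    exact le_rfl

/-- The joint run of the challenger of the traceability game and the reduction. -/
def jointRun (A : Prog) (n : ℕ) :
    PMF (((Data × Data) × Data × Data) × Data × (Params × Log) × TraceState) :=
  D.setup n >>= fun k => E₁ n >>= fun e =>
    (fun y => ((k, e), y)) <$> A.runT (redOracle D N H P E₂ n k.1 k.2)
      (Coded.code ((n, e.1), k.1)) ((⟨n, e.1, k.1, e.2⟩, Log.empty), ⟨fun _ => none, [], ∅⟩)

/-- The traceability adversary. -/
theorem exists_traceAdversary {A : Prog} (hA : A.IsOraclePPT) (hE₁ : PPT E₁)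
    (hE₂ : PPT fun x : Data × Data × (Data × Data) × Data => E₂ x.1 x.2.1 x.2.2.1 x.2.2.2) :
    ∃ B : Prog, B.IsOraclePPT ∧ ∀ n, D.traceExp B n =
      jointRun D N H P E₁ E₂ A n >>= fun z => pure (∃ S σ m dom,
        findForgery D N H (z.2.1, z.2.2.1) = (S, σ, m, dom) ∧
          D.TraceWin z.1.1.1 z.2.2.2 S σ m dom) := by
  obtain ⟨B, hB1, hB2⟩ := exists_simulation (α := Data) (fin := fun y => pure (findForgery D N H y))
    hA (redIni_ppt E₁ hE₁) (redPre_poly D H P E₂ hE₂) (redPost_poly D N H P)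
    (findForgery_poly D N H).ppt (len_le_redIni E₁) (red_usk D N H P E₂)
  -- As the inputs are plain data, the time bound provided is literally `Prog.IsOraclePPT`.
  refine ⟨B, hB2, fun n => ?_⟩
  simp only [DAAScheme.traceExp, jointRun, bind_assoc, bind_map_left]
  refine PMF.bind_congr' fun k _ => ?_
  have h := hB1 TraceState (D.traceOracle n k.1 k.2) (Coded.code (n, k.1)) ⟨fun _ => none, [], ∅⟩
  change B.runT _ (Coded.code (n, k.1)) _ = _ at h
  change B.runT _ _ _ >>= _ = _
  rw [h, redIni_code]
  simp only [bind_map_left, bind_assoc, map_pure, pure_bind, Coded.decode_code, Option.some.injEq]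
  rfl

variable {E₁ E₂}

section joint

variable (hL : D.InstantlyLinkable N) (A : Prog) (n : ℕ)
  (hE : ∀ e ∈ (E₁ n).support, ∀ x π, P.verifyProof e.1 x π = true →
    ∀ w ∈ (E₂ e.1 e.2 x π).support, D.RJoin n x w)

include hL hE

/-- `red_spec` lifted from single queries to runs. The invariant holds at the start because all
tables are empty and no identity has joined. -/
theorem runT_redOracle (k : Data × Data) (e : Data × Data) (he : e ∈ (E₁ n).support) (x : Data) :
    A.runT (gameOracle (game D N H P)) x (⟨n, e.1, k.1, k.2⟩, Log.empty) =
      (fun r => (r.1, simulated n k.2 r.2)) <$> A.runT (redOracle D N H P E₂ n k.1 k.2) x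
        ((⟨n, e.1, k.1, e.2⟩, Log.empty), ⟨fun _ => none, [], ∅⟩) ∧
    ∀ r ∈ (A.runT (redOracle D N H P E₂ n k.1 k.2) x
        ((⟨n, e.1, k.1, e.2⟩, Log.empty), ⟨fun _ => none, [], ∅⟩)).support,
      RedInv N H n e.1 k.1 e.2 r.2 := by
  refine Prog.runT_map (simulated n k.2) (RedInv N H n e.1 k.1 e.2)
    (fun v s hs => (red_spec N H E₂ hL (hE e he) v s hs).1)
    (fun v s hs => (red_spec N H E₂ (skI := k.2) hL (hE e he) v s hs).2) A x
    ((⟨n, e.1, k.1, e.2⟩, Log.empty), ⟨fun _ => none, [], ∅⟩) ?_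
  constructor <;> simp [Log.empty]

/-- The simulation is perfect: no error term arises between the experiment with an extractable
reference string and the traceability game. -/
theorem gameRun_eq_jointRun : (E₁ n >>= fun e => gameRun D N H P A (n, e.1)) =
    (fun z => (z.2.1, simulated n z.1.1.2 z.2.2)) <$> jointRun D N H P E₁ E₂ A n := by
  simp only [gameRun, gameIni, bind_map_left, jointRun, map_bind, Functor.map_map]
  -- The traceability challenger draws the issuer's keys before the reduction draws the reference
  -- string; the two samplings are independent.
  refine (PMF.bind_comm _ _ _).trans (PMF.bind_congr' fun k _ => PMF.bind_congr' fun e he => ?_)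
  exact (runT_redOracle D N H P hL A n hE k e he _).1

theorem redInv_of_mem_jointRun {z} (hz : z ∈ (jointRun D N H P E₁ E₂ A n).support) :
    RedInv N H n z.1.2.1 z.1.1.1 z.1.2.2 z.2.2 := by
  obtain ⟨k, -, hz⟩ := (PMF.mem_support_bind' _ _ _).1 hz
  obtain ⟨e, he, hz⟩ := (PMF.mem_support_bind' _ _ _).1 hz
  obtain ⟨y, hy, rfl⟩ := (PMF.mem_support_map' _ _ _).1 hz
  exact (runT_redOracle D N H P hL A n hE k e he _).2 y hy

/-- All three events live on the joint run, where `win_of_won` and the union bound apply. The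
collision term is then read back in the experiment, which the collision finder can run by itself,
including the issuer. -/
theorem prob_won_le : prob (E₁ n >>= fun e => (won D N H <$> gameRun D N H P A (n, e.1)) >>=
      fun b => pure (b = true)) ≤
    prob (E₁ n >>= fun e => (findCollision H <$> gameRun D N H P A (n, e.1)) >>=
      fun c => pure (c.1 ≠ c.2 ∧ H.hash n c.1 = H.hash n c.2)) +
    prob (jointRun D N H P E₁ E₂ A n >>= fun z => pure (∃ S σ m dom,
      findForgery D N H (z.2.1, z.2.2.1) = (S, σ, m, dom) ∧
        D.TraceWin z.1.1.1 z.2.2.2 S σ m dom)) := by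
  have h := gameRun_eq_jointRun D N H P hL A n hE
  simp only [bind_map_left, ← bind_assoc, h]
  refine prob_le_add _ _ _ _ fun z hz hw => ?_
  exact win_of_won hL (redInv_of_mem_jointRun D N H P hL A n hE hz) hw

end joint

/-- The extraction hypothesis admits arbitrary algorithms, in particular one that outputs a fixed
`(x, π)` whatever the reference string. Since it holds with probability exactly one, it holds on
every outcome in the support. -/
theorem ProofSystem.extract_sound {n : ℕ}
    (h : ∀ A : ℕ → Data → PMF ((Data × Data) × Data), prob (do
      let (ρ, τ) ← E₁ n
      let (x, π) ← A n ρ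
      let w ← E₂ ρ τ x π
      pure (P.verifyProof ρ x π = false ∨ D.RJoin n x w)) = 1) :
    ∀ e ∈ (E₁ n).support, ∀ x π, P.verifyProof e.1 x π = true →
      ∀ w ∈ (E₂ e.1 e.2 x π).support, D.RJoin n x w := by
  intro e he x π hv w hw
  have h1 := of_prob_eq_one (h fun _ _ => pure (x, π))
    (p := P.verifyProof e.1 x π = false ∨ D.RJoin n x w) (by
      refine (PMF.mem_support_bind' _ _ _).2 ⟨e, he, ?_⟩
      refine (PMF.mem_support_bind' _ _ _).2 ⟨(x, π), (PMF.mem_support_pure' _ _).2 rfl, ?_⟩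
      exact (PMF.mem_support_bind' _ _ _).2 ⟨w, hw, (PMF.mem_support_pure' _ _).2 rfl⟩)
  simpa [hv] using h1

end troll

end

theorem mainTheorem1 (D : DAAScheme) (N : NymAlgorithms) (H : HashFunction)
    (P : ProofSystem D.RJoin)
    (hTrace : D.UserControlledTraceable) (hLink : D.InstantlyLinkable N)
    (hHash : H.CollisionResistant) (hPoK : P.IsProofOfKnowledge) :
    (trollThrottle D N H P).ProtectsAgainstTrolling := by
  intro A hA
  obtain ⟨E₁, E₂, hE₁, hE₂, hind, hext⟩ := hPoK
  have hE := fun n => P.extract_sound D (E₁ := E₁) (E₂ := E₂) fun A => hext A n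
  have hrun := gameRun_ppt D N H P hA
  -- The distinguisher runs the whole experiment with the given reference string and tests whether
  -- the adversary has won.
  have h1 := hind (fun x => won D N H <$> gameRun D N H P A x)
    (PPT.map (g := fun _ y => won D N H y) hrun ((won_poly D N H).comp (by fun_prop)))
  -- The collision finder runs the experiment with a reference string from `E₁` and searches the
  -- output and the recorded comments.
  have h2 := hHash (fun n => E₁ n >>= fun e => findCollision H <$> gameRun D N H P A (n, e.1))
    (PPT.bind (G := fun x : ℕ × Data × Data => findCollision H <$> gameRun D N H P A (x.1, x.2.1))
      hE₁ (PPT.map (g := fun _ y => findCollision H y)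
        (F := fun x : ℕ × Data × Data => gameRun D N H P A (x.1, x.2.1))
        (hrun.comp_polyTime (by fun_prop)) ((findCollision_poly H).comp (by fun_prop))))
  obtain ⟨B, hB, hBexp⟩ := exists_traceAdversary D N H P E₁ E₂ hA hE₁ hE₂
  have h3 := hTrace B hB
  refine Negligible.of_le (h1.add (h2.add h3)) (fun n => prob_nonneg _) fun n => ?_
  have h4 := prob_won_le D N H P hLink A n (hE n)
  rw [trollExp_eq_won, hBexp]
  have h5 : (E₁ n >>= fun e => (findCollision H <$> gameRun D N H P A (n, e.1)) >>= fun c =>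
      pure (c.1 ≠ c.2 ∧ H.hash n c.1 = H.hash n c.2)) =
      (E₁ n >>= fun e => findCollision H <$> gameRun D N H P A (n, e.1)) >>= fun c =>
        pure (c.1 ≠ c.2 ∧ H.hash n c.1 = H.hash n c.2) := (bind_assoc _ _ _).symm
  rw [h5] at h4
  -- The winning probability is at most the distinguishing gap plus the winning probability with an
  -- extractable string, and the latter is bounded by `h4`.
  refine le_trans ?_ (add_le_add_right h4 _)
  exact sub_le_iff_le_add.1 (le_abs_self _)
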